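/- **Setting.** Let $(\mathcal A,\tau,\tau',t)$ be a tracial real infinitesimal probability space: $\mathcal A$ is a unital complex algebra, $t:a\mapsto a^t$ is a linear involution on $\mathcal A$ with $(ab)^t=b^ta^t$, $\tau,\tau':\mathcal A\to\mathbb C$ are linear with $\tau(1)=1$, $\tau(a^t)=\tau(a)$, $\tau'(1)=0$, and $\tau(ab)=\tau(ba)$, $\tau'(ab)=\tau'(ba)$ for all $a,b$. **Cumulants.** Let $NC(n)$ be the set of non-crossing partitions of $[n]=\{1,\dots,n\}$. For $V=\{i_1<\dots<i_k\}\subseteq[n]$ write $f_{|V|}(a_1,\dots,a_n|V)=f_k(a_{i_1},\dots,a_{i_k})$. The free cumulants $\kappa_n$ are defined recursively by $\tau(a_1\cdots a_n)=\sum_{\pi\in NC(n)}\prod_{V\in\pi}\kappa_{|V|}(a_1,\dots,a_n|V)$. **Annular permutations.** On $[\pm n]=\{\pm1,\dots,\pm n\}$ let $\delta(k)=-k$, and let $\gamma_n=(1,2,\dots,n)$, acting trivially on negative points. Products of permutations are composed from right to left, and $\#(\cdot)$ is the number of cycles, including fixed points. $S^\delta_{NC}(n,-n)$ is the set of permutations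 $\sigma$ of $[\pm n]$ such that the orbit partitions of $\sigma$ and of $\gamma_n\delta\gamma_n^{-1}\delta$ have join the one-block partition, $\#(\sigma)+\#(\sigma^{-1}\gamma_n\delta\gamma_n^{-1}\delta)=2n$, and all cycles of $\sigma\delta$ have length two (this set is empty for $n=1$). The cycles of such a $\sigma$ come in conjugate pairs $\{c,\,\delta c^{-1}\delta\}$. Put $a_{(i)}=a_i$ and $a_{(-i)}=a_i^t$ for $i\in[n]$, and $$\kappa_{\sigma/2}(a_1,\dots,a_n)=\prod_{\{c,\,\delta c^{-1}\delta\}}\kappa_p\big(a_{(x_1)},\dots,a_{(x_p)}\big),$$ where the product is over all conjugate pairs of cycles of $\sigma$ and $c=(x_1,\dots,x_p)$ is one of the two cycles of the pair (the factor depends neither on which cycle is taken nor on its starting point). **Real infinitesimal cumulants.** The $\kappa'_n$ are defined recursively, for $n\ge1$, by $$\tau'(a_1\cdots a_n)=\sum_{\pi\in NC(n)}\partial\kappa_\pi(a_1,\dots,a_n)+\sum_{\sigma\in S^\delta_{NC}(n,-n)}\kappa_{\sigma/2}(a_1,\dots,a_n),$$ where $$\partial\kappa_\pi(a_1,\dots,a_n)=\sum_{V\in\pi}\kappa'_{|V|}(a_1,\dots,a_n|V)\prod_{W\in\pi,\,W\ne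 V}\kappa_{|W|}(a_1,\dots,a_n|W).$$ **Theorem.** Let $r\ge1$, $m_1,\dots,m_r\ge1$, $m=m_1+\dots+m_r$, $M=\{m_1,m_1+m_2,\dots,m_1+\dots+m_r\}$, let $\gamma_{\vec m}$ be the partition of $[m]$ into the consecutive intervals of lengths $m_1,\dots,m_r$, and let $\pm M=M\cup(-M)$. Let $a_1,\dots,a_m\in\mathcal A$ and $A_j=a_{m_1+\dots+m_{j-1}+1}\cdots a_{m_1+\dots+m_j}$ for $1\le j\le r$. For $\sigma\in S^\delta_{NC}(m,-m)$ let $K^\delta(\sigma)=\delta\gamma_m^{-1}\delta\sigma^{-1}\gamma_m$. A permutation is said to separate the points of a set if distinct points of the set lie in distinct cycles. Then $$\kappa'_r(A_1,\dots,A_r)=\sum_{\substack{\pi\in NC(m)\\ \pi\vee\gamma_{\vec m}=1_m}}\partial\kappa_\pi(a_1,\dots,a_m)+\sum_{\substack{\sigma\in S^\delta_{NC}(m,-m)\\ K^\delta(\sigma)\text{ separates the points of }\pm M}}\kappa_{\sigma/2}(a_1,\dots,a_m).$$ Moreover, for $\pi\in NC(m)$, viewed also as the permutation of $[m]$ whose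 cycles are the blocks of $\pi$ in increasing order, one has $\pi\vee\gamma_{\vec m}=1_m$ if and only if $K(\pi)=\pi^{-1}\gamma_m$ separates the points of $M$. -/

import Mathlib

namespace RealInf

/-! ### Real infinitesimal probability spaces -/

/-- A real infinitesimal (non-commutative) probability space `(A, τ, τ', t)`: a unital complex
algebra `A` with a linear anti-multiplicative involution `t` (the transpose), a linear functional
`τ` with `τ 1 = 1` that is invariant under `t`, and a linear functional `τ'` with `τ' 1 = 0`. -/
structure RealInfProbSpace (A : Type*) [Ring A] [Algebra ℂ A] where
  t : A →ₗ[ℂ] A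
  t_mul : ∀ a b, t (a * b) = t b * t a
  t_t : ∀ a, t (t a) = a
  τ : A →ₗ[ℂ] ℂ
  τ_one : τ 1 = 1
  τ_t : ∀ a, τ (t a) = τ a
  τ' : A →ₗ[ℂ] ℂ
  τ'_one : τ' 1 = 0

/-- Both functionals are traces. -/
def RealInfProbSpace.IsTracial {A : Type*} [Ring A] [Algebra ℂ A]
    (S : RealInfProbSpace A) : Prop :=
  (∀ a b, S.τ (a * b) = S.τ (b * a)) ∧ (∀ a b, S.τ' (a * b) = S.τ' (b * a))

/-! ### Non-crossing partitions (the set `[n]` is modelled by `Fin n`) -/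

/-- Partitions of `[n]`; the one-block partition `1_n` is `⊤`. -/
abbrev Part (n : ℕ) := Finpartition (Finset.univ : Finset (Fin n))

/-- `π` is non-crossing: if `i < j < k < l`, `i ∼ k` and `j ∼ l`, then `i ∼ j`. -/
def IsNonCrossing {n : ℕ} (π : Part n) : Prop :=
  ∀ i j k l : Fin n, i < j → j < k → k < l →
    π.part i = π.part k → π.part j = π.part l → π.part i = π.part j

open Classical in
/-- The set `NC(n)` of non-crossing partitions of `[n]`. -/
noncomputable def NC (n : ℕ) : Finset (Part n) :=
  Finset.univ.filter IsNonCrossing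

/-- The equivalence relation "to be in the same block of `π`". -/
def sameBlock {n : ℕ} (π : Part n) : Setoid (Fin n) := Setoid.ker π.part

/-- The restriction `a | V`: the subtuple of `a` indexed by `V`, in increasing order. -/
def restr {n : ℕ} {A : Type*} (a : Fin n → A) (V : Finset (Fin n)) : Fin V.card → A :=
  fun j => a (V.orderEmbOfFin rfl j)

theorem card_lt_of_ne_top {n : ℕ} {π : Part n} (h : π ≠ ⊤) {V : Finset (Fin n)}
    (hV : V ∈ π.parts) : V.card < n := by
  rcases lt_or_eq_of_le (card_finset_fin_le V) with h1 | h1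
  · exact h1
  · exfalso
    apply h
    have hu : V = Finset.univ := by
      apply Finset.eq_univ_of_card
      simpa using h1
    subst hu
    apply top_le_iff.mp
    intro W hW
    exact ⟨_, hV, Finset.subset_univ _⟩

theorem parts_top {n : ℕ} (hn : 0 < n) : (⊤ : Part n).parts = {Finset.univ} := by
  have : Nonempty (Fin n) := ⟨⟨0, hn⟩⟩
  apply Finset.eq_singleton_iff_unique_mem.mpr
  have key : ∀ V ∈ (⊤ : Part n).parts, V = Finset.univ := by
    intro V hV
    have := Finpartition.parts_top_subset (Finset.univ : Finset (Fin n)) hV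
    simpa using this
  refine ⟨?_, key⟩
  obtain ⟨V, hV⟩ := (⊤ : Part n).parts_nonempty (Finset.univ_nonempty.ne_empty)
  exact key V hV ▸ hV

theorem top_mem_NC (n : ℕ) : (⊤ : Part n) ∈ NC n := by
  classical
  rcases Nat.eq_zero_or_pos n with rfl | hn
  · simp only [NC, Finset.mem_filter, Finset.mem_univ, true_and]
    intro i
    exact i.elim0
  · have key : ∀ i : Fin n, (⊤ : Part n).part i = Finset.univ := by
      intro i
      have := (⊤ : Part n).part_mem.mpr (Finset.mem_univ i)
      rw [parts_top hn] at this
      simpa using this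
    simp only [NC, Finset.mem_filter, Finset.mem_univ, true_and]
    intro i j k l _ _ _ _ _
    rw [key, key]

theorem restr_univ {B : Type*} {n : ℕ} (f : (n : ℕ) → (Fin n → B) → ℂ) (a : Fin n → B) :
    f (Finset.univ : Finset (Fin n)).card (restr a Finset.univ) = f n a := by
  have gen : ∀ (k : ℕ) (h : (Finset.univ : Finset (Fin n)).card = k) (hk : k = n),
      f k (fun j => a (Finset.univ.orderEmbOfFin h j)) = f n a := by
    intro k h hk
    subst hk
    congr 1
    funext j
    have := Finset.orderEmbOfFin_unique h (f := (id : Fin k → Fin k))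
      (fun _ => Finset.mem_univ _) strictMono_id
    rw [← this]
    rfl
  exact gen _ rfl (by simp)

/-! ### Free cumulants -/

section

variable {A : Type*} [Ring A] [Algebra ℂ A] (S : RealInfProbSpace A)

/-- The free cumulants `κ_n(a_1, …, a_n)`, obtained by solving the moment-cumulant formula
`τ(a_1 ⋯ a_n) = ∑_{π ∈ NC(n)} ∏_{V ∈ π} κ_{|V|}(a | V)` recursively for the term `π = 1_n`
(see `RealInfProbSpace.moment_eq` below). -/
noncomputable def RealInfProbSpace.cumulant : (n : ℕ) → (Fin n → A) → ℂ
  | n, a => S.τ (List.ofFn a).prod -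
      ∑ π : {π : Part n // π ∈ (NC n).erase ⊤},
        ∏ V : {V : Finset (Fin n) // V ∈ π.1.parts},
          RealInfProbSpace.cumulant V.1.card (restr a V.1)
termination_by n => n
decreasing_by exact card_lt_of_ne_top (Finset.ne_of_mem_erase π.2) V.2

/-- `κ_π(a_1, …, a_n) = ∏_{V ∈ π} κ_{|V|}(a | V)`. -/
noncomputable def RealInfProbSpace.cumulantPart {n : ℕ} (π : Part n) (a : Fin n → A) : ℂ :=
  ∏ V ∈ π.parts, S.cumulant V.card (restr a V)

end

/-! ### Permutations of `[±n]` and symmetric annular non-crossing permutations -/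

/-- The set `[±n]`: `inl i` is the point `i`, and `inr i` is the point `-i`. -/
abbrev Pm (n : ℕ) := Fin n ⊕ Fin n

/-- The absolute value `[±n] → [n]`. -/
def Pm.abs {n : ℕ} : Pm n → Fin n := Sum.elim id id

/-- The permutation `δ(k) = -k` of `[±n]`. -/
def delta (n : ℕ) : Equiv.Perm (Pm n) := Equiv.sumComm (Fin n) (Fin n)

/-- `γ_n = (1, 2, …, n)` as a permutation of `[±n]`, acting trivially on `{-1, …, -n}`. -/
def gammaPm (n : ℕ) : Equiv.Perm (Pm n) := Equiv.Perm.sumCongr (finRotate n) 1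

/-- `γ_n δ γ_n⁻¹ δ = (1, …, n)(-n, …, -1)`. -/
def annulus (n : ℕ) : Equiv.Perm (Pm n) := gammaPm n * delta n * (gammaPm n)⁻¹ * delta n

/-- The number `#(σ)` of cycles of `σ`, fixed points included. -/
noncomputable def numCycles {α : Type*} (σ : Equiv.Perm α) : ℕ :=
  Nat.card (Quotient (Equiv.Perm.SameCycle.setoid σ))

/-- All cycles of `p` have length two. -/
def IsPairing {α : Type*} (p : Equiv.Perm α) : Prop := p * p = 1 ∧ ∀ x, p x ≠ x

/-- The defining conditions of `S_NC^δ(n, -n)`. (For `n = 1` no permutation satisfies them.) -/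
def IsSymmAnnularNC {n : ℕ} (σ : Equiv.Perm (Pm n)) : Prop :=
  Equiv.Perm.SameCycle.setoid σ ⊔ Equiv.Perm.SameCycle.setoid (annulus n) = ⊤ ∧
  numCycles σ + numCycles (σ⁻¹ * annulus n) = 2 * n ∧
  IsPairing (σ * delta n)

open Classical in
/-- The set `S_NC^δ(n, -n)` of symmetric non-crossing annular permutations. -/
noncomputable def SNC (n : ℕ) : Finset (Equiv.Perm (Pm n)) :=
  Finset.univ.filter IsSymmAnnularNC

section

variable {A : Type*} [Ring A] [Algebra ℂ A] (S : RealInfProbSpace A)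

/-- `a_i` at the point `i`, and the transpose `a_i^t` at the point `-i`. -/
def RealInfProbSpace.signed {n : ℕ} (a : Fin n → A) : Pm n → A :=
  Sum.elim a (fun i => S.t (a i))

/-- The cumulant of the entries of `a` (transposed at negative points) read along the cycle
`(x, σ x, σ² x, …)` of `σ` through `x`. -/
noncomputable def RealInfProbSpace.cycleCumulant {n : ℕ} (σ : Equiv.Perm (Pm n)) (a : Fin n → A)
    (x : Pm n) : ℂ :=
  S.cumulant (Function.minimalPeriod σ x)
    (fun j : Fin (Function.minimalPeriod σ x) => S.signed a ((σ ^ (j : ℕ)) x))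

open Classical in
/-- `κ_{σ/2}(a_1, …, a_n)`: the product over the conjugate pairs `{c, δ c⁻¹ δ}` of cycles of `σ` of
the cumulant read along one of the two cycles. Every conjugate pair contains exactly one cycle that
passes through a point `i > 0` with `i ≤ |x|` for all points `x` of the cycle; that cycle is the
representative, and it is read from `i` on. (As `τ` is a trace invariant under the transpose,
the contribution depends neither on the representative nor on the starting point.) -/
noncomputable def RealInfProbSpace.cumulantHalf {n : ℕ} (σ : Equiv.Perm (Pm n))
    (a : Fin n → A) : ℂ :=
  ∏ i ∈ Finset.univ.filter (fun i : Fin n => ∀ x, σ.SameCycle (Sum.inl i) x → i ≤ Pm.abs x),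
    S.cycleCumulant σ a (Sum.inl i)

/-! ### Real infinitesimal cumulants -/

/-- The real infinitesimal cumulants `κ'_n(a_1, …, a_n)`, obtained by solving
`τ'(a_1 ⋯ a_n) = ∑_{π ∈ NC(n)} ∂κ_π(a_1, …, a_n) + ∑_{σ ∈ S_NC^δ(n, -n)} κ_{σ/2}(a_1, …, a_n)`
recursively for the term `∂κ_{1_n} = κ'_n` (see `RealInfProbSpace.infMoment_eq` below). -/
noncomputable def RealInfProbSpace.infCumulant : (n : ℕ) → (Fin n → A) → ℂ
  | n, a => S.τ' (List.ofFn a).prod -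
      (∑ π : {π : Part n // π ∈ (NC n).erase ⊤},
        ∑ V : {V : Finset (Fin n) // V ∈ π.1.parts},
          RealInfProbSpace.infCumulant V.1.card (restr a V.1) *
            ∏ W ∈ π.1.parts.erase V.1, S.cumulant W.card (restr a W)) -
      ∑ σ ∈ SNC n, S.cumulantHalf σ a
termination_by n => n
decreasing_by exact card_lt_of_ne_top (Finset.ne_of_mem_erase π.2) V.2

/-- `∂κ_π(a_1, …, a_n) = ∑_{V ∈ π} κ'_{|V|}(a | V) ∏_{W ≠ V} κ_{|W|}(a | W)`. -/
noncomputable def RealInfProbSpace.dCumulantPart {n : ℕ} (π : Part n) (a : Fin n → A) : ℂ :=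
  ∑ V ∈ π.parts, S.infCumulant V.card (restr a V) *
    ∏ W ∈ π.parts.erase V, S.cumulant W.card (restr a W)

/-! ### Checks of the recursive definitions -/

/-- The moment-cumulant formula. -/
theorem RealInfProbSpace.moment_eq {n : ℕ} (hn : 0 < n) (a : Fin n → A) :
    S.τ (List.ofFn a).prod = ∑ π ∈ NC n, S.cumulantPart π a := by
  have h1 : S.cumulantPart (⊤ : Part n) a = S.cumulant n a := by
    unfold RealInfProbSpace.cumulantPart
    rw [parts_top hn, Finset.prod_singleton]
    exact restr_univ S.cumulant a
  have h2 : S.cumulant n a = S.τ (List.ofFn a).prod -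
      ∑ π ∈ (NC n).erase ⊤, S.cumulantPart π a := by
    conv_lhs => rw [RealInfProbSpace.cumulant]
    rw [← Finset.sum_coe_sort ((NC n).erase ⊤)]
    congr 1
    refine Finset.sum_congr rfl fun π _ => ?_
    exact Finset.prod_coe_sort π.1.parts (fun V => S.cumulant V.card (restr a V))
  rw [← Finset.add_sum_erase _ _ (top_mem_NC n), h1, h2]
  ring

/-- The infinitesimal moment-cumulant formula that defines the real infinitesimal cumulants. -/
theorem RealInfProbSpace.infMoment_eq {n : ℕ} (hn : 0 < n) (a : Fin n → A) :
    S.τ' (List.ofFn a).prod =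
      ∑ π ∈ NC n, S.dCumulantPart π a + ∑ σ ∈ SNC n, S.cumulantHalf σ a := by
  have h1 : S.dCumulantPart (⊤ : Part n) a = S.infCumulant n a := by
    unfold RealInfProbSpace.dCumulantPart
    rw [parts_top hn, Finset.sum_singleton]
    simp only [Finset.erase_singleton, Finset.prod_empty, mul_one]
    exact restr_univ S.infCumulant a
  have h2 : S.infCumulant n a = S.τ' (List.ofFn a).prod -
      ∑ π ∈ (NC n).erase ⊤, S.dCumulantPart π a - ∑ σ ∈ SNC n, S.cumulantHalf σ a := by
    conv_lhs => rw [RealInfProbSpace.infCumulant]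
    rw [← Finset.sum_coe_sort ((NC n).erase ⊤)]
    congr 2
    refine Finset.sum_congr rfl fun π _ => ?_
    exact Finset.sum_coe_sort π.1.parts (fun V => S.infCumulant V.card (restr a V) *
      ∏ W ∈ π.1.parts.erase V, S.cumulant W.card (restr a W))
  rw [← Finset.add_sum_erase _ _ (top_mem_NC n), h1, h2]
  ring

end

/-! ### Products as entries -/

/-- For `m = m_1 + ⋯ + m_r` with all `m_j ≥ 1` (a `Composition` of `m` with `r = c.length`), the
tuple `(A_1, …, A_r)` of consecutive products `A_j = a_{m_1 + ⋯ + m_{j-1} + 1} ⋯ a_{m_1 + ⋯ + m_j}`. -/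
def consecutiveProducts {A : Type*} [Ring A] {m : ℕ} (c : Composition m) (a : Fin m → A) :
    Fin c.length → A :=
  fun j => (List.ofFn fun i => a (c.embedding j i)).prod

/-- The equivalence relation whose classes are the blocks (intervals) of `γ_m⃗`. -/
def sameInterval {m : ℕ} (c : Composition m) : Setoid (Fin m) := Setoid.ker c.index

/-- `M = {m_1, m_1 + m_2, …, m_1 + ⋯ + m_r}`; the point `k ∈ [m]` is the element of `Fin m` with
value `k - 1`. -/
def endpoints {m : ℕ} (c : Composition m) : Set (Fin m) :=
  {x | ∃ j : Fin c.length, (x : ℕ) + 1 = c.sizeUpTo ((j : ℕ) + 1)}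

/-- `±M`. -/
def pmEndpoints {m : ℕ} (c : Composition m) : Set (Pm m) := {x | Pm.abs x ∈ endpoints c}

/-- `σ` separates the points of `M`: distinct points of `M` are in distinct cycles of `σ`. -/
def Separates {α : Type*} (σ : Equiv.Perm α) (M : Set α) : Prop :=
  ∀ x ∈ M, ∀ y ∈ M, σ.SameCycle x y → x = y

/-- The Kreweras complement `K^δ(σ) = δ γ_m⁻¹ δ σ⁻¹ γ_m`. -/
def krewerasDelta {m : ℕ} (σ : Equiv.Perm (Pm m)) : Equiv.Perm (Pm m) :=
  delta m * (gammaPm m)⁻¹ * delta m * σ⁻¹ * gammaPm m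

theorem blockPerm_commute {n : ℕ} (π : Part n) :
    (π.parts : Set (Finset (Fin n))).Pairwise
      (Function.onFun Commute fun V => (V.sort (· ≤ ·)).formPerm) := by
  intro V hV W hW hVW
  apply Equiv.Perm.Disjoint.commute
  rw [Equiv.Perm.disjoint_iff_disjoint_support]
  have h := π.disjoint hV hW hVW
  refine Finset.disjoint_of_subset_left ?_ (Finset.disjoint_of_subset_right ?_ h)
  · simpa using List.support_formPerm_le (V.sort (· ≤ ·))
  · simpa using List.support_formPerm_le (W.sort (· ≤ ·))

/-- The partition `π` viewed as the permutation whose cycles are the blocks of `π`, with the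
elements of each block in increasing order. -/
def blockPerm {n : ℕ} (π : Part n) : Equiv.Perm (Fin n) :=
  π.parts.noncommProd (fun V => (V.sort (· ≤ ·)).formPerm) (blockPerm_commute π)

/-- The Kreweras complement `K(π) = π⁻¹ γ_m`. -/
def kreweras {m : ℕ} (π : Part m) : Equiv.Perm (Fin m) := (blockPerm π)⁻¹ * finRotate m

open Classical in
/-- The set of all `π ∈ NC(m)` with `π ∨ γ_m⃗ = 1_m`. -/
noncomputable def joiningNC {m : ℕ} (c : Composition m) : Finset (Part m) :=
  (NC m).filter fun π => sameBlock π ⊔ sameInterval c = ⊤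

open Classical in
/-- The set of all `σ ∈ S_NC^δ(m, -m)` such that `K^δ(σ)` separates the points of `±M`. -/
noncomputable def separatingSNC {m : ℕ} (c : Composition m) : Finset (Equiv.Perm (Pm m)) :=
  (SNC m).filter fun σ => Separates (krewerasDelta σ) (pmEndpoints c)

end RealInf

/-! Both moment-cumulant formulas are instances of one formula over the dual numbers. Put
`dualMoment` = τ + ετ' and `dualCumulant` = κ + εκ' with ε² = 0, and index everything by pairings P
of [±n]. Such a P forms loops with `delta` (edges {i, -i}) and with `gap` (edges {-i, i+1}). The
loops with `delta` are the conjugate pairs of cycles of σ = Pδ, the loops with `gap` those of the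
Kreweras complement, and `totalLoops P` is, up to a shift, the Euler characteristic of a glued
surface. For n ≥ 1 its maximum n+1 is attained exactly by the non-crossing partitions
(`totalLoops_eq_iff`, the sphere) and the value n exactly by S_NC^δ(n,-n) (`mem_SNC_iff`, the
projective plane). Hence `MomentFormula`: a moment is the sum over all P of ε^(n+1-`totalLoops P`)
times the cumulants of the words of Pδ. On planar terms the Leibniz rule produces ∂κ_π, one factor ε
leaves κ_{σ/2}, and everything else is killed by ε².

The engine is the removal of the points -i and i+1, which form an edge of `gap`. Every pairing P of
[±(n+1)] comes from exactly one pairing P' of [±n], either by adding the edge {-i, i+1} or by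
inserting the two points on an edge {y, P'y} in one of its two directions (`sum_pairings_succ`). An
insertion on an edge does not alter the loops with `gap`. On the loops with `delta` it splits the
cycle of i, reverses a part of it, or merges it with another loop, according to where y lies.
Relative to the maximum, which grows by one, this costs zero, one or two loops, that is a factor 1,
ε or ε² = 0.

Summed over the insertions into a fixed P', this turns the cumulant with entry xy into
`splitExpansion` (`weight_insert_sum`). Comparing the formulas for the moments of (x, y, w) and (xy,
w) and cancelling all P' except `gap`, the one-block partition, gives the rule for a single product
(`cumulant_mul_cons`). The same scheme with a relabelling instead of an insertion shows that
cumulants are invariant under rotation and, for κ, under reversed transposition. Each of these facts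
is first proved over ℂ with ε = 0 and then feeds the terms with a factor ε over the dual numbers.

Merging neighbours in a common interval one pair at a time then yields the theorem
(`cumulant_fiberProd`). Insertions change neither the loops with `gap` nor the last points of the
intervals, so the condition that these loops separate the last points is carried along; when no
interval has two points it singles out `gap`. This condition is the one on K^δ
(`separates_krewerasDelta`), and for planar P the same induction identifies it with π ∨ γ = 1
(`joins_iff`). -/

namespace RealInf
open Equiv Equiv.Perm

/-! ### Two pairings and the loops they form -/

section Loops

variable {X : Type*}

theorem IsPairing.apply_apply {P : Perm X} (h : IsPairing P) (x : X) : P (P x) = x := by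
  have := congrArg (fun f : Perm X => f x) h.1
  simpa using this

theorem IsPairing.apply_eq_iff {P : Perm X} (h : IsPairing P) {x y : X} : P x = y ↔ x = P y :=
  ⟨fun e => by rw [← e, h.apply_apply], fun e => by rw [e, h.apply_apply]⟩

theorem IsPairing.inv_eq {P : Perm X} (h : IsPairing P) : P⁻¹ = P :=
  inv_eq_of_mul_eq_one_left h.1

theorem IsPairing.inv_mul {P D : Perm X} (hP : IsPairing P) (hD : IsPairing D) :
    (P * D)⁻¹ = D * P := by
  rw [mul_inv_rev, hP.inv_eq, hD.inv_eq]

theorem IsPairing.conj_zpow {P D : Perm X} (hP : IsPairing P) (hD : IsPairing D) (k : ℤ) (x : X) :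
    D (((P * D) ^ k) x) = ((P * D) ^ (-k)) (D x) := by
  have h : D * (P * D) * D⁻¹ = (P * D)⁻¹ := by
    rw [hP.inv_mul hD, mul_assoc, mul_assoc, mul_inv_cancel, mul_one]
  have h2 : D * (P * D) ^ k * D⁻¹ = (P * D) ^ (-k) := by
    rw [← _root_.conj_zpow, h, inv_zpow, zpow_neg]
  rw [← h2]
  simp

/-- A power of `P * D` taking `x` to `D x` could be halved, because `D` inverts `P * D` under
conjugation. For an even exponent the midpoint gives a fixed point of `D`, for an odd one a fixed
point of `P`, and pairings have none. -/
theorem IsPairing.not_sameCycle {P D : Perm X} (hP : IsPairing P) (hD : IsPairing D) (x : X) :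
    ¬ SameCycle (P * D) x (D x) := by
  rintro ⟨k, hk⟩
  rcases Int.even_or_odd' k with ⟨j, rfl | rfl⟩
  · have h1 : ((P * D) ^ j) x = ((P * D) ^ (-j)) (D x) := by
      rw [← hk, ← Perm.mul_apply, ← zpow_add]
      congr 2
      ring
    rw [← hP.conj_zpow hD] at h1
    exact hD.2 _ h1.symm
  · have h1 : ((P * D) ^ (j + 1)) x = ((P * D) ^ (-j)) (D x) := by
      rw [← hk, ← Perm.mul_apply, ← zpow_add]
      congr 2
      ring
    rw [← hP.conj_zpow hD, add_comm, zpow_add, zpow_one, Perm.mul_apply, Perm.mul_apply] at h1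
    exact hP.2 _ h1

theorem IsPairing.sameCycle_conj {P D : Perm X} (hP : IsPairing P) (hD : IsPairing D) {x y : X}
    (h : SameCycle (P * D) x y) : SameCycle (P * D) (D x) (D y) := by
  obtain ⟨k, rfl⟩ := h
  exact ⟨-k, (hP.conj_zpow hD k x).symm⟩

/-- The equivalence relation whose classes are the loops formed by the edges of `P` and `D`. -/
def loops (P D : Perm X) : Setoid X := Relation.EqvGen.setoid fun x y => y = P x ∨ y = D x

theorem loops_left (P D : Perm X) (x : X) : loops P D x (P x) := .rel _ _ (.inl rfl)

theorem loops_right (P D : Perm X) (x : X) : loops P D x (D x) := .rel _ _ (.inr rfl)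

theorem loops_le {P D : Perm X} {r : Setoid X} (h1 : ∀ x, r x (P x)) (h2 : ∀ x, r x (D x)) :
    loops P D ≤ r := by
  intro x y h
  induction h with
  | rel x y h => rcases h with rfl | rfl; exacts [h1 x, h2 x]
  | refl x => exact r.refl x
  | symm x y _ ih => exact r.symm ih
  | trans x y z _ _ ih1 ih2 => exact r.trans ih1 ih2

theorem loops_of_sameCycle {P D : Perm X} {x y : X} (h : SameCycle (P * D) x y) :
    loops P D x y := by
  have hc : SameCycle.setoid (P * D) ≤ loops P D := by
    have key : ∀ z, loops P D z ((P * D) z) := fun z =>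
      (loops P D).trans (loops_right P D z) (loops_left P D _)
    rintro x y ⟨k, rfl⟩
    revert x
    induction k using Int.induction_on with
    | zero => exact fun x => (loops P D).refl _
    | succ k ih =>
      intro x
      have := @ih ((P * D) x)
      rw [← Perm.mul_apply, ← zpow_add_one] at this
      exact (loops P D).trans (key x) this
    | pred k ih =>
      intro x
      have := @ih ((P * D)⁻¹ x)
      rw [← Perm.mul_apply, ← zpow_sub_one] at this
      refine (loops P D).trans ?_ this
      simpa using (loops P D).symm (key ((P * D)⁻¹ x))
  exact hc h

/-- The right-hand side is already an equivalence relation that contains the edges of both pairings: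
a loop consists of a cycle of `P * D` and its mirror image under `D`. -/
theorem loops_iff {P D : Perm X} (hP : IsPairing P) (hD : IsPairing D) {x y : X} :
    loops P D x y ↔ SameCycle (P * D) x y ∨ SameCycle (P * D) (D x) y := by
  constructor
  · let r : Setoid X :=
      { r := fun x y => SameCycle (P * D) x y ∨ SameCycle (P * D) (D x) y
        iseqv := by
          refine ⟨fun x => .inl (.refl _ _), ?_, ?_⟩
          · rintro x y (h | h)
            · exact .inl h.symm
            · exact .inr (by simpa [hD.apply_apply] using (hP.sameCycle_conj hD h).symm)
          · rintro x y z (h | h) (h' | h')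
            · exact .inl (h.trans h')
            · exact .inr ((hP.sameCycle_conj hD h).trans h')
            · exact .inr (h.trans h')
            · refine .inl (SameCycle.trans ?_ h')
              simpa [hD.apply_apply] using hP.sameCycle_conj hD h }
    have : loops P D ≤ r := by
      apply loops_le
      · intro x
        exact .inr ⟨1, by simp [hD.apply_apply]⟩
      · intro x
        exact .inr (.refl _ _)
    exact fun h => this h
  · rintro (h | h)
    · exact loops_of_sameCycle h
    · exact (loops P D).trans (loops_right P D x) (loops_of_sameCycle h)

/-- The number of loops formed by `P` and `D`. -/
noncomputable def numLoops (P D : Perm X) : ℕ := Nat.card (Quotient (loops P D))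

/-- Each loop carries two different cycles, one for each direction of travel; the Boolean chooses
between them. This converts the cycle counts in the definition of `SNC` into loop counts. -/
theorem numCycles_mul [Finite X] {P D : Perm X} (hP : IsPairing P) (hD : IsPairing D) :
    numCycles (P * D) = 2 * numLoops P D := by
  let g : Quotient (loops P D) → X := Quotient.out
  have hg : ∀ q, Quotient.mk (loops P D) (g q) = q := Quotient.out_eq
  let F : Bool × Quotient (loops P D) → Quotient (SameCycle.setoid (P * D)) := fun bq =>
    Quotient.mk _ (if bq.1 then g bq.2 else D (g bq.2))
  have key : ∀ (b : Bool) q, loops P D (g q) (if b then g q else D (g q)) := by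
    intro b q
    cases b
    · exact loops_right P D _
    · exact (loops P D).refl _
  have hF : Function.Bijective F := by
    constructor
    · rintro ⟨b, q⟩ ⟨b', q'⟩ h
      have h1 : SameCycle (P * D) (if b then g q else D (g q)) (if b' then g q' else D (g q')) :=
        Quotient.exact h
      have h2 : q = q' := by
        rw [← hg q, ← hg q']
        exact Quotient.sound ((loops P D).trans (key b q)
          ((loops P D).trans (loops_of_sameCycle h1) ((loops P D).symm (key b' q'))))
      subst h2
      have := hP.not_sameCycle hD (g q)
      cases b <;> cases b' <;> simp_all
      exact this (SameCycle.symm h1)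
    · intro c
      induction c using Quotient.inductionOn with
      | h x =>
        have h1 : loops P D (g (Quotient.mk _ x)) x := Quotient.exact (hg _)
        rcases (loops_iff hP hD).1 h1 with h | h
        · exact ⟨(true, Quotient.mk _ x), Quotient.sound h⟩
        · exact ⟨(false, Quotient.mk _ x), Quotient.sound h⟩
  have := Nat.card_eq_of_bijective F hF
  rw [Nat.card_prod, Nat.card_eq_fintype_card (α := Bool), Fintype.card_bool] at this
  exact this.symm

end Loops

/-! ### Cycles as words -/

section Words

variable {X : Type*}

/-- The word `x, σ x, σ² x, …` of the cycle of `σ` through `x`. -/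
noncomputable def orbitWord (σ : Perm X) (x : X) : List X :=
  (List.range (Function.minimalPeriod σ x)).map fun j => (σ ^ j) x

/-- The list `l` is a cycle of `σ`. -/
def IsCycleWord (σ : Perm X) (l : List X) : Prop :=
  l ≠ [] ∧ l.Nodup ∧ l.map σ = l.rotate 1

theorem isCycleWord_cons {σ : Perm X} {x : X} {w : List X} :
    IsCycleWord σ (x :: w) ↔ (x :: w).Nodup ∧ (x :: w).map σ = w ++ [x] := by
  simp [IsCycleWord]

theorem IsCycleWord.getElem {σ : Perm X} {l : List X} (h : IsCycleWord σ l) (j : ℕ)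
    (hj : j < l.length) : l[j] = (σ ^ j) (l[0]'(by omega)) := by
  induction j with
  | zero => simp
  | succ j ih =>
    have h1 : (l.map σ)[j]'(by simp; omega) = (l.rotate 1)[j]'(by simp; omega) := by
      simp only [h.2.2]
    rw [List.getElem_map, List.getElem_rotate, ih (by omega)] at h1
    rw [pow_succ', Perm.mul_apply, h1]
    congr 1
    exact (Nat.mod_eq_of_lt hj).symm

theorem IsCycleWord.mem_iff {σ : Perm X} {x : X} {w : List X}
    (h : IsCycleWord σ (x :: w)) {y : X} : y ∈ x :: w ↔ SameCycle σ x y := by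
  constructor
  · intro hy
    obtain ⟨j, hj, rfl⟩ := List.getElem_of_mem hy
    rw [h.getElem j hj]
    exact ⟨j, by simp⟩
  · have key : ∀ z, z ∈ x :: w ↔ σ z ∈ x :: w := by
      intro z
      have : σ z ∈ (x :: w).map σ ↔ z ∈ x :: w := by simp
      rw [← this, h.2.2, List.mem_rotate]
    have key2 : ∀ (k : ℤ) z, z ∈ x :: w ↔ (σ ^ k) z ∈ x :: w := by
      intro k
      induction k using Int.induction_on with
      | zero => simp
      | succ k ih => intro z; rw [key z, ih (σ z), zpow_add_one, Perm.mul_apply]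
      | pred k ih =>
        intro z
        rw [ih z, key ((σ ^ (-(k : ℤ) - 1)) z), ← Perm.mul_apply, ← zpow_one_add]
        ring_nf
    rintro ⟨k, rfl⟩
    exact (key2 k x).1 (by simp)

/-- A cycle word is determined by its first letter. This identifies words that are constructed by
hand with those read off from the permutation. -/
theorem IsCycleWord.orbitWord_eq {σ : Perm X} {x : X} {w : List X}
    (h : IsCycleWord σ (x :: w)) : orbitWord σ x = x :: w := by
  have hper : (σ ^ (w.length + 1)) x = x := by
    have h1 := h.getElem w.length (by simp)
    have h2 : ((x :: w).map σ)[w.length]'(by simp) = ((x :: w).rotate 1)[w.length]'(by simp) := by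
      simp only [h.2.2]
    rw [List.getElem_map, h1, List.getElem_rotate, ← Perm.mul_apply, ← pow_succ'] at h2
    simpa using h2
  have hm : Function.minimalPeriod σ x = (x :: w).length := by
    apply le_antisymm
    · apply Function.IsPeriodicPt.minimalPeriod_le (by simp)
      rw [Function.IsPeriodicPt, Function.IsFixedPt, iterate_eq_pow]
      simpa using hper
    · by_contra! hlt
      have hp : 0 < Function.minimalPeriod σ x := by
        apply Function.IsPeriodicPt.minimalPeriod_pos (n := w.length + 1) (by simp)
        rw [Function.IsPeriodicPt, Function.IsFixedPt, iterate_eq_pow]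
        exact hper
      have h1 := h.getElem _ hlt
      have h3 : (σ ^ Function.minimalPeriod σ x) x = x := by
        have := Function.isPeriodicPt_minimalPeriod σ x
        rwa [Function.IsPeriodicPt, Function.IsFixedPt, iterate_eq_pow] at this
      have h2 : (x :: w)[Function.minimalPeriod σ x] = (x :: w)[0]'(by simp) := by
        rw [h1]; simpa using h3
      have := (List.Nodup.getElem_inj_iff h.2.1).1 h2
      omega
  apply List.ext_getElem
  · simp [orbitWord, hm]
  · intro j h1 h2
    rw [h.getElem j h2]
    simp [orbitWord]

theorem isCycleWord_orbitWord [Finite X] (σ : Perm X) (x : X) :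
    IsCycleWord σ (orbitWord σ x) := by
  have hp : 0 < Function.minimalPeriod σ x := by
    apply Function.IsPeriodicPt.minimalPeriod_pos (n := orderOf σ) (orderOf_pos σ)
    rw [Function.IsPeriodicPt, Function.IsFixedPt, iterate_eq_pow, pow_orderOf_eq_one]
    rfl
  have h3 : (σ ^ Function.minimalPeriod σ x) x = x := by
    have := Function.isPeriodicPt_minimalPeriod σ x
    rwa [Function.IsPeriodicPt, Function.IsFixedPt, iterate_eq_pow] at this
  refine ⟨by simp [orbitWord]; omega, ?_, ?_⟩
  · rw [orbitWord]
    refine List.Nodup.map_on ?_ List.nodup_range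
    intro i hi j hj hij
    rw [List.mem_range] at hi hj
    rw [← iterate_eq_pow, ← iterate_eq_pow] at hij
    exact Function.iterate_injOn_Iio_minimalPeriod hi hj hij
  · apply List.ext_getElem
    · simp
    · intro j h1 h2
      simp only [orbitWord, List.length_map, List.length_range] at h1
      simp only [orbitWord, List.getElem_map, List.getElem_range, List.getElem_rotate,
        List.length_map, List.length_range]
      rw [← Perm.mul_apply, ← pow_succ']
      rcases Nat.lt_or_ge (j + 1) (Function.minimalPeriod σ x) with h | h
      · rw [Nat.mod_eq_of_lt h]
      · have : j + 1 = Function.minimalPeriod σ x := by omega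
        rw [this, h3]; simp

theorem orbitWord_eq_cons [Finite X] (σ : Perm X) (x : X) :
    ∃ w, orbitWord σ x = x :: w := by
  have h := (isCycleWord_orbitWord σ x)
  match hl : orbitWord σ x with
  | [] => exact absurd hl h.1
  | y :: w =>
    refine ⟨w, ?_⟩
    have : (orbitWord σ x)[0]'(by simp [hl]) = x := by simp [orbitWord]
    simp only [hl, List.getElem_cons_zero] at this
    rw [this]

theorem mem_orbitWord [Finite X] {σ : Perm X} {x y : X} :
    y ∈ orbitWord σ x ↔ SameCycle σ x y := by
  obtain ⟨w, hw⟩ := orbitWord_eq_cons σ x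
  have h := isCycleWord_orbitWord σ x
  rw [hw] at h ⊢
  exact h.mem_iff

theorem IsCycleWord.rotate {σ : Perm X} {l : List X} (h : IsCycleWord σ l) (k : ℕ) :
    IsCycleWord σ (l.rotate k) := by
  refine ⟨by simpa using h.1, by simpa using h.2.1, ?_⟩
  rw [List.map_rotate, h.2.2, List.rotate_rotate, List.rotate_rotate, add_comm]

/-- Two words of the same cycle are rotations of each other. -/
theorem IsCycleWord.eq_rotate {σ : Perm X} {l l' : List X} (h : IsCycleWord σ l)
    (h' : IsCycleWord σ l') {z : X} (hz : z ∈ l) (hz' : z ∈ l') : ∃ k, l' = l.rotate k := by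
  obtain ⟨x', w', rfl⟩ := List.exists_cons_of_ne_nil h'.1
  obtain ⟨x, w, rfl⟩ := List.exists_cons_of_ne_nil h.1
  have hx : x' ∈ x :: w := h.mem_iff.2 ((h.mem_iff.1 hz).trans (h'.mem_iff.1 hz').symm)
  obtain ⟨j, hj, hjx⟩ := List.getElem_of_mem hx
  refine ⟨j, ?_⟩
  have hr := h.rotate j
  have : ∃ w2, (x :: w).rotate j = x' :: w2 := by
    match hl : (x :: w).rotate j with
    | [] => exact absurd hl hr.1
    | y :: w2 =>
      refine ⟨w2, ?_⟩
      have h0 : ((x :: w).rotate j)[0]'(by simp) = x' := by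
        rw [List.getElem_rotate]
        simp only [zero_add, Nat.mod_eq_of_lt hj]
        exact hjx
      simp only [hl, List.getElem_cons_zero] at h0
      rw [h0]
  obtain ⟨w2, hw2⟩ := this
  rw [hw2] at hr ⊢
  rw [← hr.orbitWord_eq, h'.orbitWord_eq]

/-- Reading a cycle of `P * D` backwards along the other side. -/
theorem IsCycleWord.reverse_map {P D : Perm X} (hP : IsPairing P) (hD : IsPairing D) {l : List X}
    (h : IsCycleWord (P * D) l) : IsCycleWord (P * D) (l.map D).reverse := by
  obtain ⟨x, w, rfl⟩ := List.exists_cons_of_ne_nil h.1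
  have h2 := (isCycleWord_cons.1 h).2
  refine ⟨by simp, ?_, ?_⟩
  · rw [List.nodup_reverse]
    exact h.2.1.map D.injective
  · have h3 : (x :: w).map D = (w ++ [x]).map P := by
      rw [← h2, List.map_map]
      apply List.map_congr_left
      intro z _
      simp [hP.apply_apply]
    have e1 : (((x :: w).map D).reverse).map (P * D : Perm X) = ((x :: w).map P).reverse := by
      rw [List.map_reverse, List.map_map]
      congr 2
      funext z; simp [hD.apply_apply]
    rw [e1, h3]
    simp

end Words

/-! ### One word for each loop -/

section Decomp

variable {X : Type*}

/-- A list of cycles of `P * D` that contains exactly one of the two cycles of every loop formed by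
`P` and `D`. -/
structure LoopDecomp (P D : Perm X) (W : List (List X)) : Prop where
  cyc : ∀ l ∈ W, IsCycleWord (P * D) l
  nodup : W.flatten.Nodup
  cover : ∀ x, x ∈ W.flatten ↔ D x ∉ W.flatten

theorem IsCycleWord.loops {P D : Perm X} {l : List X} (h : IsCycleWord (P * D) l) {x y : X}
    (hx : x ∈ l) (hy : y ∈ l) : loops P D x y := by
  obtain ⟨x', w', rfl⟩ := List.exists_cons_of_ne_nil h.1
  exact loops_of_sameCycle ((h.mem_iff.1 hx).symm.trans (h.mem_iff.1 hy))

theorem IsCycleWord.mem_of_loops {P D : Perm X} (hP : IsPairing P) (hD : IsPairing D) {l : List X}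
    (h : IsCycleWord (P * D) l) {x y : X} (hx : x ∈ l) (hxy : RealInf.loops P D x y) :
    y ∈ l ∨ D y ∈ l := by
  obtain ⟨x', w', rfl⟩ := List.exists_cons_of_ne_nil h.1
  rcases (loops_iff hP hD).1 hxy with h1 | h1
  · exact .inl (h.mem_iff.2 ((h.mem_iff.1 hx).trans h1))
  · refine .inr (h.mem_iff.2 ((h.mem_iff.1 hx).trans ?_))
    simpa [hD.apply_apply] using hP.sameCycle_conj hD h1

/-- Two words on the same loop would either share a letter, against `nodup`, or share one after an
application of `D`, against `cover`. -/
theorem LoopDecomp.bijective {P D : Perm X} (hP : IsPairing P) (hD : IsPairing D)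
    {W : List (List X)} (h : LoopDecomp P D W) :
    Function.Bijective (fun k : Fin W.length => Quotient.mk (loops P D)
      ((W[k]).head (h.cyc _ (List.getElem_mem k.2)).1)) := by
  constructor
  · intro k k' hkk
    have h1 := Quotient.exact hkk
    have hk := h.cyc _ (List.getElem_mem k.2)
    have hk' := h.cyc _ (List.getElem_mem k'.2)
    have hd := (List.nodup_flatten.1 h.nodup).2
    have e1 := List.head_mem hk.1
    have e2 := List.head_mem hk'.1
    rcases hk.mem_of_loops hP hD e1 h1 with h2 | h2
    · by_contra hne
      have hne' : (k : ℕ) ≠ k' := fun e => hne (Fin.ext e)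
      rcases lt_or_gt_of_ne hne' with hl | hl
      · exact (List.pairwise_iff_getElem.1 hd _ _ k.2 k'.2 hl) h2 e2
      · exact (List.pairwise_iff_getElem.1 hd _ _ k'.2 k.2 hl) e2 h2
    · exact absurd (List.mem_flatten.2 ⟨_, List.getElem_mem k.2, h2⟩)
        ((h.cover _).1 (List.mem_flatten.2 ⟨_, List.getElem_mem k'.2, e2⟩))
  · intro c
    induction c using Quotient.inductionOn with
    | h x =>
      have : ∃ l ∈ W, x ∈ l ∨ D x ∈ l := by
        by_cases hx : x ∈ W.flatten
        · obtain ⟨l, hl, hxl⟩ := List.mem_flatten.1 hx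
          exact ⟨l, hl, .inl hxl⟩
        · have : D x ∈ W.flatten := by
            by_contra hc
            exact hx ((h.cover x).2 hc)
          obtain ⟨l, hl, hxl⟩ := List.mem_flatten.1 this
          exact ⟨l, hl, .inr hxl⟩
      obtain ⟨l, hl, hx⟩ := this
      obtain ⟨k, hk, rfl⟩ := List.getElem_of_mem hl
      refine ⟨⟨k, hk⟩, Quotient.sound ?_⟩
      have hc := h.cyc _ hl
      rcases hx with hx | hx
      · exact hc.loops (List.head_mem hc.1) hx
      · exact (loops P D).trans (hc.loops (List.head_mem hc.1) hx)
          ((loops P D).symm (loops_right P D x))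

theorem LoopDecomp.length_eq {P D : Perm X} (hP : IsPairing P) (hD : IsPairing D)
    {W : List (List X)} (h : LoopDecomp P D W) : numLoops P D = W.length := by
  have := Nat.card_eq_of_bijective _ (h.bijective hP hD)
  rw [numLoops, ← this]
  simp

/-- A decomposition that reads given representatives. -/
theorem loopDecomp_of_section [Finite X] {P D : Perm X} (hP : IsPairing P) (hD : IsPairing D)
    (g : Quotient (loops P D) → X) (hg : ∀ c, Quotient.mk _ (g c) = c)
    (L : List (Quotient (loops P D))) (hL : L.Nodup) (hL' : ∀ c, c ∈ L) :
    LoopDecomp P D (L.map fun c => orbitWord (P * D) (g c)) := by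
  have mem : ∀ x, x ∈ (L.map fun c => orbitWord (P * D) (g c)).flatten ↔
      SameCycle (P * D) (g (Quotient.mk _ x)) x := by
    intro x
    simp only [List.mem_flatten, List.mem_map, exists_exists_and_eq_and, mem_orbitWord]
    constructor
    · rintro ⟨c, _, hc⟩
      have : Quotient.mk _ x = c := by
        rw [← hg c]
        exact Quotient.sound ((loops P D).symm (loops_of_sameCycle hc))
      rwa [this]
    · intro hx
      exact ⟨_, hL' _, hx⟩
  refine ⟨?_, ?_, ?_⟩
  · intro l hl
    obtain ⟨c, _, rfl⟩ := List.mem_map.1 hl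
    exact isCycleWord_orbitWord _ _
  · rw [List.nodup_flatten]
    constructor
    · intro l hl
      obtain ⟨c, _, rfl⟩ := List.mem_map.1 hl
      exact (isCycleWord_orbitWord _ _).2.1
    · rw [List.pairwise_map]
      refine hL.imp ?_
      intro c c' hne x hx hx'
      apply hne
      rw [mem_orbitWord] at hx hx'
      rw [← hg c, ← hg c']
      exact Quotient.sound (loops_of_sameCycle (hx.trans hx'.symm))
  · intro x
    rw [mem, mem]
    have e : Quotient.mk (loops P D) (D x) = Quotient.mk _ x :=
      Quotient.sound ((loops P D).symm (loops_right P D x))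
    rw [e]
    constructor
    · intro h1 h2
      exact hP.not_sameCycle hD x (h1.symm.trans h2)
    · intro h1
      have h2 : loops P D (g (Quotient.mk _ x)) x := Quotient.exact (hg _)
      rcases (loops_iff hP hD).1 h2 with h3 | h3
      · exact h3
      · exact absurd (by simpa [hD.apply_apply] using hP.sameCycle_conj hD h3) h1

/-- The surgery below needs a word that starts at a prescribed point, while the remaining words
should start at positive points: in the planar case the cumulants may only be rotated, not reversed,
so the direction of each word matters. -/
theorem exists_loopDecomp_cons [Finite X] {P D : Perm X} (hP : IsPairing P) (hD : IsPairing D)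
    (x : X) {good : X → Prop} (hgood : ∀ z, good z ∨ good (D z)) :
    ∃ W, LoopDecomp P D (orbitWord (P * D) x :: W) ∧
      ∀ l ∈ W, ∃ z w, l = z :: w ∧ good z := by
  classical
  have := Fintype.ofFinite (Quotient (loops P D))
  let cx := Quotient.mk (loops P D) x
  have hr : ∀ c : Quotient (loops P D), ∃ z, good z ∧ Quotient.mk _ z = c := by
    intro c
    induction c using Quotient.inductionOn with
    | h z =>
      rcases hgood z with h | h
      · exact ⟨z, h, rfl⟩
      · exact ⟨D z, h, Quotient.sound ((loops P D).symm (loops_right P D z))⟩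
  choose r hr1 hr2 using hr
  let g : Quotient (loops P D) → X := fun c => if c = cx then x else r c
  have hg : ∀ c, Quotient.mk _ (g c) = c := by
    intro c
    simp only [g]
    split_ifs with h1
    · exact h1.symm
    · exact hr2 c
  have := loopDecomp_of_section hP hD g hg (cx :: (Finset.univ.erase cx).toList)
    (by simp [Finset.nodup_toList]) (by intro c; simp; tauto)
  refine ⟨(Finset.univ.erase cx).toList.map fun c => orbitWord (P * D) (g c), ?_, ?_⟩
  · have e1 : g cx = x := by simp [g]
    simpa [e1] using this
  · intro l hl
    obtain ⟨c, hc, rfl⟩ := List.mem_map.1 hl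
    obtain ⟨w, hw⟩ := orbitWord_eq_cons (P * D) (g c)
    refine ⟨_, w, hw, ?_⟩
    have : c ≠ cx := by simpa using hc
    simp [g, this, hr1]

theorem exists_loopDecomp_cons_cons [Finite X] {P D : Perm X} (hP : IsPairing P) (hD : IsPairing D)
    {x y : X} (hxy : ¬ loops P D x y) :
    ∃ W, LoopDecomp P D (orbitWord (P * D) x :: orbitWord (P * D) y :: W) := by
  classical
  have := Fintype.ofFinite (Quotient (loops P D))
  let cx := Quotient.mk (loops P D) x
  let cy := Quotient.mk (loops P D) y
  have hne : cx ≠ cy := fun h => hxy (Quotient.exact h)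
  let g : Quotient (loops P D) → X := fun c => if c = cx then x else if c = cy then y else c.out
  have hg : ∀ c, Quotient.mk _ (g c) = c := by
    intro c
    simp only [g]
    split_ifs with h1 h2
    · exact h1.symm
    · exact h2.symm
    · exact Quotient.out_eq c
  have := loopDecomp_of_section hP hD g hg
    (cx :: cy :: ((Finset.univ.erase cx).erase cy).toList) (by simp [hne, Finset.nodup_toList])
    (by intro c; simp; tauto)
  refine ⟨((Finset.univ.erase cx).erase cy).toList.map fun c => orbitWord (P * D) (g c), ?_⟩
  have e1 : g cx = x := by simp [g]
  have e2 : g cy = y := by simp [g, hne.symm]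
  simpa [e1, e2] using this

end Decomp

/-! ### Adding two points to a pair of pairings -/

section Surgery

variable {Y X : Type*}

/-- `e : Y → X` omits exactly the two points `p` and `q`, and the pairing `D'` of `Y` arises from
the pairing `D` of `X` by connecting the partners `e x₀` of `p` and `e y₀` of `q`. -/
structure IsContraction (e : Y → X) (p q : X) (D' : Perm Y) (D : Perm X) (x₀ y₀ : Y) : Prop where
  inj : Function.Injective e
  ne : p ≠ q
  p_ne : ∀ y, e y ≠ p
  q_ne : ∀ y, e y ≠ q
  surj : ∀ x, x = p ∨ x = q ∨ ∃ y, e y = x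
  D'_pairing : IsPairing D'
  D_pairing : IsPairing D
  D_p : D p = e x₀
  D_q : D q = e y₀
  D'_x : D' x₀ = y₀
  D_e : ∀ z, z ≠ x₀ → z ≠ y₀ → D (e z) = e (D' z)

/-- The pairing `P` of `X` has the edge `{p, q}` and agrees with `P'` elsewhere. -/
structure IsTrivialExpansion (e : Y → X) (p q : X) (P' : Perm Y) (P : Perm X) : Prop where
  P'_pairing : IsPairing P'
  P_pairing : IsPairing P
  P_p : P p = q
  P_q : P q = p
  P_e : ∀ z, P (e z) = e (P' z)

/-- The pairing `P` of `X` arises from the pairing `P'` of `Y` by replacing the edge `{y, P' y}` by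
the edges `{p, e y}` and `{q, e (P' y)}`. -/
structure IsExpansion (e : Y → X) (p q : X) (P' : Perm Y) (P : Perm X) (y : Y) : Prop where
  P'_pairing : IsPairing P'
  P_pairing : IsPairing P
  P_p : P p = e y
  P_q : P q = e (P' y)
  P_e : ∀ z, z ≠ y → z ≠ P' y → P (e z) = e (P' z)

variable {e : Y → X} {p q : X} {D' P' : Perm Y} {D P : Perm X} {x₀ y₀ y : Y}

namespace IsContraction

theorem D'_y (h : IsContraction e p q D' D x₀ y₀) : D' y₀ = x₀ := by
  rw [← h.D'_x, h.D'_pairing.apply_apply]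

theorem D_x (h : IsContraction e p q D' D x₀ y₀) : D (e x₀) = p := by
  rw [← h.D_p, h.D_pairing.apply_apply]

theorem D_y (h : IsContraction e p q D' D x₀ y₀) : D (e y₀) = q := by
  rw [← h.D_q, h.D_pairing.apply_apply]

/-- Used when the new words gain the letter `q`. Then `e x₀` occurs and its partner `p` does not,
while `q` occurs and its partner `e y₀` does not. -/
theorem cover_of_perm (h : IsContraction e p q D' D x₀ y₀) {F' : List Y} {F : List X}
    (hx : x₀ ∈ F') (hF : F.Perm (q :: F'.map e)) (hn : F'.Nodup)
    (hc : ∀ z, z ∈ F' ↔ D' z ∉ F') : F.Nodup ∧ ∀ x, x ∈ F ↔ D x ∉ F := by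
  have hy : y₀ ∉ F' := by rw [← h.D'_x]; exact (hc x₀).1 hx
  have mem : ∀ x, x ∈ F ↔ x = q ∨ ∃ z ∈ F', e z = x := by
    intro x; rw [hF.mem_iff]; simp
  have memp : p ∉ F := by
    rw [mem]; rintro (h1 | ⟨z, _, h1⟩)
    · exact h.ne h1
    · exact h.p_ne _ h1
  have meme : ∀ z, e z ∈ F ↔ z ∈ F' := by
    intro z; rw [mem]
    constructor
    · rintro (h1 | ⟨z', hz, h1⟩)
      · exact absurd h1 (h.q_ne _)
      · rwa [← h.inj h1]
    · exact fun hz => .inr ⟨z, hz, rfl⟩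
  have memq : q ∈ F := (mem q).2 (.inl rfl)
  constructor
  · rw [hF.nodup_iff, List.nodup_cons]
    refine ⟨?_, hn.map h.inj⟩
    simp only [List.mem_map, not_exists, not_and]
    exact fun z _ => h.q_ne z
  · intro x
    rcases h.surj x with rfl | rfl | ⟨z, rfl⟩
    · simp [memp, h.D_p, meme, hx]
    · simp [memq, h.D_q, meme, hy]
    · by_cases h1 : z = x₀
      · subst h1; simp [h.D_x, meme, hx, memp]
      · by_cases h2 : z = y₀
        · subst h2; simp [h.D_y, meme, hy, memq]
        · rw [h.D_e z h1 h2, meme, meme]; exact hc z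

/-- The variant for a reversed segment: neither `p` nor `q` occurs, but both of their partners `e
x₀` and `e y₀` do. -/
theorem cover_of_perm' (h : IsContraction e p q D' D x₀ y₀) {F' : List Y} {F : List X}
    (hx : x₀ ∈ F') (hF : F.Perm (e y₀ :: F'.map e)) (hn : F'.Nodup)
    (hc : ∀ z, z ∈ F' ↔ D' z ∉ F') : F.Nodup ∧ ∀ x, x ∈ F ↔ D x ∉ F := by
  have hy : y₀ ∉ F' := by rw [← h.D'_x]; exact (hc x₀).1 hx
  have mem : ∀ x, x ∈ F ↔ x = e y₀ ∨ ∃ z ∈ F', e z = x := by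
    intro x; rw [hF.mem_iff]; simp
  have memp : p ∉ F := by
    rw [mem]; rintro (h1 | ⟨z, _, h1⟩)
    · exact h.p_ne _ h1.symm
    · exact h.p_ne _ h1
  have memq : q ∉ F := by
    rw [mem]; rintro (h1 | ⟨z, _, h1⟩)
    · exact h.q_ne _ h1.symm
    · exact h.q_ne _ h1
  have meme : ∀ z, e z ∈ F ↔ z = y₀ ∨ z ∈ F' := by
    intro z; rw [mem]
    constructor
    · rintro (h1 | ⟨z', hz, h1⟩)
      · exact .inl (h.inj h1)
      · exact .inr (by rwa [← h.inj h1])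
    · rintro (rfl | hz)
      · exact .inl rfl
      · exact .inr ⟨z, hz, rfl⟩
  constructor
  · rw [hF.nodup_iff, List.nodup_cons]
    refine ⟨?_, hn.map h.inj⟩
    simp only [List.mem_map, not_exists, not_and]
    exact fun z hz h1 => hy (h.inj h1 ▸ hz)
  · intro x
    rcases h.surj x with rfl | rfl | ⟨z, rfl⟩
    · simp [memp, h.D_p, meme, hx]
    · simp [memq, h.D_q, meme]
    · by_cases h1 : z = x₀
      · subst h1; simp [h.D_x, meme, hx, memp]
      · by_cases h2 : z = y₀
        · subst h2; simp [h.D_y, meme, memq]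
        · have h3 : D' z ≠ y₀ := by
            intro h3; apply h1; rw [← h.D'_y, ← h3, h.D'_pairing.apply_apply]
          rw [h.D_e z h1 h2, meme, meme]; simp [h2, h3, hc z]

theorem apply_e (h : IsContraction e p q D' D x₀ y₀) (hP : IsExpansion e p q P' P y) {z : Y}
    (h1 : z ≠ x₀) (h2 : z ≠ y₀) (h3 : D' z ≠ y) (h4 : D' z ≠ P' y) :
    (P * D) (e z) = e ((P' * D') z) := by
  rw [Perm.mul_apply, h.D_e z h1 h2, hP.P_e _ h3 h4, Perm.mul_apply]

theorem apply_x (h : IsContraction e p q D' D x₀ y₀) (hP : IsExpansion e p q P' P y) :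
    (P * D) (e x₀) = e y := by
  rw [Perm.mul_apply, h.D_x, hP.P_p]

theorem apply_y (h : IsContraction e p q D' D x₀ y₀) (hP : IsExpansion e p q P' P y) :
    (P * D) (e y₀) = e (P' y) := by
  rw [Perm.mul_apply, h.D_y, hP.P_q]

theorem isCycleWord_map (h : IsContraction e p q D' D x₀ y₀) {l : List Y}
    (hl : IsCycleWord (P' * D') l) (hz : ∀ z ∈ l, (P * D) (e z) = e ((P' * D') z)) :
    IsCycleWord (P * D) (l.map e) := by
  refine ⟨by simpa using hl.1, hl.2.1.map h.inj, ?_⟩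
  rw [← List.map_rotate, ← hl.2.2, List.map_map, List.map_map]
  exact List.map_congr_left hz

end IsContraction

/-- From `e x₀` the path runs over `p` to `q`, and from `q` it continues as it formerly did from
`x₀`. The cycle of `x₀` thus gains one letter and all other cycles stay as they are. -/
theorem IsTrivialExpansion.loopDecomp (h : IsContraction e p q D' D x₀ y₀)
    (hP : IsTrivialExpansion e p q P' P) {w : List Y} {W : List (List Y)}
    (hW : LoopDecomp P' D' ((x₀ :: w) :: W)) :
    LoopDecomp P D ((e x₀ :: q :: w.map e) :: W.map (List.map e)) := by
  have hx : x₀ ∈ ((x₀ :: w) :: W).flatten := by simp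
  obtain ⟨c1, c2⟩ := h.cover_of_perm (F := ((e x₀ :: q :: w.map e) :: W.map (List.map e)).flatten)
    hx (by simpa [List.map_flatten] using List.Perm.swap q (e x₀) _) hW.nodup hW.cover
  have hy : y₀ ∉ ((x₀ :: w) :: W).flatten := by rw [← h.D'_x]; exact (hW.cover _).1 hx
  have hnd := hW.nodup
  have key : ∀ z, z ≠ x₀ → z ≠ y₀ → (P * D) (e z) = e ((P' * D') z) := by
    intro z h1 h2
    rw [Perm.mul_apply, h.D_e z h1 h2, hP.P_e, Perm.mul_apply]
  refine ⟨?_, c1, c2⟩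
  intro l hl
  rcases List.mem_cons.1 hl with rfl | hl
  · rw [isCycleWord_cons]
    refine ⟨by rw [List.flatten_cons] at c1; exact c1.of_append_left, ?_⟩
    have h1 := (isCycleWord_cons.1 (hW.cyc (x₀ :: w) (by simp))).2
    have hq : (P * D) q = e ((P' * D') x₀) := by
      rw [Perm.mul_apply, h.D_q, hP.P_e, Perm.mul_apply, h.D'_x]
    have hx0 : (P * D) (e x₀) = q := by rw [Perm.mul_apply, h.D_x, hP.P_p]
    have h2 : (w.map e).map (P * D) = (w.map (P' * D')).map e := by
      rw [List.map_map, List.map_map]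
      apply List.map_congr_left
      intro z hz
      apply key z
      · rintro rfl; simp_all
      · rintro rfl; simp_all
    rw [List.map_cons, List.map_cons, h2, hq, hx0, ← List.map_cons, ← List.map_cons, h1]
    simp
  · obtain ⟨l', hl', rfl⟩ := List.mem_map.1 hl
    apply h.isCycleWord_map (hW.cyc l' (by simp [hl']))
    intro z hz
    have hzm : z ∈ W.flatten := List.mem_flatten.2 ⟨_, hl', hz⟩
    apply key z
    · rintro rfl
      simp_all
    · rintro rfl; simp_all

end Surgery

/-! ### Splitting, reversing and merging loops -/

section Surgery

variable {Y X : Type*}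
variable {e : Y → X} {p q : X} {D' P' : Perm Y} {D P : Perm X} {x₀ y₀ y : Y}

/-- Points outside the loop of `x₀` that is affected by an expansion. -/
theorem LoopDecomp.avoid (h : IsContraction e p q D' D x₀ y₀) (hP' : IsPairing P')
    {w : List Y} {W : List (List Y)}
    (hW : LoopDecomp P' D' ((x₀ :: w) :: W)) (hy : y ∈ x₀ :: w ∨ D' y ∈ x₀ :: w) {z : Y}
    (hz : z ∈ W.flatten) : z ≠ x₀ ∧ z ≠ y₀ ∧ D' z ≠ y ∧ D' z ≠ P' y := by
  have hcyc := hW.cyc (x₀ :: w) (by simp)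
  have hnd := hW.nodup
  have hcov := hW.cover
  have hdis : ∀ z, z ∈ W.flatten → z ∉ x₀ :: w ∧ D' z ∉ x₀ :: w := by
    intro z hz
    constructor
    · intro h1
      rw [List.flatten_cons] at hnd
      exact (List.nodup_append.1 hnd).2.2 z h1 z hz rfl
    · intro h1
      exact (hcov z).1 (by rw [List.flatten_cons]; simp [hz]) (by
        rw [List.flatten_cons, List.mem_append]; exact .inl h1)
  obtain ⟨d1, d2⟩ := hdis z hz
  have d3 : z ≠ y₀ := by
    rintro rfl; rw [h.D'_y] at d2; simp at d2
  have cl : ∀ a, (P' * D') a ∈ x₀ :: w ↔ a ∈ x₀ :: w := by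
    intro a
    rw [hcyc.mem_iff, hcyc.mem_iff, sameCycle_apply_right]
  refine ⟨fun h1 => d1 (by simp [h1]), d3, ?_, ?_⟩
  · intro h1
    rcases hy with hy | hy
    · exact d2 (h1 ▸ hy)
    · rw [← h1, h.D'_pairing.apply_apply] at hy; exact d1 hy
  · intro h1
    rcases hy with hy | hy
    · have : (P' * D') z = y := by
        rw [Perm.mul_apply, h1, hP'.apply_apply]
      exact d1 ((cl z).1 (this ▸ hy))
    · have : (P' * D') (D' y) = D' z := by
        rw [Perm.mul_apply, h.D'_pairing.apply_apply, h1]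
      exact d2 (this ▸ (cl _).2 hy)

theorem IsExpansion.rest (h : IsContraction e p q D' D x₀ y₀) (hP : IsExpansion e p q P' P y)
    {w : List Y} {W : List (List Y)}
    (hW : LoopDecomp P' D' ((x₀ :: w) :: W)) (hy : y ∈ x₀ :: w ∨ D' y ∈ x₀ :: w)
    {l : List X} (hl : l ∈ W.map (List.map e)) : IsCycleWord (P * D) l := by
  obtain ⟨l', hl', rfl⟩ := List.mem_map.1 hl
  apply h.isCycleWord_map (hW.cyc l' (by simp [hl']))
  intro z hz
  obtain ⟨h1, h2, h3, h4⟩ := hW.avoid h hP.P'_pairing hy (List.mem_flatten.2 ⟨_, hl', hz⟩)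
  exact h.apply_e hP h1 h2 h3 h4

/-- If `y` lies on the cycle of `x₀`, the expansion splits this cycle into two. -/
theorem IsExpansion.split (h : IsContraction e p q D' D x₀ y₀) (hP : IsExpansion e p q P' P y)
    {A B : List Y} {W : List (List Y)} (hW : LoopDecomp P' D' ((x₀ :: (A ++ B)) :: W))
    (hy : (B ++ [x₀]).head (by simp) = y) :
    LoopDecomp P D ((e x₀ :: B.map e) :: (q :: A.map e) :: W.map (List.map e)) := by
  have hx : x₀ ∈ ((x₀ :: (A ++ B)) :: W).flatten := by simp
  have hperm : ((e x₀ :: B.map e) :: (q :: A.map e) :: W.map (List.map e)).flatten.Perm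
      (q :: ((x₀ :: (A ++ B)) :: W).flatten.map e) := by
    have : ((e x₀ :: B.map e) :: (q :: A.map e) :: W.map (List.map e)).flatten
        = (e x₀ :: B.map e) ++ (q :: (A.map e ++ W.flatten.map e)) := by
      simp [List.map_flatten]
    rw [this]
    refine List.perm_middle.trans (List.Perm.cons q ?_)
    simp only [List.flatten_cons, List.map_append, List.map_cons, List.cons_append]
    refine List.Perm.cons _ ?_
    rw [← List.append_assoc]
    exact List.perm_append_comm.append_right _
  obtain ⟨c1, c2⟩ := h.cover_of_perm hx hperm hW.nodup hW.cover
  have hy₀ : y₀ ∉ ((x₀ :: (A ++ B)) :: W).flatten := by rw [← h.D'_x]; exact (hW.cover _).1 hx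
  have hcyc := hW.cyc (x₀ :: (A ++ B)) (by simp)
  have hnd := hcyc.2.1
  have hmap := (isCycleWord_cons.1 hcyc).2
  -- `y` is the first letter of `B`, or `x₀` itself, after a full turn, when `B` is empty. So `A`
  -- lies strictly between `x₀` and `y`.
  obtain ⟨T, hT⟩ : ∃ T, B ++ [x₀] = y :: T := by
    rcases hB : B ++ [x₀] with _ | ⟨b, T⟩
    · simp at hB
    · refine ⟨T, ?_⟩
      simp only [hB] at hy
      rw [← hy]; rfl
  have hsplit : (x₀ :: A).map (P' * D') = A ++ [y] ∧ B.map (P' * D') = T := by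
    have : (x₀ :: A).map (P' * D') ++ B.map (P' * D') = (A ++ [y]) ++ T := by
      rw [← List.map_append, List.cons_append, hmap, List.append_assoc, hT]; simp
    exact List.append_inj this (by simp)
  have hymem : y ∈ x₀ :: (A ++ B) := by
    have : y ∈ B ++ [x₀] := by rw [hT]; simp
    simp at this ⊢; tauto
  have hcov : ∀ z, z ∈ x₀ :: (A ++ B) → D' z ∉ x₀ :: (A ++ B) := by
    intro z hz hz'
    exact (hW.cover z).1 (List.mem_flatten.2 ⟨_, by simp, hz⟩) (List.mem_flatten.2 ⟨_, by simp, hz'⟩)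
  -- away from the preimage of `y`, nothing changes
  have key : ∀ z, z ∈ A ++ B → (P' * D') z ≠ y → (P * D) (e z) = e ((P' * D') z) := by
    intro z hz hne
    apply h.apply_e hP
    · rintro rfl; simp_all
    · rintro rfl; simp_all
    · intro h1; exact hcov z (by simp only [List.mem_cons, hz, or_true]) (h1 ▸ hymem)
    · intro h1; apply hne; rw [Perm.mul_apply, h1, hP.P'_pairing.apply_apply]
  -- The edge that led from `P' y` to `y` is cut, and a path arriving at `e (P' y)` is now led to
  -- `q`.
  have last : ∀ z, z ∈ x₀ :: A → z ≠ x₀ → (P' * D') z = y → (P * D) (e z) = q := by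
    intro z hz hne h1
    have h2 : z ≠ y₀ := by rintro rfl; simp_all
    rw [Perm.mul_apply, h.D_e z hne h2]
    have : D' z = P' y := by rw [← h1, Perm.mul_apply, hP.P'_pairing.apply_apply]
    rw [this, ← hP.P_q, hP.P_pairing.apply_apply]
  refine ⟨?_, c1, c2⟩
  intro l hl
  rcases List.mem_cons.1 hl with rfl | hl
  · rw [isCycleWord_cons]
    refine ⟨by rw [List.flatten_cons] at c1; exact c1.of_append_left, ?_⟩
    have h2 : (B.map e).map (P * D) = (B.map (P' * D')).map e := by
      rw [List.map_map, List.map_map]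
      apply List.map_congr_left
      intro z hz
      apply key z (by simp [hz])
      intro h1
      have h3 : y ∈ B.map (P' * D') := by rw [← h1]; exact List.mem_map_of_mem hz
      rw [hsplit.2] at h3
      have h4 : (B ++ [x₀]).Nodup := by
        have := hnd
        simp only [List.nodup_cons, List.nodup_append, List.mem_append] at this ⊢
        refine ⟨this.2.2.1, by simp, ?_⟩
        rintro z hz _ hz' rfl
        rw [List.mem_singleton] at hz'
        exact this.1 (.inr (hz' ▸ hz))
      rw [hT] at h4
      exact (List.nodup_cons.1 h4).1 h3
    rw [List.map_cons, h.apply_x hP, h2, hsplit.2, ← List.map_cons, ← hT]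
    simp
  rcases List.mem_cons.1 hl with rfl | hl
  · rw [isCycleWord_cons]
    constructor
    · rw [List.flatten_cons, List.flatten_cons] at c1
      exact c1.of_append_right.of_append_left
    -- If `y` directly follows `x₀`, the part that is cut off is the single point `q`.
    · have hq : A = [] → (P * D) q = q := by
        rintro rfl
        have h1 : (P' * D') x₀ = y := by simpa using hsplit.1
        have h2 : y₀ = P' y := by
          rw [← h1, Perm.mul_apply, h.D'_x, hP.P'_pairing.apply_apply]
        rw [Perm.mul_apply, h.D_q, h2, ← hP.P_q, hP.P_pairing.apply_apply]
      have hq' : (P' * D') x₀ ≠ y → (P * D) q = e ((P' * D') x₀) := by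
        intro h1
        rw [Perm.mul_apply, h.D_q, hP.P_e, Perm.mul_apply, h.D'_x]
        · rintro rfl
          exact hcov x₀ (by simp) (by rw [h.D'_x]; exact hymem)
        · intro h2
          apply h1
          rw [Perm.mul_apply, h.D'_x, h2, hP.P'_pairing.apply_apply]
      rcases List.eq_nil_or_concat' A with rfl | ⟨A', a, rfl⟩
      · simpa using hq rfl
      · have h1 : (x₀ :: A').map (P' * D') = A' ++ [a] ∧ (P' * D') a = y := by
          have : (x₀ :: A').map (P' * D') ++ [(P' * D') a] = (A' ++ [a]) ++ [y] := by
            rw [← hsplit.1]; simp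
          have := List.append_inj this (by simp)
          exact ⟨this.1, by simpa using this.2⟩
        have hya : ∀ z ∈ x₀ :: A', (P' * D') z ≠ y := by
          intro z hz hzy
          have : z = a := (P' * D').injective (hzy.trans h1.2.symm)
          subst this
          simp only [List.nodup_cons, List.nodup_append, List.mem_append]
            at hnd
          simp at hnd hz
          rcases hz with rfl | hz
          · simp at hnd
          · exact hnd.2.1.2 z hz rfl
        have h2 : (A'.map e).map (P * D) = (A'.map (P' * D')).map e := by
          rw [List.map_map, List.map_map]
          apply List.map_congr_left
          intro z hz
          exact key z (by simp [hz]) (hya z (by simp [hz]))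
        have h3 : (P * D) (e a) = q := by
          apply last a (by simp) _ h1.2
          rintro rfl
          simp at hnd
        have h4 := hq' (hya x₀ (by simp))
        rw [List.map_append, List.map_cons, List.map_append, h2, h4,
          List.map_singleton, List.map_singleton, h3]
        have h5 := congrArg (List.map e) h1.1
        rw [List.map_cons, List.map_cons] at h5
        rw [← List.cons_append, h5]
        simp
  · exact hP.rest h hW (.inl hymem) hl

/-- Propositional core of the covering condition in `IsExpansion.twist`. The letters `a`, `b`, `c`
say that a point lies in the segment to be reversed, in the rest of its cycle or in another word;
the primed letters say this of its partner, and `x`, `y` mean that the point is `x₀` or `y₀`.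
Mirroring the segment exchanges points with partners, so still exactly one of the two is covered. -/
theorem flip_cover_aux {a a' b b' c c' x y : Prop} (h : (a ∨ b ∨ c) ↔ ¬ (a' ∨ b' ∨ c'))
    (h1 : a → ¬ b) (h2 : a ∨ b → ¬ c) (h3 : a' → ¬ b') (h4 : a' ∨ b' → ¬ c') (hx : x → a)
    (hy : y → a') :
    (x ∨ (a' ∧ ¬ y) ∨ b ∨ c) ↔ ¬ (y ∨ (a ∧ ¬ x) ∨ b' ∨ c') := by
  grind

/-- If `D' y` lies on the cycle of `x₀`, the expansion reverses a part of this cycle. -/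
theorem IsExpansion.twist (h : IsContraction e p q D' D x₀ y₀) (hP : IsExpansion e p q P' P y)
    {w A B : List Y} {W : List (List Y)} (hW : LoopDecomp P' D' ((x₀ :: w) :: W))
    (hA : x₀ :: w = A ++ D' y :: B) :
    LoopDecomp P D ((e x₀ :: (((A ++ [D' y]).map D').reverse.map e ++ B.map e)) ::
      W.map (List.map e)) := by
  have hcyc := hW.cyc (x₀ :: w) (by simp)
  have hmem : D' y ∈ x₀ :: w := by rw [hA]; simp
  have hcov : ∀ z, z ∈ x₀ :: w → D' z ∉ x₀ :: w := by
    intro z hz hz'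
    exact (hW.cover z).1 (List.mem_flatten.2 ⟨_, by simp, hz⟩) (List.mem_flatten.2 ⟨_, by simp, hz'⟩)
  have hynot : y ∉ x₀ :: w := by
    have := hcov _ hmem; rwa [h.D'_pairing.apply_apply] at this
  have hy₀ : y₀ ∉ x₀ :: w := by rw [← h.D'_x]; exact hcov _ (by simp)
  have hnd := hcyc.2.1
  -- The mirrored segment begins with the partner `y₀` of `x₀`. It is set apart because `D` pairs `e
  -- y₀` with the new point `q`; everywhere else on the segment the old pairing persists.
  obtain ⟨C, hC⟩ : ∃ C, (A ++ [D' y]).map D' = y₀ :: C := by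
    rcases A with _ | ⟨a, A⟩
    · refine ⟨[], ?_⟩
      simp at hA
      simp [← hA.1, h.D'_x]
    · simp at hA
      refine ⟨(A ++ [D' y]).map D', ?_⟩
      simp [← hA.1, h.D'_x]
  have hCsub : ∀ z ∈ C, D' z ∈ A ++ [D' y] ∧ z ≠ y₀ := by
    intro z hz
    have h1 : z ∈ (A ++ [D' y]).map D' := by rw [hC]; simp [hz]
    have h2 : (y₀ :: C).Nodup := by
      rw [← hC]
      apply List.Nodup.map D'.injective
      rw [hA] at hnd
      have : (A ++ [D' y] ++ B).Nodup := by simpa using hnd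
      exact this.of_append_left
    obtain ⟨z', hz', rfl⟩ := List.mem_map.1 h1
    rw [h.D'_pairing.apply_apply]
    exact ⟨hz', fun h3 => (List.nodup_cons.1 h2).1 (h3 ▸ hz)⟩
  -- the reversed word
  have hrev := (hcyc.reverse_map hP.P'_pairing h.D'_pairing).2.2
  have hrw : ((x₀ :: w).map D').reverse = (B.map D').reverse ++ (y :: (A.map D').reverse) := by
    rw [hA]; simp [h.D'_pairing.apply_apply]
  have hCr : C.reverse ++ [y₀] = y :: (A.map D').reverse := by
    have := congrArg List.reverse hC
    simpa [h.D'_pairing.apply_apply] using this.symm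
  have hCrev : (C.reverse).map (P' * D') = (A.map D').reverse := by
    rw [hrw] at hrev
    rcases hB : (B.map D').reverse with _ | ⟨b, B'⟩
    · rw [hB, List.nil_append] at hrev
      have h1 : C.reverse.map (P' * D') ++ [(P' * D') y₀] = (A.map D').reverse ++ [y] := by
        have : (C.reverse ++ [y₀]).map (P' * D') = (y :: (A.map D').reverse).rotate 1 := by
          rw [hCr]; exact hrev
        simpa using this
      exact (List.append_inj' h1 rfl).1
    · rw [hB] at hrev
      have h1 : (b :: B').map (P' * D') ++ C.reverse.map (P' * D') ++ [(P' * D') y₀] =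
          (B' ++ [y]) ++ (A.map D').reverse ++ [b] := by
        have : (b :: B' ++ (C.reverse ++ [y₀])).map (P' * D') =
            (b :: B' ++ y :: (A.map D').reverse).rotate 1 := by
          rw [hCr]; exact hrev
        simpa using this
      have h2 := (List.append_inj' h1 rfl).1
      exact (List.append_inj h2 (by simp)).2
  have hnext : (D' y :: B).map (P' * D') = B ++ [x₀] := by
    have hmap := (isCycleWord_cons.1 hcyc).2
    rcases A with _ | ⟨a, A⟩
    · simp only [List.nil_append] at hA
      rw [hA] at hmap
      rw [hmap, (List.cons.inj hA).2]
    · simp only [List.cons_append] at hA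
      obtain ⟨rfl, rfl⟩ := List.cons.inj hA
      have h1 : (x₀ :: A).map (P' * D') ++ (D' y :: B).map (P' * D') =
          (A ++ [D' y]) ++ (B ++ [x₀]) := by
        rw [← List.map_append, List.cons_append, hmap]; simp
      exact (List.append_inj h1 (by simp)).2
  have hPy : P' y = (P' * D') (D' y) := by
    rw [Perm.mul_apply, h.D'_pairing.apply_apply]
  have hPy_mem : P' y ∈ B ++ [x₀] := by
    rw [hPy, ← hnext]; simp
  have hndAB : (A ++ [D' y] ++ B).Nodup := by
    rw [hA] at hnd; simpa using hnd
  have hx₀A : x₀ ∈ A ++ [D' y] := by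
    rcases A with _ | ⟨a, A⟩
    · simp only [List.nil_append] at hA ⊢
      simp [(List.cons.inj hA).1]
    · simp only [List.cons_append] at hA ⊢
      simp [(List.cons.inj hA).1]
  have memw : ∀ z, z ∈ x₀ :: w ↔ z ∈ A ++ [D' y] ∨ z ∈ B := by
    intro z; rw [hA]; simp; tauto
  have hdis : ∀ z, z ∈ A ++ [D' y] → z ∉ B := by
    intro z h1 h2
    exact (List.nodup_append.1 hndAB).2.2 z h1 z h2 rfl
  have hndW : (x₀ :: w).Nodup ∧ W.flatten.Nodup ∧ ∀ z, z ∈ x₀ :: w → z ∉ W.flatten := by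
    have := hW.nodup
    rw [List.flatten_cons, List.nodup_append] at this
    exact ⟨this.1, this.2.1, fun z h1 h2 => this.2.2 z h1 z h2 rfl⟩
  have cov0 : ∀ z, (z ∈ A ++ [D' y] ∨ z ∈ B ∨ z ∈ W.flatten) ↔
      ¬ (D' z ∈ A ++ [D' y] ∨ D' z ∈ B ∨ D' z ∈ W.flatten) := by
    intro z
    have := hW.cover z
    rw [List.flatten_cons, List.mem_append, List.mem_append, memw, memw] at this
    tauto
  have memC : ∀ z, z ∈ C ↔ D' z ∈ A ++ [D' y] ∧ z ≠ y₀ := by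
    intro z
    refine ⟨hCsub z, fun ⟨h1, h2⟩ => ?_⟩
    have : z ∈ (A ++ [D' y]).map D' :=
      List.mem_map.2 ⟨_, h1, h.D'_pairing.apply_apply z⟩
    rw [hC, List.mem_cons] at this
    exact this.resolve_left h2
  have hflat : (((e x₀ :: (((A ++ [D' y]).map D').reverse.map e ++ B.map e)) ::
      W.map (List.map e)).flatten).Perm
      (e y₀ :: (x₀ :: (C.reverse ++ (B ++ W.flatten))).map e) := by
    rw [hC, List.reverse_cons]
    have : ((e x₀ :: ((C.reverse ++ [y₀]).map e ++ B.map e)) :: W.map (List.map e)).flatten =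
        (e x₀ :: C.reverse.map e) ++ e y₀ :: (B.map e ++ W.flatten.map e) := by
      simp [List.map_flatten]
    rw [this]
    refine List.perm_middle.trans (List.Perm.cons _ ?_)
    simp
  have hdisW : ∀ z, z ∈ A ++ [D' y] ∨ z ∈ B → z ∉ W.flatten := fun z hz =>
    hndW.2.2 z ((memw z).2 hz)
  have hx₀C : x₀ ∉ C := by
    intro h1
    have h2 := (hCsub _ h1).1
    rw [h.D'_x] at h2
    exact hy₀ ((memw _).2 (.inl h2))
  obtain ⟨c1, c2⟩ := h.cover_of_perm' (by simp) hflat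
    (by
      have hCn : C.Nodup := by
        have h2 : (y₀ :: C).Nodup := by
          rw [← hC]
          exact hndAB.of_append_left.map D'.injective
        exact (List.nodup_cons.1 h2).2
      rw [List.nodup_cons, List.nodup_append, List.nodup_append, List.nodup_reverse]
      refine ⟨?_, hCn, ⟨hndAB.of_append_right, hndW.2.1, ?_⟩, ?_⟩
      · simp only [List.mem_append, List.mem_reverse, not_or]
        exact ⟨hx₀C, hdis _ hx₀A, hdisW _ (.inl hx₀A)⟩
      · rintro z h1 _ h2 rfl
        exact hdisW z (.inr h1) h2
      · rintro z h1 _ h2 rfl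
        rw [List.mem_reverse] at h1
        rw [List.mem_append] at h2
        exact (cov0 z).1 (.inr h2) (.inl (hCsub z h1).1))
    (by
      intro z
      have e1 : D' z = x₀ ↔ z = y₀ := by rw [h.D'_pairing.apply_eq_iff, h.D'_x]
      have e2 : D' z = y₀ ↔ z = x₀ := by rw [h.D'_pairing.apply_eq_iff, h.D'_y]
      have e3 := cov0 z
      have e4 := hdis z
      have e5 := hdisW z
      have e6 := hdis (D' z)
      have e7 := hdisW (D' z)
      have mF : ∀ z, z ∈ x₀ :: (C.reverse ++ (B ++ W.flatten)) ↔
          z = x₀ ∨ (D' z ∈ A ++ [D' y] ∧ z ≠ y₀) ∨ z ∈ B ∨ z ∈ W.flatten := by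
        intro z
        rw [List.mem_cons, List.mem_append, List.mem_append, List.mem_reverse, memC]
      rw [mF, mF, h.D'_pairing.apply_apply, e1, ne_eq, ne_eq, e2]
      have e8 : z = x₀ → z ∈ A ++ [D' y] := by rintro rfl; exact hx₀A
      have e9 : z = y₀ → D' z ∈ A ++ [D' y] := by rintro rfl; rw [h.D'_y]; exact hx₀A
      exact flip_cover_aux e3 e4 e5 e6 e7 e8 e9)
  refine ⟨?_, c1, c2⟩
  intro l hl
  rcases List.mem_cons.1 hl with rfl | hl
  · rw [isCycleWord_cons]
    refine ⟨by rw [List.flatten_cons] at c1; exact c1.of_append_left, ?_⟩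
    have h1 : (C.reverse.map e).map (P * D) = (C.reverse.map (P' * D')).map e := by
      rw [List.map_map, List.map_map]
      apply List.map_congr_left
      intro z hz
      rw [List.mem_reverse] at hz
      obtain ⟨z1, z2⟩ := hCsub z hz
      apply h.apply_e hP
      · rintro rfl; exact hx₀C hz
      · exact z2
      · intro h2; exact hynot ((memw _).2 (.inl (h2 ▸ z1)))
      · intro h2
        rw [List.mem_append, List.mem_singleton, ← h2] at hPy_mem
        rcases hPy_mem with h3 | h3
        · exact hdis _ z1 h3
        · rw [h.D'_pairing.apply_eq_iff, h.D'_x] at h3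
          exact z2 h3
    have h2 : (B.map e).map (P * D) = (B.map (P' * D')).map e := by
      rw [List.map_map, List.map_map]
      apply List.map_congr_left
      intro z hz
      have hzw := (memw z).2 (.inr hz)
      apply h.apply_e hP
      · rintro rfl; exact hdis _ hx₀A hz
      · rintro rfl; exact hy₀ hzw
      · intro h2
        have : z = D' y := by rw [← h2, h.D'_pairing.apply_apply]
        exact hdis z (by rw [this]; simp) hz
      · intro h2
        refine hcov z hzw ?_
        rw [h2, memw]
        rw [List.mem_append, List.mem_singleton] at hPy_mem
        rcases hPy_mem with h3 | h3
        · exact .inr h3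
        · rw [h3]; exact .inl hx₀A
    have h3 : e (P' y) :: (B.map (P' * D')).map e = B.map e ++ [e x₀] := by
      rw [hPy, ← List.map_cons, ← List.map_cons, hnext]; simp
    have h4 : ((A ++ [D' y]).map D').reverse = C.reverse ++ [y₀] := by
      rw [hC]; simp
    rw [h4, List.map_cons, h.apply_x hP, List.map_append, List.map_append, List.map_append, h1,
      hCrev, h2, List.map_singleton, List.map_singleton, h.apply_y hP, List.append_assoc,
      List.singleton_append, h3]
    have h5 := congrArg (List.map e) hCr
    rw [List.map_append, List.map_singleton, List.map_cons] at h5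
    rw [h5]
    simp
  · exact hP.rest h hW (.inr hmem) hl

/-- If `y` lies on another loop than `x₀`, the expansion merges the two loops. -/
theorem IsExpansion.merge (h : IsContraction e p q D' D x₀ y₀) (hP : IsExpansion e p q P' P y)
    {w v : List Y} {W : List (List Y)} (hW : LoopDecomp P' D' ((x₀ :: w) :: (y :: v) :: W)) :
    LoopDecomp P D ((e x₀ :: ((y :: v).map e ++ q :: w.map e)) :: W.map (List.map e)) := by
  have hx : x₀ ∈ ((x₀ :: w) :: (y :: v) :: W).flatten := by simp
  have hperm : ((e x₀ :: ((y :: v).map e ++ q :: w.map e)) :: W.map (List.map e)).flatten.Perm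
      (q :: ((x₀ :: w) :: (y :: v) :: W).flatten.map e) := by
    have : ((e x₀ :: ((y :: v).map e ++ q :: w.map e)) :: W.map (List.map e)).flatten =
        (e x₀ :: (y :: v).map e) ++ q :: (w.map e ++ W.flatten.map e) := by
      simp [List.map_flatten]
    rw [this]
    refine List.perm_middle.trans (List.Perm.cons q ?_)
    simp only [List.flatten_cons, List.map_append, List.map_cons, List.cons_append]
    refine List.Perm.cons _ ?_
    simpa using List.perm_append_comm_assoc ((y :: v).map e) (w.map e) (W.flatten.map e)
  obtain ⟨c1, c2⟩ := h.cover_of_perm hx hperm hW.nodup hW.cover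
  have hc1 := hW.cyc (x₀ :: w) (by simp)
  have hc2 := hW.cyc (y :: v) (by simp)
  have hm1 := (isCycleWord_cons.1 hc1).2
  have hm2 := (isCycleWord_cons.1 hc2).2
  have hnd := hW.nodup
  have hdis1 : ∀ z, z ∈ x₀ :: w → z ∉ y :: v ∧ z ∉ W.flatten := by
    intro z h1
    rw [List.flatten_cons, List.flatten_cons, List.nodup_append] at hnd
    have := hnd.2.2 z h1
    constructor
    · intro h2; exact this z (List.mem_append.2 (.inl h2)) rfl
    · intro h2; exact this z (List.mem_append.2 (.inr h2)) rfl
  have hdis2 : ∀ z, z ∈ y :: v → z ∉ W.flatten := by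
    intro z h1 h2
    rw [List.flatten_cons, List.flatten_cons, List.nodup_append, List.nodup_append] at hnd
    exact hnd.2.1.2.2 z h1 z h2 rfl
  have hcov : ∀ z, (z ∈ x₀ :: w ∨ z ∈ y :: v ∨ z ∈ W.flatten) →
      ¬ (D' z ∈ x₀ :: w ∨ D' z ∈ y :: v ∨ D' z ∈ W.flatten) := by
    intro z hz
    have := (hW.cover z).1
    rw [List.flatten_cons, List.flatten_cons, List.mem_append, List.mem_append, List.mem_append,
      List.mem_append] at this
    exact this hz
  have hy₀ := hcov x₀ (by simp)
  rw [h.D'_x] at hy₀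
  -- away from `x₀` and the preimage of `y`, nothing changes
  have key : ∀ z, z ∈ x₀ :: w ∨ z ∈ y :: v ∨ z ∈ W.flatten → z ≠ x₀ → (P' * D') z ≠ y →
      (P * D) (e z) = e ((P' * D') z) := by
    intro z hz h1 h2
    apply h.apply_e hP h1
    · rintro rfl; exact hy₀ hz
    · intro h3; exact hcov z hz (by rw [h3]; simp)
    · intro h3; apply h2; rw [Perm.mul_apply, h3, hP.P'_pairing.apply_apply]
  have cl : ∀ z, (P' * D') z = y → z ∈ y :: v := by
    intro z hz
    rw [hc2.mem_iff, ← sameCycle_apply_right, hz]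
  refine ⟨?_, c1, c2⟩
  intro l hl
  rcases List.mem_cons.1 hl with rfl | hl
  · rw [isCycleWord_cons]
    refine ⟨by rw [List.flatten_cons] at c1; exact c1.of_append_left, ?_⟩
    have h2 : (w.map e).map (P * D) = (w.map (P' * D')).map e := by
      rw [List.map_map, List.map_map]
      apply List.map_congr_left
      intro z hz
      have hz' : z ∈ x₀ :: w := by simp [hz]
      apply key z (.inl hz')
      · rintro rfl; exact (List.nodup_cons.1 hc1.2.1).1 hz
      · intro h3; exact (hdis1 z hz').1 (cl z h3)
    have hq : (P * D) q = e ((P' * D') x₀) := by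
      have h3 : y₀ ≠ y := by rintro rfl; simp at hy₀
      have h4 : y₀ ≠ P' y := by
        intro h4
        have : (P' * D') x₀ = y := by rw [Perm.mul_apply, h.D'_x, h4, hP.P'_pairing.apply_apply]
        exact (hdis1 x₀ (by simp)).1 (cl _ this)
      rw [Perm.mul_apply, h.D_q, hP.P_e _ h3 h4, Perm.mul_apply, h.D'_x]
    -- `z` precedes `y` on its cycle. Here the path leaves that cycle through `q` and returns to
    -- what followed `x₀`.
    obtain ⟨v', z, hv⟩ : ∃ v' z, y :: v = v' ++ [z] := by
      rcases List.eq_nil_or_concat' (y :: v) with h3 | h3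
      · simp at h3
      · exact h3
    have h3 : v'.map (P' * D') = v ∧ (P' * D') z = y := by
      have : v'.map (P' * D') ++ [(P' * D') z] = v ++ [y] := by
        rw [← hm2, hv]; simp
      have := List.append_inj' this rfl
      exact ⟨this.1, by simpa using this.2⟩
    have hzx : ∀ z ∈ y :: v, z ≠ x₀ := by
      rintro z hz rfl; exact (hdis1 _ (by simp)).1 hz
    have hvnd : (v' ++ [z]).Nodup := hv ▸ hc2.2.1
    have h4 : (v'.map e).map (P * D) = v.map e := by
      rw [← h3.1, List.map_map, List.map_map]
      apply List.map_congr_left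
      intro z' hz'
      have hz2 : z' ∈ y :: v := by rw [hv]; simp [hz']
      apply key z' (.inr (.inl hz2)) (hzx _ hz2)
      intro h5
      have : z' = z := (P' * D').injective (h5.trans h3.2.symm)
      exact (List.nodup_append.1 hvnd).2.2 z' hz' z (by simp) this
    have h5 : (P * D) (e z) = q := by
      have hz2 : z ∈ y :: v := by rw [hv]; simp
      have hz3 : z ≠ y₀ := by rintro rfl; exact hy₀ (.inr (.inl hz2))
      have : D' z = P' y := by rw [← h3.2, Perm.mul_apply, hP.P'_pairing.apply_apply]
      rw [Perm.mul_apply, h.D_e z (hzx z hz2) hz3, this, ← hP.P_q, hP.P_pairing.apply_apply]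
    have h6 : e ((P' * D') x₀) :: (w.map (P' * D')).map e = w.map e ++ [e x₀] := by
      rw [← List.map_cons, ← List.map_cons, hm1]; simp
    rw [List.map_cons, h.apply_x hP, List.map_append, hv, List.map_append, List.map_singleton,
      List.map_append, h4, List.map_singleton, h5, List.map_cons, hq, h2, h6]
    have h7 : v'.map e ++ [e z] = e y :: v.map e := by
      rw [← List.map_cons, hv]; simp
    rw [h7]
    simp
  · obtain ⟨l', hl', rfl⟩ := List.mem_map.1 hl
    apply h.isCycleWord_map (hW.cyc l' (by simp [hl']))
    intro z hz
    have hzm : z ∈ W.flatten := List.mem_flatten.2 ⟨_, hl', hz⟩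
    apply key z (.inr (.inr hzm))
    · rintro rfl; exact (hdis1 _ (by simp)).2 hzm
    · intro h3; exact hdis2 z (cl z h3) hzm

end Surgery

/-! ### Loops with a pairing that has the edge between the new points -/

section Gap

variable {Y X : Type*} {e : Y → X} {p q : X} {G' P' : Perm Y} {G P : Perm X} {y : Y}

theorem loops_map (he : ∀ z, loops P G (e z) (e (P' z))) (hG : ∀ z, loops P G (e z) (e (G' z)))
    {a b : Y} (h : loops P' G' a b) : loops P G (e a) (e b) := by
  have : loops P' G' ≤ (loops P G).comap e := loops_le he hG
  exact this h

/-- Retraction of the points of `X` to loops on `Y`. -/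
theorem exists_retraction {Z : Type*} (he : Function.Injective e) (f : Y → Z) (c : Z) :
    ∃ ρ : X → Z, (∀ z, ρ (e z) = f z) ∧ ∀ x, (∀ z, e z ≠ x) → ρ x = c := by
  classical
  refine ⟨fun x => if h : ∃ z, e z = x then f h.choose else c, ?_, ?_⟩
  · intro z
    have h : ∃ z', e z' = e z := ⟨z, rfl⟩
    simp only [dif_pos h]
    rw [he h.choose_spec]
  · intro x hx
    exact dif_neg (by push Not; exact hx)

/-- With the edge {p, q} in `G`, the edge {y, P' y} is merely subdivided into the path `e y`, `p`,
`q`, `e (P' y)`, so the loops are the old ones. -/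
theorem IsExpansion.loops_gap (he : Function.Injective e) (hp : ∀ z, e z ≠ p) (hq : ∀ z, e z ≠ q)
    (hs : ∀ x, x = p ∨ x = q ∨ ∃ z, e z = x)
    (hG : IsTrivialExpansion e p q G' G) (hP : IsExpansion e p q P' P y) :
    (∀ a b, loops P G (e a) (e b) ↔ loops P' G' a b) ∧ numLoops P G = numLoops P' G' := by
  have hPy : P (e y) = p := by rw [← hP.P_p, hP.P_pairing.apply_apply]
  have hPy' : P (e (P' y)) = q := by rw [← hP.P_q, hP.P_pairing.apply_apply]
  obtain ⟨ρ, h1, h2⟩ := exists_retraction he (fun z => Quotient.mk (loops P' G') z)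
    (Quotient.mk (loops P' G') y)
  have hy : Quotient.mk (loops P' G') (P' y) = Quotient.mk (loops P' G') y :=
    Quotient.sound ((loops P' G').symm (loops_left P' G' y))
  have hle : loops P G ≤ Setoid.ker ρ := by
    apply loops_le
    · intro x
      rw [Setoid.ker_def]
      rcases hs x with rfl | rfl | ⟨z, rfl⟩
      · rw [hP.P_p, h1, h2 _ hp]
      · rw [hP.P_q, h1, h2 _ hq, hy]
      · by_cases z1 : z = y
        · rw [z1, hPy, h1, h2 _ hp]
        · by_cases z2 : z = P' y
          · rw [z2, hPy', h1, h2 _ hq, hy]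
          · rw [hP.P_e z z1 z2, h1, h1]
            exact Quotient.sound (loops_left _ _ _)
    · intro x
      rw [Setoid.ker_def]
      rcases hs x with rfl | rfl | ⟨z, rfl⟩
      · rw [hG.P_p, h2 _ hp, h2 _ hq]
      · rw [hG.P_q, h2 _ hp, h2 _ hq]
      · rw [hG.P_e, h1, h1]
        exact Quotient.sound (loops_right _ _ _)
  have hpq : loops P G p q := by rw [← hG.P_p]; exact loops_right _ _ _
  have hpy : loops P G p (e y) := by rw [← hP.P_p]; exact loops_left _ _ _
  have hqy : loops P G q (e (P' y)) := by rw [← hP.P_q]; exact loops_left _ _ _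
  have hyy : loops P G (e y) (e (P' y)) :=
    (loops P G).trans ((loops P G).symm hpy) ((loops P G).trans hpq hqy)
  have key : ∀ a b, loops P G (e a) (e b) ↔ loops P' G' a b := by
    intro a b
    constructor
    · intro h
      have := hle h
      rw [Setoid.ker_def, h1, h1] at this
      exact Quotient.exact this
    · apply loops_map
      · intro z
        by_cases z1 : z = y
        · rw [z1]; exact hyy
        · by_cases z2 : z = P' y
          · rw [z2, hP.P'_pairing.apply_apply]; exact (loops P G).symm hyy
          · rw [← hP.P_e z z1 z2]; exact loops_left _ _ _
      · intro z
        rw [← hG.P_e]; exact loops_right _ _ _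
  refine ⟨key, ?_⟩
  symm
  apply Nat.card_eq_of_bijective
    (Quotient.map e fun a b h => (key a b).2 h : Quotient (loops P' G') → Quotient (loops P G))
  constructor
  · intro a b
    induction a, b using Quotient.inductionOn₂ with
    | h a b => exact fun h => Quotient.sound ((key a b).1 (Quotient.exact h))
  · intro c
    induction c using Quotient.inductionOn with
    | h x =>
      rcases hs x with rfl | rfl | ⟨z, rfl⟩
      · exact ⟨Quotient.mk _ y, Quotient.sound ((loops P G).symm hpy)⟩
      · exact ⟨Quotient.mk _ (P' y), Quotient.sound ((loops P G).symm hqy)⟩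
      · exact ⟨Quotient.mk _ z, rfl⟩

/-- Both pairings contain the edge {p, q}, which is therefore a loop of its own; `none` stands for
it. -/
theorem IsTrivialExpansion.loops_gap [Finite Y] (he : Function.Injective e) (hp : ∀ z, e z ≠ p)
    (hq : ∀ z, e z ≠ q) (hs : ∀ x, x = p ∨ x = q ∨ ∃ z, e z = x)
    (hG : IsTrivialExpansion e p q G' G) (hP : IsTrivialExpansion e p q P' P) :
    (∀ a b, loops P G (e a) (e b) ↔ loops P' G' a b) ∧ numLoops P G = numLoops P' G' + 1 := by
  obtain ⟨ρ, h1, h2⟩ := exists_retraction he (fun z => some (Quotient.mk (loops P' G') z)) none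
  have hle : loops P G ≤ Setoid.ker ρ := by
    apply loops_le
    · intro x
      rw [Setoid.ker_def]
      rcases hs x with rfl | rfl | ⟨z, rfl⟩
      · rw [hP.P_p, h2 _ hp, h2 _ hq]
      · rw [hP.P_q, h2 _ hp, h2 _ hq]
      · rw [hP.P_e, h1, h1]
        exact congrArg some (Quotient.sound (loops_left _ _ _))
    · intro x
      rw [Setoid.ker_def]
      rcases hs x with rfl | rfl | ⟨z, rfl⟩
      · rw [hG.P_p, h2 _ hp, h2 _ hq]
      · rw [hG.P_q, h2 _ hp, h2 _ hq]
      · rw [hG.P_e, h1, h1]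
        exact congrArg some (Quotient.sound (loops_right _ _ _))
  have key : ∀ a b, loops P G (e a) (e b) ↔ loops P' G' a b := by
    intro a b
    constructor
    · intro h
      have := hle h
      rw [Setoid.ker_def, h1, h1] at this
      exact Quotient.exact (Option.some.inj this)
    · apply loops_map
      · intro z
        rw [← hP.P_e]; exact loops_left _ _ _
      · intro z
        rw [← hG.P_e]; exact loops_right _ _ _
  refine ⟨key, ?_⟩
  have hpq : loops P G p q := by rw [← hG.P_p]; exact loops_right _ _ _
  rw [numLoops, numLoops, ← Finite.card_option]
  symm
  apply Nat.card_eq_of_bijective (fun o : Option (Quotient (loops P' G')) =>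
    o.elim (Quotient.mk (loops P G) p) (Quotient.map e fun a b h => (key a b).2 h))
  have hpe : ∀ z, ¬ loops P G p (e z) := by
    intro z h
    have := hle h
    rw [Setoid.ker_def, h1, h2 _ hp] at this
    exact absurd this (by simp)
  constructor
  · rintro (_ | a) (_ | b) h
    · rfl
    · induction b using Quotient.inductionOn with
      | h b => exact absurd (Quotient.exact h) (hpe b)
    · induction a using Quotient.inductionOn with
      | h a => exact absurd (Quotient.exact h.symm) (hpe a)
    · congr 1
      induction a, b using Quotient.inductionOn₂ with
      | h a b => exact Quotient.sound ((key a b).1 (Quotient.exact h))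
  · intro c
    induction c using Quotient.inductionOn with
    | h x =>
      rcases hs x with rfl | rfl | ⟨z, rfl⟩
      · exact ⟨none, rfl⟩
      · exact ⟨none, Quotient.sound hpq⟩
      · exact ⟨some (Quotient.mk _ z), rfl⟩

end Gap

/-! ### All pairings on two more points -/

section Expand

variable {Y X : Type*} [DecidableEq X]

/-- The permutation with edge `{p, q}` that agrees with `P'` elsewhere. -/
noncomputable def trivialExpand (e : Y ↪ X) (p q : X) (P' : Perm Y) : Perm X :=
  P'.viaEmbedding e * swap p q

/-- The permutation that arises from `P'` by inserting the points `p` and `q` in such a way that `p`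
is connected with `u`. -/
noncomputable def expand (e : Y ↪ X) (p q : X) (P' : Perm Y) (u : X) : Perm X :=
  swap q u * trivialExpand e p q P' * swap q u

variable {e : Y ↪ X} {p q : X} (hpq : p ≠ q) (hp : ∀ z, e z ≠ p) (hq : ∀ z, e z ≠ q)
  (hs : ∀ x, x = p ∨ x = q ∨ ∃ z, e z = x)

section
variable {P' : Perm Y}
include hp hq

omit hp in
theorem trivialExpand_left : trivialExpand e p q P' p = q := by
  rw [trivialExpand, Perm.mul_apply, swap_apply_left, viaEmbedding_apply_of_notMem]
  rintro ⟨z, hz⟩; exact hq z hz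

omit hq in
theorem trivialExpand_right : trivialExpand e p q P' q = p := by
  rw [trivialExpand, Perm.mul_apply, swap_apply_right, viaEmbedding_apply_of_notMem]
  rintro ⟨z, hz⟩; exact hp z hz

theorem trivialExpand_apply (z : Y) : trivialExpand e p q P' (e z) = e (P' z) := by
  rw [trivialExpand, Perm.mul_apply, swap_apply_of_ne_of_ne (hp z) (hq z), viaEmbedding_apply]

include hpq hs in
theorem isTrivialExpansion_trivialExpand (hP' : IsPairing P') :
    IsTrivialExpansion e p q P' (trivialExpand e p q P') := by
  refine ⟨hP', ⟨?_, ?_⟩, trivialExpand_left hq, trivialExpand_right hp,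
    trivialExpand_apply hp hq⟩
  · ext x
    rw [Perm.mul_apply, Perm.one_apply]
    rcases hs x with rfl | rfl | ⟨z, rfl⟩
    · rw [trivialExpand_left hq, trivialExpand_right hp]
    · rw [trivialExpand_right hp, trivialExpand_left hq]
    · rw [trivialExpand_apply hp hq, trivialExpand_apply hp hq, hP'.apply_apply]
  · intro x
    rcases hs x with rfl | rfl | ⟨z, rfl⟩
    · rw [trivialExpand_left hq]; exact hpq.symm
    · rw [trivialExpand_right hp]; exact hpq
    · rw [trivialExpand_apply hp hq]; exact fun h => hP'.2 z (e.injective h)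

omit hp hq [DecidableEq X] in
theorem isPairing_conj {P : Perm X} (hP : IsPairing P) (s : Perm X) (h : s * s = 1) :
    IsPairing (s * P * s) := by
  constructor
  · have : s * P * s * (s * P * s) = s * (P * (s * s) * P) * s := by group
    rw [this, h, mul_one, hP.1, mul_one, h]
  · intro x hx
    have hss : ∀ x, s (s x) = x := fun x => by rw [← Perm.mul_apply, h, Perm.one_apply]
    have : P (s x) = s x := by
      rw [← hss (P (s x))]
      exact congrArg s hx
    exact hP.2 _ this

omit hp hq in
theorem expand_self : expand e p q P' q = trivialExpand e p q P' := by
  ext x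
  simp [expand]

include hpq hs in
theorem isExpansion_expand (hP' : IsPairing P') (y : Y) :
    IsExpansion e p q P' (expand e p q P' (e y)) y := by
  have hT := isTrivialExpansion_trivialExpand hpq hp hq hs hP'
  have hsw : swap q (e y) p = p := swap_apply_of_ne_of_ne hpq (hp y).symm
  refine ⟨hP', isPairing_conj hT.P_pairing _ (swap_mul_self _ _), ?_, ?_, ?_⟩
  · rw [expand, Perm.mul_apply, Perm.mul_apply, hsw, hT.P_p, swap_apply_left]
  · rw [expand, Perm.mul_apply, Perm.mul_apply, swap_apply_left, hT.P_e,
      swap_apply_of_ne_of_ne (hq _) fun h => hP'.2 y (e.injective h)]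
  · intro z h1 h2
    rw [expand, Perm.mul_apply, Perm.mul_apply,
      swap_apply_of_ne_of_ne (hq _) fun h => h1 (e.injective h), hT.P_e,
      swap_apply_of_ne_of_ne (hq _)]
    intro h
    apply h2
    rw [← e.injective h, hP'.apply_apply]

end

include hpq hp hq hs in
-- The option records the partner of `p`, with `none` for `q`. Conjugation by the transposition of
-- `q` and this partner creates the edge {p, q}, and the rest of the conjugated pairing lives on
-- `Y`.
theorem exists_expand_eq {P : Perm X} (hP : IsPairing P) :
    ∃ P' : Perm Y, IsPairing P' ∧ ∃ o : Option Y, expand e p q P' (o.elim q e) = P := by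
  obtain ⟨o, ho⟩ : ∃ o : Option Y, o.elim q e = P p := by
    rcases hs (P p) with h | h | ⟨z, hz⟩
    · exact absurd h (hP.2 p)
    · exact ⟨none, h.symm⟩
    · exact ⟨some z, hz⟩
  set s : Perm X := swap q (P p) with hsdef
  have hss : s * s = 1 := swap_mul_self _ _
  have hPh := isPairing_conj hP s hss
  have hsp : s p = p := swap_apply_of_ne_of_ne hpq (hP.2 p).symm
  have hPhp : (s * P * s) p = q := by
    rw [Perm.mul_apply, Perm.mul_apply, hsp, hsdef, swap_apply_right]
  have hPhq : (s * P * s) q = p := by rw [← hPhp, hPh.apply_apply]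
  have hr : ∀ z, ∃ z', e z' = (s * P * s) (e z) := by
    intro z
    rcases hs ((s * P * s) (e z)) with h | h | h
    · rw [hPh.apply_eq_iff, hPhp] at h; exact absurd h (hq z)
    · rw [hPh.apply_eq_iff, hPhq] at h; exact absurd h (hp z)
    · exact h
  choose f hf using hr
  have hinv : Function.Involutive f := by
    intro z
    apply e.injective
    rw [hf, hf, hPh.apply_apply]
  have hP' : IsPairing hinv.toPerm := by
    constructor
    · ext z; exact hinv z
    · intro z hz
      apply hPh.2 (e z)
      rw [← hf]
      exact congrArg e hz
  refine ⟨hinv.toPerm, hP', o, ?_⟩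
  have h5 : trivialExpand e p q hinv.toPerm = s * P * s := by
    ext x
    rcases hs x with rfl | rfl | ⟨z, rfl⟩
    · rw [trivialExpand_left hq, hPhp]
    · rw [trivialExpand_right hp, hPhq]
    · rw [trivialExpand_apply hp hq, ← hf]; rfl
  simp only [expand, ho, h5, ← hsdef]
  have : s * (s * P * s) * s = (s * s) * P * (s * s) := by group
  rw [this, hss, one_mul, mul_one]

open Classical in
/-- The set of pairings of a finite type. -/
noncomputable def pairings (X : Type*) [Fintype X] [DecidableEq X] : Finset (Perm X) :=
  Finset.univ.filter IsPairing

omit [DecidableEq X] in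
theorem mem_pairings [Fintype X] [DecidableEq X] {P : Perm X} : P ∈ pairings X ↔ IsPairing P := by
  simp [pairings]

include hpq hp hq hs in
-- A pairing of `X` amounts to a pairing of `Y` together with the partner of `p`, which is either
-- `q` or the image of a point of `Y`.
theorem sum_pairings [Fintype Y] [DecidableEq Y] [Fintype X] {M : Type*} [AddCommMonoid M]
    (g : Perm X → M) :
    ∑ P ∈ pairings X, g P = ∑ P' ∈ pairings Y,
      (g (trivialExpand e p q P') + ∑ y, g (expand e p q P' (e y))) := by
  have h1 : ∀ P' : Perm Y, g (trivialExpand e p q P') + ∑ y, g (expand e p q P' (e y)) =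
      ∑ o : Option Y, g (expand e p q P' (o.elim q e)) := by
    intro P'
    rw [Fintype.sum_option]
    simp [expand_self]
  simp only [h1]
  rw [← Finset.sum_product' (f := fun P' (o : Option Y) => g (expand e p q P' (o.elim q e)))]
  symm
  have hop : ∀ (P' : Perm Y) (o : Option Y), expand e p q P' (o.elim q e) p = o.elim q e := by
    intro P' o
    have : swap q (o.elim q e) p = p := by
      apply swap_apply_of_ne_of_ne hpq
      cases o
      · exact hpq
      · exact (hp _).symm
    rw [expand, Perm.mul_apply, Perm.mul_apply, this, trivialExpand_left hq, swap_apply_left]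
  refine Finset.sum_bij (fun x _ => expand e p q x.1 (x.2.elim q e)) ?_ ?_ ?_ ?_
  · rintro ⟨P', o⟩ hx
    rw [Finset.mem_product, mem_pairings] at hx
    rw [mem_pairings]
    cases o with
    | none =>
      simp only [Option.elim_none, expand_self]
      exact (isTrivialExpansion_trivialExpand hpq hp hq hs hx.1).P_pairing
    | some y => exact (isExpansion_expand hpq hp hq hs hx.1 y).P_pairing
  · rintro ⟨P₁, o₁⟩ _ ⟨P₂, o₂⟩ _ h
    have h2 := congrArg (fun f : Perm X => f p) h
    simp only [hop] at h2
    have ho : o₁ = o₂ := by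
      cases o₁ <;> cases o₂
      · rfl
      · exact absurd h2.symm (hq _)
      · exact absurd h2 (hq _)
      · exact congrArg some (e.injective h2)
    subst ho
    have h3 : trivialExpand e p q P₁ = trivialExpand e p q P₂ :=
      mul_left_cancel (mul_right_cancel h)
    congr 1
    ext z
    have h4 := congrArg (fun f : Perm X => f (e z)) h3
    simp only [trivialExpand_apply hp hq] at h4
    exact e.injective h4
  · intro P hP
    obtain ⟨P', hP', o, h⟩ := exists_expand_eq hpq hp hq hs (mem_pairings.1 hP)
    exact ⟨(P', o), by simp [mem_pairings, hP'], h⟩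
  · intros; rfl

end Expand

theorem sameCycle_invariant {X Z : Type*} {σ : Perm X} {f : X → Z} (h : ∀ x, f (σ x) = f x)
    {x y : X} (hxy : SameCycle σ x y) : f x = f y := by
  have key : ∀ (k : ℤ) x, f ((σ ^ k) x) = f x := by
    intro k
    induction k using Int.induction_on with
    | zero => simp
    | succ k ih => intro x; rw [zpow_add_one, Perm.mul_apply, ih, h]
    | pred k ih =>
      intro x
      rw [zpow_sub_one, Perm.mul_apply, ih, ← h (σ⁻¹ x)]
      simp
  obtain ⟨k, rfl⟩ := hxy
  exact (key k x).symm

/-! ### Removing the points -i and i+1 from [±(n+1)] -/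

theorem isPairing_delta (n : ℕ) : IsPairing (delta n) := by
  constructor
  · ext x; cases x <;> rfl
  · intro x; cases x <;> simp [delta]

/-- The pairing with edges `{-i, i + 1}`. -/
def gap (n : ℕ) : Perm (Pm n) := gammaPm n * delta n * (gammaPm n)⁻¹

theorem annulus_eq (n : ℕ) : annulus n = gap n * delta n := rfl

theorem gap_inr {n : ℕ} (j : Fin n) : gap n (.inr j) = .inl (finRotate n j) := rfl

theorem gap_inl {n : ℕ} (j : Fin n) : gap n (.inl j) = .inr ((finRotate n)⁻¹ j) := rfl

theorem isPairing_gap (n : ℕ) : IsPairing (gap n) := by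
  constructor
  · refine Equiv.ext fun x => ?_
    cases x
    · exact congrArg Sum.inl (Equiv.apply_symm_apply _ _)
    · exact congrArg Sum.inr (Equiv.symm_apply_apply _ _)
  · intro x; cases x <;> simp [gap_inl, gap_inr]

/-- Skipping `i` in the source and `i + 1` in the target shortens the rotation by one point. This is
what makes `gap (n + 1)` restrict to `gap n`. -/
theorem finRotate_succAbove {n : ℕ} (i j : Fin n) :
    finRotate (n + 1) (i.castSucc.succAbove j) = i.succ.succAbove (finRotate n j) := by
  rcases n with _ | n
  · exact i.elim0
  rcases Fin.eq_castSucc_or_eq_last j with ⟨j, rfl⟩ | rfl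
  · have h : finRotate (n + 1) j.castSucc = j.succ := by simp
    rw [h]
    have h2 : i.castSucc.succAbove j.castSucc ≠ Fin.last _ := by
      intro h3
      have := congrArg Fin.val h3
      simp [Fin.succAbove, Fin.lt_def] at this
      split_ifs at this <;> simp at this <;> omega
    apply Fin.ext
    rw [coe_finRotate_of_ne_last h2]
    simp [Fin.succAbove, Fin.lt_def]
    split_ifs <;> simp
  · have hi : ¬ n < (i : ℕ) := by omega
    have : i.castSucc.succAbove (Fin.last n) = Fin.last _ := by
      apply Fin.ext
      simp [Fin.succAbove, Fin.lt_def, hi]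
    rw [this, finRotate_last, finRotate_last]
    simp [Fin.succAbove, Fin.lt_def]

/-- The embedding of `[±n]` into `[±(n + 1)]` that omits `-i` and `i + 1`. -/
def contractEmb {n : ℕ} (i : Fin n) : Pm n ↪ Pm (n + 1) where
  toFun := Sum.map i.succ.succAbove i.castSucc.succAbove
  inj' := Sum.map_injective.2 ⟨Fin.succAbove_right_injective, Fin.succAbove_right_injective⟩

section Contract

variable {n : ℕ} (i : Fin n)

theorem contractEmb_inl (j : Fin n) : contractEmb i (.inl j) = .inl (i.succ.succAbove j) := rfl

theorem contractEmb_inr (j : Fin n) : contractEmb i (.inr j) = .inr (i.castSucc.succAbove j) := rfl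

theorem succ_succAbove_self : i.succ.succAbove i = i.castSucc := Fin.succAbove_succ_self i

theorem castSucc_succAbove_self : i.castSucc.succAbove i = i.succ := Fin.succAbove_castSucc_self i

theorem contractEmb_ne_left (z : Pm n) : contractEmb i z ≠ .inr i.castSucc := by
  rcases z with j | j
  · simp [contractEmb_inl]
  · simp [contractEmb_inr, Fin.succAbove_ne]

theorem contractEmb_ne_right (z : Pm n) : contractEmb i z ≠ .inl i.succ := by
  rcases z with j | j
  · simp [contractEmb_inl, Fin.succAbove_ne]
  · simp [contractEmb_inr]

theorem contractEmb_surj (x : Pm (n + 1)) :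
    x = .inr i.castSucc ∨ x = .inl i.succ ∨ ∃ z, contractEmb i z = x := by
  rcases x with j | j
  · by_cases h : j = i.succ
    · simp [h]
    · obtain ⟨k, hk⟩ := Fin.exists_succAbove_eq h
      exact .inr (.inr ⟨.inl k, by rw [contractEmb_inl, hk]⟩)
  · by_cases h : j = i.castSucc
    · simp [h]
    · obtain ⟨k, hk⟩ := Fin.exists_succAbove_eq h
      exact .inr (.inr ⟨.inr k, by rw [contractEmb_inr, hk]⟩)

theorem isLeft_contractEmb (z : Pm n) : (contractEmb i z).isLeft = z.isLeft := by
  cases z <;> rfl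

theorem succAbove_succ_eq {j : Fin n} (h : j ≠ i) :
    i.succ.succAbove j = i.castSucc.succAbove j := by
  rw [Ne, Fin.ext_iff] at h
  apply Fin.ext
  simp only [Fin.succAbove, Fin.lt_def, Fin.val_castSucc, Fin.val_succ]
  split_ifs <;> simp <;> omega

/-- The removal leaves i and -(i+1) without partners; they are the images of i and -i, so on [±n]
they are paired with each other. -/
theorem isContraction_delta : IsContraction (contractEmb i) (.inr i.castSucc) (.inl i.succ)
    (delta n) (delta (n + 1)) (.inl i) (.inr i) where
  inj := (contractEmb i).injective
  ne := by simp
  p_ne := contractEmb_ne_left i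
  q_ne := contractEmb_ne_right i
  surj := contractEmb_surj i
  D'_pairing := isPairing_delta n
  D_pairing := isPairing_delta (n + 1)
  D_p := by rw [contractEmb_inl, succ_succAbove_self]; rfl
  D_q := by rw [contractEmb_inr, castSucc_succAbove_self]; rfl
  D'_x := rfl
  D_e := by
    rintro (j | j) h1 h2
    · have : j ≠ i := fun h => h1 (by rw [h])
      change Sum.inr _ = Sum.inr _
      rw [succAbove_succ_eq i this]
    · have : j ≠ i := fun h => h2 (by rw [h])
      change Sum.inl _ = Sum.inl _
      rw [succAbove_succ_eq i this]

theorem isTrivialExpansion_gap : IsTrivialExpansion (contractEmb i) (.inr i.castSucc) (.inl i.succ)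
    (gap n) (gap (n + 1)) := by
  have hp : gap (n + 1) (.inr i.castSucc) = .inl i.succ := by
    rw [gap_inr]; simp
  have hr : ∀ j, gap (n + 1) (contractEmb i (.inr j)) = contractEmb i (gap n (.inr j)) := by
    intro j
    rw [contractEmb_inr, gap_inr, gap_inr, contractEmb_inl, finRotate_succAbove]
  refine ⟨isPairing_gap n, isPairing_gap (n + 1), hp, ?_, ?_⟩
  · rw [← hp, (isPairing_gap _).apply_apply]
  · rintro (j | j)
    · obtain ⟨k, hk⟩ : ∃ k, gap n (.inl j) = .inr k := ⟨_, gap_inl j⟩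
      have hj : (Sum.inl j : Pm n) = gap n (.inr k) := by
        rw [← hk, (isPairing_gap _).apply_apply]
      rw [hk, hj, ← hr, (isPairing_gap _).apply_apply]
    · exact hr j

/-- The pairings of `[±(n + 1)]` that arise from a pairing of `[±n]` by inserting the edge
`{-i, i + 1}`. -/
noncomputable def insertEdge (P' : Perm (Pm n)) : Perm (Pm (n + 1)) :=
  trivialExpand (contractEmb i) (.inr i.castSucc) (.inl i.succ) P'

/-- The pairing of `[±(n + 1)]` that arises from `P'` by inserting `-i` and `i + 1` on the edge
`{y, P' y}`. -/
noncomputable def insertOn (P' : Perm (Pm n)) (y : Pm n) : Perm (Pm (n + 1)) :=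
  expand (contractEmb i) (.inr i.castSucc) (.inl i.succ) P' (contractEmb i y)

variable {i} {P' : Perm (Pm n)} (hP' : IsPairing P')

include hP' in
theorem isTrivialExpansion_insertEdge : IsTrivialExpansion (contractEmb i) (.inr i.castSucc)
    (.inl i.succ) P' (insertEdge i P') :=
  isTrivialExpansion_trivialExpand (by simp) (contractEmb_ne_left i) (contractEmb_ne_right i)
    (contractEmb_surj i) hP'

include hP' in
theorem isExpansion_insertOn (y : Pm n) : IsExpansion (contractEmb i) (.inr i.castSucc)
    (.inl i.succ) P' (insertOn i P' y) y :=
  isExpansion_expand (by simp) (contractEmb_ne_left i) (contractEmb_ne_right i)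
    (contractEmb_surj i) hP' y

variable (i) in
theorem exists_insert_eq {P : Perm (Pm (n + 1))} (hP : IsPairing P) :
    ∃ P', IsPairing P' ∧ (P = insertEdge i P' ∨ ∃ y, P = insertOn i P' y) := by
  obtain ⟨P', hP', o, ho⟩ := exists_expand_eq (e := contractEmb i) (by simp)
    (contractEmb_ne_left i) (contractEmb_ne_right i) (contractEmb_surj i) hP
  refine ⟨P', hP', ?_⟩
  cases o with
  | none => left; rw [← ho]; exact expand_self
  | some y => exact .inr ⟨y, ho.symm⟩

variable (i) in
theorem sum_pairings_succ {M : Type*} [AddCommMonoid M] (g : Perm (Pm (n + 1)) → M) :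
    ∑ P ∈ pairings (Pm (n + 1)), g P =
      ∑ P' ∈ pairings (Pm n), (g (insertEdge i P') + ∑ y, g (insertOn i P' y)) :=
  sum_pairings (e := contractEmb i) (by simp)
    (contractEmb_ne_left i) (contractEmb_ne_right i) (contractEmb_surj i) g

/-- The total number of loops that `P` forms with `delta n` and with `gap n`. -/
noncomputable def totalLoops (P : Perm (Pm n)) : ℕ := numLoops P (delta n) + numLoops P (gap n)

include hP' in
theorem loops_gap_insertEdge :
    (∀ a b, loops (insertEdge i P') (gap (n + 1)) (contractEmb i a) (contractEmb i b) ↔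
      loops P' (gap n) a b) ∧
    numLoops (insertEdge i P') (gap (n + 1)) = numLoops P' (gap n) + 1 :=
  (isTrivialExpansion_gap i).loops_gap (contractEmb i).injective (contractEmb_ne_left i)
    (contractEmb_ne_right i) (contractEmb_surj i) (isTrivialExpansion_insertEdge hP')

include hP' in
theorem loops_gap_insertOn (y : Pm n) :
    (∀ a b, loops (insertOn i P' y) (gap (n + 1)) (contractEmb i a) (contractEmb i b) ↔
      loops P' (gap n) a b) ∧
    numLoops (insertOn i P' y) (gap (n + 1)) = numLoops P' (gap n) :=
  (isExpansion_insertOn hP' y).loops_gap (contractEmb i).injective (contractEmb_ne_left i)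
    (contractEmb_ne_right i) (contractEmb_surj i) (isTrivialExpansion_gap i)

section
variable {w : List (Pm n)} {W : List (List (Pm n))}
  (hW : LoopDecomp P' (delta n) ((.inl i :: w) :: W))
include hP' hW

theorem loopDecomp_insertEdge : LoopDecomp (insertEdge i P') (delta (n + 1))
    ((.inl i.castSucc :: .inl i.succ :: w.map (contractEmb i)) ::
      W.map (List.map (contractEmb i))) := by
  have := (isTrivialExpansion_insertEdge hP').loopDecomp (isContraction_delta i) hW
  rwa [contractEmb_inl, succ_succAbove_self] at this

theorem loopDecomp_split {A B : List (Pm n)} {y : Pm n} (hw : w = A ++ B)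
    (hy : (B ++ [Sum.inl i]).head (by simp) = y) : LoopDecomp (insertOn i P' y) (delta (n + 1))
      ((.inl i.castSucc :: B.map (contractEmb i)) :: (.inl i.succ :: A.map (contractEmb i)) ::
        W.map (List.map (contractEmb i))) := by
  subst hw
  have := (isExpansion_insertOn hP' y).split (isContraction_delta i) hW hy
  rwa [contractEmb_inl, succ_succAbove_self] at this

theorem loopDecomp_twist {A B : List (Pm n)} {y : Pm n}
    (hA : Sum.inl i :: w = A ++ delta n y :: B) : LoopDecomp (insertOn i P' y) (delta (n + 1))
      ((.inl i.castSucc :: (((A ++ [delta n y]).map (delta n)).reverse.map (contractEmb i) ++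
        B.map (contractEmb i))) :: W.map (List.map (contractEmb i))) := by
  have := (isExpansion_insertOn hP' y).twist (isContraction_delta i) hW hA
  rwa [contractEmb_inl, succ_succAbove_self] at this

end

theorem isLeft_or_isLeft_delta (z : Pm n) : z.isLeft ∨ (delta n z).isLeft := by
  cases z
  · exact .inl rfl
  · exact .inr rfl

variable (i) in
include hP' in
theorem exists_loopDecomp : ∃ w W, orbitWord (P' * delta n) (.inl i) = .inl i :: w ∧
    LoopDecomp P' (delta n) ((.inl i :: w) :: W) ∧
    ∀ l ∈ W, ∃ z v, l = z :: v ∧ z.isLeft := by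
  obtain ⟨w, hw⟩ := orbitWord_eq_cons (P' * delta n) (.inl i)
  obtain ⟨W, hW, hW'⟩ := exists_loopDecomp_cons hP' (isPairing_delta n) (.inl i)
    (good := fun z => z.isLeft) isLeft_or_isLeft_delta
  exact ⟨w, W, hw, hw ▸ hW, hW'⟩

include hP' in
-- The new edge is a loop with `gap` and only lengthens a loop with `delta`.
theorem totalLoops_insertEdge : totalLoops (insertEdge i P') = totalLoops P' + 1 := by
  obtain ⟨w, W, -, hW, -⟩ := exists_loopDecomp i hP'
  rw [totalLoops, totalLoops, hW.length_eq hP' (isPairing_delta n),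
    (loopDecomp_insertEdge hP' hW).length_eq (isTrivialExpansion_insertEdge hP').P_pairing
      (isPairing_delta _), (loops_gap_insertEdge hP').2]
  simp; omega

include hP' in
theorem totalLoops_split {y : Pm n} (h : SameCycle (P' * delta n) (.inl i) y) :
    totalLoops (insertOn i P' y) = totalLoops P' + 1 := by
  obtain ⟨w, W, -, hW, -⟩ := exists_loopDecomp i hP'
  have hy : y ∈ w ++ [.inl i] := by
    have := (hW.cyc (.inl i :: w) (by simp)).mem_iff.2 h
    simp at this ⊢; tauto
  obtain ⟨A, B, hAB⟩ := List.append_of_mem hy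
  obtain ⟨B', hB', hw⟩ : ∃ B', B' ++ [.inl i] = y :: B ∧ w = A ++ B' := by
    rcases List.eq_nil_or_concat' B with rfl | ⟨B', b, rfl⟩
    · have := List.append_inj' hAB rfl
      exact ⟨[], by simpa using this.2, by simpa using this.1⟩
    · have h1 : w ++ [.inl i] = (A ++ y :: B') ++ [b] := by simpa using hAB
      have := List.append_inj' h1 rfl
      exact ⟨y :: B', by simpa using this.2, this.1⟩
  have h2 := loopDecomp_split hP' hW hw (y := y) (by simp [hB'])
  rw [totalLoops, totalLoops, hW.length_eq hP' (isPairing_delta n),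
    h2.length_eq (isExpansion_insertOn hP' y).P_pairing
      (isPairing_delta _), (loops_gap_insertOn hP' y).2]
  simp; omega

include hP' in
-- Only the order within one loop changes. As the maximum grows by one with the size, this insertion
-- loses one loop relative to it and will contribute a factor ε.
theorem totalLoops_twist {y : Pm n} (h : SameCycle (P' * delta n) (.inl i) (delta n y)) :
    totalLoops (insertOn i P' y) = totalLoops P' := by
  obtain ⟨w, W, -, hW, -⟩ := exists_loopDecomp i hP'
  have hy : delta n y ∈ Sum.inl i :: w := (hW.cyc _ (by simp)).mem_iff.2 h
  obtain ⟨A, B, hAB⟩ := List.append_of_mem hy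
  have h2 := loopDecomp_twist hP' hW hAB
  rw [totalLoops, totalLoops, hW.length_eq hP' (isPairing_delta n),
    h2.length_eq (isExpansion_insertOn hP' y).P_pairing
      (isPairing_delta _), (loops_gap_insertOn hP' y).2]
  simp

include hP' in
-- Relative to the growing maximum two loops are lost, so these insertions will contribute ε² = 0.
theorem totalLoops_merge {y : Pm n} (h : ¬ loops P' (delta n) (.inl i) y) :
    totalLoops (insertOn i P' y) + 1 = totalLoops P' := by
  obtain ⟨W, hW⟩ := exists_loopDecomp_cons_cons hP' (isPairing_delta n) h
  obtain ⟨w, hw⟩ := orbitWord_eq_cons (P' * delta n) (.inl i)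
  obtain ⟨v, hv⟩ := orbitWord_eq_cons (P' * delta n) y
  rw [hw, hv] at hW
  have h2 := (isExpansion_insertOn hP' y).merge (isContraction_delta i) hW
  rw [totalLoops, totalLoops, hW.length_eq hP' (isPairing_delta n),
    h2.length_eq (isExpansion_insertOn hP' y).P_pairing
      (isPairing_delta _), (loops_gap_insertOn hP' y).2]
  simp; omega

/-- All edges of `P` connect a positive with a negative point. -/
def IsOrientable (P : Perm (Pm n)) : Prop := ∀ x, (P x).isLeft = !x.isLeft

omit i in
theorem IsOrientable.isLeft_eq {P : Perm (Pm n)} (h : IsOrientable P) {x y : Pm n}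
    (hxy : SameCycle (P * delta n) x y) : x.isLeft = y.isLeft := by
  apply sameCycle_invariant _ hxy
  intro z
  rw [Perm.mul_apply, h]
  cases z <;> rfl

include hP' in
theorem isOrientable_insertEdge : IsOrientable (insertEdge i P') ↔ IsOrientable P' := by
  have h := isTrivialExpansion_insertEdge (i := i) hP'
  constructor
  · intro h1 x
    rw [← isLeft_contractEmb i, ← h.P_e, h1, isLeft_contractEmb]
  · intro h1 x
    rcases contractEmb_surj i x with rfl | rfl | ⟨z, rfl⟩
    · rw [h.P_p]; rfl
    · rw [h.P_q]; rfl
    · rw [h.P_e, isLeft_contractEmb, isLeft_contractEmb, h1]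

include hP' in
theorem isOrientable_insertOn {y : Pm n} :
    IsOrientable (insertOn i P' y) ↔ IsOrientable P' ∧ y.isLeft := by
  have h := isExpansion_insertOn (i := i) hP' y
  have hy : insertOn i P' y (contractEmb i y) = .inr i.castSucc := by
    rw [← h.P_p, h.P_pairing.apply_apply]
  have hy' : insertOn i P' y (contractEmb i (P' y)) = .inl i.succ := by
    rw [← h.P_q, h.P_pairing.apply_apply]
  constructor
  · intro h1
    have h2 : y.isLeft = true := by
      rw [← isLeft_contractEmb i, ← h.P_p, h1]; rfl
    have h3 : (P' y).isLeft = false := by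
      rw [← isLeft_contractEmb i, ← h.P_q, h1]; rfl
    refine ⟨fun x => ?_, h2⟩
    by_cases x1 : x = y
    · rw [x1, h2, h3]; rfl
    · by_cases x2 : x = P' y
      · rw [x2, hP'.apply_apply, h2, h3]; rfl
      · rw [← isLeft_contractEmb i, ← h.P_e x x1 x2, h1, isLeft_contractEmb]
  · rintro ⟨h1, h2⟩ x
    have h3 : (P' y).isLeft = false := by rw [h1, h2]; rfl
    rcases contractEmb_surj i x with rfl | rfl | ⟨z, rfl⟩
    · rw [h.P_p, isLeft_contractEmb, h2]; rfl
    · rw [h.P_q, isLeft_contractEmb, h3]; rfl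
    · by_cases x1 : z = y
      · rw [x1, hy, isLeft_contractEmb, h2]; rfl
      · by_cases x2 : z = P' y
        · rw [x2, hy', isLeft_contractEmb, h3]; rfl
        · rw [h.P_e z x1 x2, isLeft_contractEmb, isLeft_contractEmb, h1]

end Contract

/-- The Euler characteristic bound: spheres have `n + 1` loops and are orientable, projective planes
have `n` loops and are not orientable. -/
theorem totalLoops_spec (n : ℕ) {P : Perm (Pm (n + 1))} (hP : IsPairing P) :
    totalLoops P ≤ n + 2 ∧ (totalLoops P = n + 2 → IsOrientable P) ∧
      (IsOrientable P → totalLoops P ≠ n + 1) := by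
  induction n with
  | zero =>
    have h0 : ∀ x : Pm 1, x = .inl 0 ∨ x = .inr 0 := by
      rintro (x | x)
      · left; congr; omega
      · right; congr; omega
    have hP0 : P (.inl 0) = .inr 0 := (h0 _).resolve_left (hP.2 _)
    have hP1 : P (.inr 0) = .inl 0 := (h0 _).resolve_right (hP.2 _)
    have hl : ∀ D : Perm (Pm 1), numLoops P D = 1 := by
      intro D
      have h1 : loops P D (.inl 0) (.inr 0) := by rw [← hP0]; exact loops_left _ _ _
      have h2 : ∀ x y, loops P D x y := by
        intro x y
        rcases h0 x with rfl | rfl <;> rcases h0 y with rfl | rfl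
        · exact (loops P D).refl _
        · exact h1
        · exact (loops P D).symm h1
        · exact (loops P D).refl _
      rw [numLoops, Nat.card_eq_one_iff_unique]
      refine ⟨⟨fun a b => ?_⟩, ⟨Quotient.mk _ (.inl 0)⟩⟩
      induction a, b using Quotient.inductionOn₂ with
      | h a b => exact Quotient.sound (h2 a b)
    have ht : totalLoops P = 2 := by rw [totalLoops, hl, hl]
    refine ⟨by omega, fun _ x => ?_, fun _ => by omega⟩
    rcases h0 x with rfl | rfl
    · rw [hP0]; rfl
    · rw [hP1]; rfl
  | succ n ih =>
    -- The points -1 and 2 are removed. A new edge or a split raises the count along with the bound,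
    -- a reversal never yields an orientable pairing, and a merge stays below both critical values.
    obtain ⟨P', hP', rfl | ⟨y, rfl⟩⟩ := exists_insert_eq 0 hP
    · obtain ⟨h1, h2, h3⟩ := ih hP'
      rw [totalLoops_insertEdge hP', isOrientable_insertEdge hP']
      exact ⟨by omega, fun h => h2 (by omega), fun h h' => h3 h (by omega)⟩
    · obtain ⟨h1, h2, h3⟩ := ih hP'
      rw [isOrientable_insertOn hP']
      by_cases hs : SameCycle (P' * delta (n + 1)) (.inl 0) y
      · rw [totalLoops_split hP' hs]
        refine ⟨by omega, fun h => ?_, fun h h' => h3 h.1 (by omega)⟩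
        have h4 := h2 (by omega)
        exact ⟨h4, by rw [← h4.isLeft_eq hs]; rfl⟩
      by_cases ht : SameCycle (P' * delta (n + 1)) (.inl 0) (delta _ y)
      · rw [totalLoops_twist hP' ht]
        refine ⟨by omega, fun h => by omega, fun h => ?_⟩
        have h4 := h.1.isLeft_eq ht
        have h5 := h.2
        rcases y with y | y
        · exact absurd h4 (by simp [delta])
        · simp at h5
      · have hm : ¬ loops P' (delta (n + 1)) (.inl 0) y := by
          rw [loops_iff hP' (isPairing_delta _)]
          rintro (h | h)
          · exact hs h
          · exact ht (by
              simpa [(isPairing_delta _).apply_apply] using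
                hP'.sameCycle_conj (isPairing_delta _) h)
        have := totalLoops_merge hP' hm
        exact ⟨by omega, fun h => by omega, fun _ => by omega⟩

/-! ### Transpositions, cycle counts and the genus inequality -/

section Merge

variable {α : Type*}

theorem card_quotient_le [Finite α] {r s : Setoid α} (h : r ≤ s) :
    Nat.card (Quotient s) ≤ Nat.card (Quotient r) :=
  Nat.card_le_card_of_surjective (Quotient.map' id fun _ _ hxy => h hxy) fun c => by
    induction c using Quotient.inductionOn with
    | h a => exact ⟨Quotient.mk _ a, rfl⟩

open Classical in
/-- The equivalence relation that arises from `r` by joining the classes of `x` and `y`. -/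
noncomputable def joinPair (r : Setoid α) (x y : α) : Setoid α :=
  Setoid.ker fun a => if r a y then Quotient.mk r x else Quotient.mk r a

theorem le_joinPair (r : Setoid α) (x y : α) : r ≤ joinPair r x y := by
  intro a b h
  rw [joinPair, Setoid.ker_def]
  by_cases hb : r b y
  · rw [if_pos hb, if_pos (r.trans h hb)]
  · rw [if_neg hb, if_neg fun ha => hb (r.trans (r.symm h) ha)]
    exact Quotient.sound h

theorem joinPair_apply (r : Setoid α) (x y : α) : joinPair r x y x y := by
  rw [joinPair, Setoid.ker_def, if_pos (r.refl y)]
  split_ifs <;> rfl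

theorem card_joinPair [Finite α] {r : Setoid α} {x y : α} (h : ¬ r x y) :
    Nat.card (Quotient (joinPair r x y)) + 1 = Nat.card (Quotient r) := by
  classical
  have := Fintype.ofFinite (Quotient r)
  rw [joinPair, Nat.card_congr (Setoid.quotientKerEquivRange _)]
  have : Set.range (fun a => if r a y then Quotient.mk r x else Quotient.mk r a) =
      {c | c ≠ Quotient.mk r y} := by
    ext c
    constructor
    · rintro ⟨a, rfl⟩
      simp only [Set.mem_ofPred_eq]
      split_ifs with ha
      · exact fun hc => h (Quotient.exact hc)
      · exact fun hc => ha (Quotient.exact hc)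
    · intro hc
      induction c using Quotient.inductionOn with
      | h a =>
        refine ⟨a, if_neg fun ha => hc (Quotient.sound ha)⟩
  have h2 := Fintype.card_subtype_compl (fun c : Quotient r => c = Quotient.mk r y)
  rw [Fintype.card_subtype_eq] at h2
  have h3 : 0 < Fintype.card (Quotient r) := Fintype.card_pos_iff.2 ⟨Quotient.mk r x⟩
  rw [this, Nat.card_eq_fintype_card (α := Quotient r), Set.coe_ofPred, Nat.card_eq_fintype_card,
    h2]
  omega

variable [DecidableEq α] {σ : Perm α} {x y : α}

theorem sameCycle_mul_swap_le {r : Setoid α} (h : SameCycle.setoid σ ≤ r) (hxy : r x y) :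
    SameCycle.setoid (σ * swap x y) ≤ r := by
  have hs : ∀ a, r a (σ a) := fun a => h ⟨1, by simp⟩
  have key : ∀ a, Quotient.mk r ((σ * swap x y) a) = Quotient.mk r a := by
    intro a
    apply Quotient.sound
    rw [Perm.mul_apply]
    by_cases h1 : a = x
    · rw [h1, swap_apply_left]; exact r.trans (r.symm (hs y)) (r.symm hxy)
    · by_cases h2 : a = y
      · rw [h2, swap_apply_right]; exact r.trans (r.symm (hs x)) hxy
      · rw [swap_apply_of_ne_of_ne h1 h2]; exact r.symm (hs a)
  intro a b hab
  exact Quotient.exact (sameCycle_invariant key hab)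

/-- From `x` the product jumps to `σ y` and then follows the cycle of `y`, on which the
transposition does not act before `y` itself is reached. -/
theorem sameCycle_mul_swap [Finite α] (h : ¬ SameCycle σ x y) :
    SameCycle (σ * swap x y) x y := by
  have hne : x ≠ y := fun e => h (e ▸ SameCycle.refl _ _)
  have key : ∀ k : ℕ, SameCycle (σ * swap x y) x ((σ ^ (k + 1)) y) := by
    intro k
    induction k with
    | zero => exact ⟨1, by simp⟩
    | succ k ih =>
      rw [pow_succ', Perm.mul_apply]
      set b := (σ ^ (k + 1)) y with hb
      have hbx : b ≠ x := by
        intro e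
        apply h
        rw [← e, hb]
        exact SameCycle.symm ⟨(k + 1 : ℕ), rfl⟩
      by_cases hby : b = y
      · rw [hby]; exact ⟨1, by simp⟩
      · refine ih.trans ⟨1, ?_⟩
        rw [zpow_one, Perm.mul_apply, swap_apply_of_ne_of_ne hbx hby]
  have h1 := key (orderOf σ - 1)
  have : orderOf σ - 1 + 1 = orderOf σ := Nat.sub_add_cancel (orderOf_pos σ)
  rw [this, pow_orderOf_eq_one] at h1
  exact h1

theorem setoid_mul_swap [Finite α] (h : ¬ SameCycle σ x y) :
    SameCycle.setoid (σ * swap x y) = joinPair (SameCycle.setoid σ) x y := by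
  apply le_antisymm
  · exact sameCycle_mul_swap_le (le_joinPair _ x y) (joinPair_apply _ x y)
  · have hxy := sameCycle_mul_swap h
    have hle : SameCycle.setoid σ ≤ SameCycle.setoid (σ * swap x y) := by
      have := sameCycle_mul_swap_le (σ := σ * swap x y) (x := x) (y := y) le_rfl hxy
      rwa [mul_assoc, swap_mul_self, mul_one] at this
    intro a b hab
    rw [joinPair, Setoid.ker_def] at hab
    by_cases ha : SameCycle.setoid σ a y <;> by_cases hb : SameCycle.setoid σ b y
    · exact (SameCycle.setoid _).trans (hle ha) ((SameCycle.setoid _).symm (hle hb))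
    · rw [if_pos ha, if_neg hb] at hab
      exact (SameCycle.setoid _).trans (hle ha) ((SameCycle.setoid _).trans
        ((SameCycle.setoid _).symm hxy) (hle (Quotient.exact hab)))
    · rw [if_neg ha, if_pos hb] at hab
      exact (SameCycle.setoid _).trans (hle (Quotient.exact hab)) ((SameCycle.setoid _).trans
        hxy ((SameCycle.setoid _).symm (hle hb)))
    · rw [if_neg ha, if_neg hb] at hab
      exact hle (Quotient.exact hab)

/-- Multiplication with a transposition that connects two cycles merges them. -/
theorem numCycles_mul_swap [Finite α] (h : ¬ SameCycle σ x y) :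
    numCycles (σ * swap x y) + 1 = numCycles σ := by
  rw [numCycles, setoid_mul_swap h]
  exact card_joinPair h

theorem numCycles_mul_swap_le [Finite α] : numCycles (σ * swap x y) ≤ numCycles σ + 1 := by
  by_cases h : SameCycle σ x y
  · by_cases h' : SameCycle (σ * swap x y) x y
    · have := sameCycle_mul_swap_le (σ := σ * swap x y) (x := x) (y := y) le_rfl h'
      rw [mul_assoc, swap_mul_self, mul_one] at this
      exact (card_quotient_le this).trans (Nat.le_succ _)
    · have := numCycles_mul_swap h'
      rw [mul_assoc, swap_mul_self, mul_one] at this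
      exact this.ge
  · have := numCycles_mul_swap h
    omega

omit [DecidableEq α] in
theorem numCycles_conj [Finite α] (σ τ : Perm α) : numCycles (τ * σ * τ⁻¹) = numCycles σ := by
  symm
  apply Nat.card_eq_of_bijective
    (Quotient.map τ fun a b (h : SameCycle σ a b) => by
      change SameCycle _ _ _
      rw [sameCycle_conj]; simpa using h)
  constructor
  · intro a b
    induction a, b using Quotient.inductionOn₂ with
    | h a b =>
      intro h
      have h1 : SameCycle (τ * σ * τ⁻¹) (τ a) (τ b) := Quotient.exact h
      rw [sameCycle_conj] at h1
      have h2 : SameCycle σ a b := by simpa using h1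
      exact Quotient.sound h2
  · intro c
    induction c using Quotient.inductionOn with
    | h a => exact ⟨Quotient.mk _ (τ⁻¹ a), Quotient.sound (by
        change SameCycle _ _ _; simp [SameCycle.refl])⟩

theorem numCycles_swap_mul [Finite α] : numCycles (swap x y * σ) = numCycles (σ * swap x y) := by
  rw [← numCycles_conj (σ * swap x y) (swap x y)]
  congr 1
  rw [swap_inv, mul_assoc, mul_assoc, swap_mul_self, mul_one]

omit [DecidableEq α] in
theorem setoid_one : SameCycle.setoid (1 : Perm α) = ⊥ := by
  ext a b
  exact sameCycle_one

omit [DecidableEq α] in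
theorem numCycles_one [Finite α] : numCycles (1 : Perm α) = Nat.card α := by
  rw [numCycles, setoid_one]
  exact (Nat.card_eq_of_bijective (Quotient.mk (⊥ : Setoid α))
    ⟨fun a b h => Quotient.exact h, Quotient.mk_surjective⟩).symm

/-- A point that is moved can be split off its cycle. -/
theorem exists_split [Fintype α] (hx : σ x ≠ x) :
    ∃ z σ₀, σ z = x ∧ z ≠ x ∧ σ₀ = σ * swap x z ∧ σ = σ₀ * swap x z ∧ σ₀ x = x ∧ σ₀ z = σ x ∧
      (∀ a, a ≠ x → a ≠ z → σ₀ a = σ a) ∧ σ₀.support.card < σ.support.card ∧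
      ¬ SameCycle σ₀ x z := by
  have hz : σ⁻¹ x ≠ x := by
    intro h; apply hx; have h2 := congrArg σ h; simpa using h2.symm
  have h0 : (σ * swap x (σ⁻¹ x)) x = x := by rw [Perm.mul_apply, swap_apply_left]; simp
  have h1 : ∀ a, a ≠ x → a ≠ σ⁻¹ x → (σ * swap x (σ⁻¹ x)) a = σ a := fun a h1 h2 => by
    rw [Perm.mul_apply, swap_apply_of_ne_of_ne h1 h2]
  refine ⟨σ⁻¹ x, σ * swap x (σ⁻¹ x), by simp, hz, rfl, ?_, h0, ?_, h1, ?_, ?_⟩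
  · rw [mul_assoc, swap_mul_self, mul_one]
  · rw [Perm.mul_apply, swap_apply_right]
  · apply Finset.card_lt_card
    rw [Finset.ssubset_iff_of_subset]
    · exact ⟨x, by simpa using hx, by rw [notMem_support]; exact h0⟩
    · intro a ha
      rw [mem_support] at ha ⊢
      intro hc
      have hax : a ≠ x := fun e => hx (e ▸ hc)
      by_cases haz : a = σ⁻¹ x
      · rw [haz] at hc; apply hz; simpa using hc.symm
      · exact ha ((h1 a hax haz).trans hc)
  · rintro ⟨k, hk⟩
    rw [zpow_apply_eq_self_of_apply_eq_self h0] at hk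
    exact hz hk.symm

/-- The genus of a pair of permutations is nonnegative. -/
theorem numCycles_add_le [Fintype α] (γ : Perm α) (σ : Perm α) :
    numCycles σ + numCycles (σ⁻¹ * γ) + numCycles γ ≤
      Fintype.card α + 2 * Nat.card (Quotient (SameCycle.setoid σ ⊔ SameCycle.setoid γ)) := by
  induction hk : σ.support.card using Nat.strong_induction_on generalizing σ with
  | h k ih =>
    by_cases h1 : σ = 1
    · subst h1
      rw [setoid_one, bot_sup_eq, numCycles_one, inv_one, one_mul, Nat.card_eq_fintype_card]
      simp only [numCycles]
      omega
    · obtain ⟨x, hx⟩ : ∃ x, σ x ≠ x := by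
        by_contra! hc
        exact h1 (Equiv.ext hc)
      obtain ⟨z, σ₀, -, -, -, hσ, -, -, -, hlt, hns⟩ := exists_split hx
      have ih0 := ih _ (hk ▸ hlt) σ₀ rfl
      have e1 := numCycles_mul_swap hns
      rw [← hσ] at e1
      have e2 : σ⁻¹ * γ = swap x z * (σ₀⁻¹ * γ) := by rw [hσ, mul_inv_rev, swap_inv, mul_assoc]
      set r₀ := SameCycle.setoid σ₀ ⊔ SameCycle.setoid γ with hr₀
      have hσ₀ : SameCycle.setoid σ₀ ≤ r₀ := le_sup_left
      have hγ : SameCycle.setoid γ ≤ r₀ := le_sup_right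
      rw [e2, numCycles_swap_mul]
      -- If `x` and `z` lie in one block of the join, the number of blocks does not drop, and a
      -- possible additional cycle of `σ⁻¹ * γ` is offset by the cycle that `σ` loses. Otherwise two
      -- blocks may merge, but then two cycles of `σ₀⁻¹ * γ` merge as well.
      by_cases hxz : r₀ x z
      · have e3 : SameCycle.setoid σ ⊔ SameCycle.setoid γ ≤ r₀ := by
          refine sup_le ?_ hγ
          rw [hσ]
          exact sameCycle_mul_swap_le hσ₀ hxz
        have e4 := card_quotient_le e3
        have e5 := numCycles_mul_swap_le (σ := σ₀⁻¹ * γ) (x := x) (y := z)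
        omega
      · have e3 : SameCycle.setoid σ ⊔ SameCycle.setoid γ ≤ joinPair r₀ x z := by
          refine sup_le ?_ (hγ.trans (le_joinPair _ x z))
          rw [hσ]
          exact sameCycle_mul_swap_le (hσ₀.trans (le_joinPair _ x z)) (joinPair_apply _ x z)
        have e4 := card_quotient_le e3
        have e5 := card_joinPair hxz
        have e6 : ¬ SameCycle (σ₀⁻¹ * γ) x z := by
          intro h
          apply hxz
          have key : ∀ a, Quotient.mk r₀ ((σ₀⁻¹ * γ) a) = Quotient.mk r₀ a := by
            intro a
            apply Quotient.sound
            refine r₀.trans (hσ₀ (?_ : SameCycle σ₀ _ (γ a))) (r₀.symm (hγ (⟨1, by simp⟩ :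
              SameCycle γ a (γ a))))
            exact ⟨1, by simp⟩
          exact Quotient.exact (sameCycle_invariant key h)
        have e7 := numCycles_mul_swap e6
        omega

end Merge

/-! ### Planar permutations are those of genus zero -/

section Planar

variable {N : ℕ} {ν : Perm (Fin N)}

/-- The gaps of all cycles of `ν` are invariant. -/
def IsPlanar (ν : Perm (Fin N)) : Prop := ∀ x y, x < y → y < ν x → x < ν y ∧ ν y < ν x

/-- A finite interval that is mapped into itself injectively is mapped onto itself. -/
theorem IsPlanar.inv (h : IsPlanar ν) {x y : Fin N} (h1 : x < y) (h2 : y < ν x) :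
    x < ν⁻¹ y ∧ ν⁻¹ y < ν x := by
  have hm : Set.MapsTo ν (Set.Ioo x (ν x)) (Set.Ioo x (ν x)) := fun y hy => h x y hy.1 hy.2
  have hs : Set.SurjOn ν (Finset.Ioo x (ν x)) (Finset.Ioo x (ν x)) :=
    Finset.surjOn_of_injOn_of_card_le ν (by simpa using hm) ν.injective.injOn le_rfl
  obtain ⟨z, hz, rfl⟩ := hs (by simpa using And.intro h1 h2)
  rw [Finset.coe_Ioo] at hz
  simpa using hz

/-- On a finite set nonnegative powers exhaust a cycle, so forward invariance suffices. -/
theorem not_sameCycle_of_mapsTo {α : Type*} [Finite α] {σ : Perm α} {s : Set α}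
    (h : ∀ a ∈ s, σ a ∈ s) {x y : α} (hx : x ∈ s) (hy : y ∉ s) : ¬ SameCycle σ x y := by
  intro hxy
  obtain ⟨k, rfl⟩ := hxy.exists_nat_pow_eq
  apply hy
  clear hxy hy
  induction k with
  | zero => exact hx
  | succ k ih => rw [pow_succ', Perm.mul_apply]; exact h _ ih

theorem exists_of_sameCycle {α : Type*} [Finite α] {σ : Perm α} {s : Set α} {x y : α}
    (h : SameCycle σ x y) (hx : x ∈ s) (hy : y ∉ s) : ∃ a ∈ s, σ a ∉ s ∧ SameCycle σ x a := by
  by_contra! hc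
  refine not_sameCycle_of_mapsTo (s := {a | a ∈ s ∧ SameCycle σ x a}) ?_
    ⟨hx, SameCycle.refl _ _⟩ (fun hh => hy hh.1) h
  intro a ha
  refine ⟨?_, by simpa using ha.2⟩
  by_contra hb
  exact hc a ha.1 hb ha.2

theorem val_finRotate {x y : Fin N} (h : x < y) : (finRotate N x : ℕ) = x + 1 := by
  obtain _ | N := N
  · exact x.elim0
  · exact coe_finRotate_of_ne_last (Fin.ne_last_of_lt h)

theorem sameCycle_finRotate (x y : Fin N) : SameCycle (finRotate N) x y := by
  obtain _ | N := N
  · exact x.elim0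
  suffices h : ∀ k : ℕ, ∀ hk : k < N + 1, SameCycle (finRotate (N + 1)) 0 ⟨k, hk⟩ from
    (h x x.2).symm.trans (h y y.2)
  intro k
  induction k with
  | zero => intro _; exact SameCycle.refl _ _
  | succ k ih =>
    intro hk
    refine (ih (by omega)).trans ⟨1, ?_⟩
    rw [zpow_one]
    apply Fin.ext
    rw [val_finRotate (y := ⟨k + 1, hk⟩) (by simp [Fin.lt_def])]

theorem numCycles_finRotate (N : ℕ) : numCycles (finRotate (N + 1)) = 1 := by
  rw [numCycles, Nat.card_eq_one_iff_unique]
  refine ⟨⟨fun a b => ?_⟩, ⟨Quotient.mk _ 0⟩⟩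
  induction a, b using Quotient.inductionOn₂ with
  | h a b => exact Quotient.sound (sameCycle_finRotate a b)

/-- Induction on the support. A point x = ν z above z is split off its cycle, which preserves
planarity. Then ν gains a cycle, and `ν⁻¹ * finRotate (N + 1)` loses one, because its cycles through
z and x are different: planarity makes the interval [z, x) invariant. If no point moves up, ν is the
identity. -/
theorem IsPlanar.numCycles {ν : Perm (Fin (N + 1))} (h : IsPlanar ν) :
    numCycles ν + numCycles (ν⁻¹ * finRotate (N + 1)) = N + 2 := by
  induction hk : ν.support.card using Nat.strong_induction_on generalizing ν with
  | h k ih =>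
    by_cases h1 : ∃ z, z < ν z
    · obtain ⟨w, hw⟩ := h1
      obtain ⟨z, ν₀, hz, -, h0, hν, h0x, h0z, h0a, hlt, hns⟩ :=
        exists_split (σ := ν) (x := ν w) (fun e => hw.ne' (ν.injective e))
      obtain rfl : z = w := ν.injective hz
      generalize hx : ν z = x at *
      have hzx : z ≠ x := hw.ne
      -- `ν x` cannot lie strictly between `z` and `x`, for the gap would then contain its preimage
      -- `x`.
      have hνx : ν x < z ∨ ν x = z ∨ x < ν x := by
        rcases lt_trichotomy (ν x) z with h2 | h2 | h2
        · exact Or.inl h2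
        · exact Or.inr (Or.inl h2)
        · right; right
          rcases lt_trichotomy (ν x) x with h3 | h3 | h3
          · have := (h.inv h2 (hx.symm ▸ h3)).2
            simp [hx] at this
          · exact absurd (ν.injective (h3.trans hx.symm)) hzx.symm
          · exact h3
      have hpl : IsPlanar ν₀ := by
        intro a y h2 h3
        by_cases hax : a = x
        · rw [hax, h0x] at h3; rw [hax] at h2; omega
        by_cases haz : a = z
        · subst haz
          rw [h0z] at h3 ⊢
          by_cases hyx : y = x
          · rw [hyx, h0x]; omega
          · rw [h0a y hyx h2.ne']
            rcases lt_trichotomy y x with h4 | h4 | h4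
            · have := h a y h2 (hx.symm ▸ h4)
              omega
            · exact absurd h4 hyx
            · have := h x y h4 h3
              omega
        · rw [h0a a hax haz] at h3 ⊢
          by_cases hyx : y = x
          · rw [hyx, h0x]; omega
          by_cases hyz : y = z
          · rw [hyz, h0z, ← hx]
            subst hyz
            have h4 := h a y h2 h3
            exact h a (ν y) h4.1 h4.2
          · rw [h0a y hyx hyz]
            exact h a y h2 h3
      have ih0 := ih _ (hk ▸ hlt) hpl rfl
      have e1 := numCycles_mul_swap hns
      rw [← hν] at e1
      have e2 : ν₀⁻¹ * finRotate (N + 1) = swap x z * (ν⁻¹ * finRotate (N + 1)) := by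
        rw [h0, mul_inv_rev, swap_inv, mul_assoc]
      have e3 : ¬ SameCycle (ν⁻¹ * finRotate (N + 1)) z x := by
        apply not_sameCycle_of_mapsTo (s := Set.Ico z x) _ ⟨le_rfl, hw⟩ (by simp)
        intro a ha
        have h4 := val_finRotate ha.2
        rw [Perm.mul_apply]
        generalize finRotate (N + 1) a = b at h4
        by_cases hb : b = x
        · have : ν⁻¹ b = z := by rw [hb, ← hx]; simp
          rw [this]; exact ⟨le_rfl, hw⟩
        · have h5 := ha.1
          have h6 := ha.2
          have := h.inv (x := z) (y := b) (by omega) (by rw [hx]; omega)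
          rw [hx] at this
          exact ⟨this.1.le, this.2⟩
      have e4 := numCycles_mul_swap (fun hh => e3 (SameCycle.symm hh))
      rw [e2, numCycles_swap_mul] at ih0
      omega
    · have : ν = 1 := by
        have h2 : ∀ k : ℕ, ∀ hk : k < N + 1, ν ⟨k, hk⟩ = ⟨k, hk⟩ := by
          intro k
          induction k using Nat.strong_induction_on with
          | h k ih2 =>
            intro hk
            by_contra hne
            have h3 : ν ⟨k, hk⟩ < ⟨k, hk⟩ := lt_of_le_of_ne (not_lt.1 fun h4 => h1 ⟨_, h4⟩) hne
            have h4 := ih2 (ν ⟨k, hk⟩) h3 (ν ⟨k, hk⟩).2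
            exact hne (ν.injective h4)
        exact Equiv.ext fun x => h2 x x.2
      subst this
      rw [inv_one, one_mul, numCycles_one, numCycles_finRotate, Nat.card_eq_fintype_card,
        Fintype.card_fin]

theorem le_of_card_quotient_le {α : Type*} [Finite α] {r s : Setoid α} (h : r ≤ s)
    (hc : Nat.card (Quotient r) ≤ Nat.card (Quotient s)) : s ≤ r := by
  intro a b hab
  have hs : Function.Surjective (Quotient.map' (s₁ := r) (s₂ := s) id fun _ _ hxy => h hxy) := by
    intro c
    induction c using Quotient.inductionOn with
    | h a => exact ⟨Quotient.mk _ a, rfl⟩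
  have hb := (Nat.bijective_iff_surjective_and_card _).2
    ⟨hs, le_antisymm hc (card_quotient_le h)⟩
  exact Quotient.exact (hb.1 (a₁ := Quotient.mk r a) (a₂ := Quotient.mk r b) (Quotient.sound hab))

/-- Cut the rotation γ into two cycles, one of which is the interval from x+1 to ν x - 1. The cut
also gives `ν⁻¹ * γ` one more cycle, namely the fixed point x. The genus inequality for ν and the
cut rotation then forces the join to have two blocks, so ν preserves the interval. -/
theorem isPlanar_of_numCycles {ν : Perm (Fin (N + 1))}
    (h : numCycles ν + numCycles (ν⁻¹ * finRotate (N + 1)) = N + 2) : IsPlanar ν := by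
  intro x y hxy hy
  set γ := finRotate (N + 1) with hγ
  obtain ⟨w, hw⟩ : ∃ w, γ w = ν x := ⟨γ⁻¹ (ν x), by simp⟩
  -- There is no wraparound: `ν x` exceeds `y` and so is not the first point.
  have hwv : (w : ℕ) + 1 = ν x := by
    by_cases h1 : w = Fin.last N
    · exfalso
      rw [h1, hγ, finRotate_last] at hw
      rw [← hw] at hy
      simp at hy
    · rw [← coe_finRotate_of_ne_last h1, ← hw]
  have hxw : x < w := by omega
  set γ₂ := γ * swap x w with hγ₂
  have hx2 : γ₂ x = ν x := by rw [hγ₂, Perm.mul_apply, swap_apply_left, hw]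
  have hs : ∀ a ∈ Set.Ioc x w, γ₂ a ∈ Set.Ioc x w := by
    intro a ha
    have h1 := ha.1
    have h2 := ha.2
    rw [hγ₂, Perm.mul_apply]
    by_cases haw : a = w
    · rw [haw, swap_apply_right]
      have := val_finRotate hxw
      exact ⟨Fin.lt_def.2 (by rw [hγ, this]; omega), Fin.le_def.2 (by rw [hγ, this]; omega)⟩
    · rw [swap_apply_of_ne_of_ne h1.ne' haw]
      have := val_finRotate (lt_of_le_of_ne h2 haw)
      have h3 := lt_of_le_of_ne h2 haw
      exact ⟨Fin.lt_def.2 (by rw [hγ, this]; omega), Fin.le_def.2 (by rw [hγ, this]; omega)⟩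
  have e1 : ¬ SameCycle γ₂ x w := fun hh =>
    not_sameCycle_of_mapsTo hs (x := w) ⟨hxw, le_rfl⟩ (y := x) (by simp) hh.symm
  have e2 := numCycles_mul_swap e1
  rw [hγ₂, mul_assoc, swap_mul_self, mul_one, hγ, numCycles_finRotate, ← hγ, ← hγ₂] at e2
  have e3 : (ν⁻¹ * γ₂) x = x := by rw [Perm.mul_apply, hx2]; simp
  have e4 : ¬ SameCycle (ν⁻¹ * γ₂) x w := by
    rintro ⟨k, hk⟩
    rw [zpow_apply_eq_self_of_apply_eq_self e3] at hk
    exact hxw.ne hk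
  have e5 := numCycles_mul_swap e4
  have e6 : ν⁻¹ * γ₂ * swap x w = ν⁻¹ * γ := by
    rw [hγ₂, ← mul_assoc, mul_assoc _ (swap x w), swap_mul_self, mul_one]
  rw [e6] at e5
  have e7 := numCycles_add_le γ₂ ν
  rw [Fintype.card_fin] at e7
  have e8 : SameCycle.setoid ν ⊔ SameCycle.setoid γ₂ ≤ SameCycle.setoid γ₂ := by
    apply le_of_card_quotient_le le_sup_right
    change numCycles γ₂ ≤ _
    omega
  have e9 : SameCycle γ₂ y (ν y) := e8 (le_sup_left (a := SameCycle.setoid ν) (⟨1, by simp⟩ :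
    SameCycle ν y (ν y)))
  have e10 : ν y ∈ Set.Ioc x w := by
    by_contra hc
    exact not_sameCycle_of_mapsTo hs (x := y) ⟨hxy, by omega⟩ hc e9
  exact ⟨e10.1, by have := e10.2; omega⟩

end Planar

/-! ### Non-crossing partitions as planar permutations -/

section Blocks

variable {N : ℕ} {ν ν' : Perm (Fin N)}

theorem blockPerm_apply {π : Part N} {V : Finset (Fin N)} (hV : V ∈ π.parts) {x : Fin N}
    (hx : x ∈ V) : blockPerm π x = (V.sort (· ≤ ·)).formPerm x := by
  rw [blockPerm, ← Finset.mul_noncommProd_erase _ hV, Perm.mul_apply]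
  congr 1
  refine Finset.noncommProd_induction _ _ _ (fun σ : Perm (Fin N) => σ x = x) ?_ rfl ?_
  · intro σ τ h1 h2
    rw [Perm.mul_apply, h2, h1]
  · intro W hW
    rw [Finset.mem_erase] at hW
    apply List.formPerm_apply_of_notMem
    rw [Finset.mem_sort]
    exact fun h => hW.1 (π.eq_of_mem_parts hW.2 hV h hx)

theorem isCycleWord_sort {π : Part N} {V : Finset (Fin N)} (hV : V ∈ π.parts) :
    IsCycleWord (blockPerm π) (V.sort (· ≤ ·)) := by
  refine ⟨?_, V.sort_nodup _, ?_⟩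
  · intro h
    have := congrArg List.length h
    rw [Finset.length_sort] at this
    exact (π.nonempty_of_mem_parts hV).card_ne_zero this
  · apply List.ext_getElem (by simp)
    intro i h1 h2
    rw [List.getElem_rotate, List.getElem_map, blockPerm_apply hV, List.formPerm_apply_getElem _
      (V.sort_nodup _)]
    exact (Finset.mem_sort _).1 (List.getElem_mem _)

theorem IsCycleWord.mem_iff_sameCycle {X : Type*} [Fintype X] [DecidableEq X] {σ : Perm X} {l : List X}
    (h : IsCycleWord σ l) {x : X} (hx : x ∈ l) {y : X} : y ∈ l ↔ SameCycle σ x y := by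
  obtain _ | ⟨z, w⟩ := l
  · simp at hx
  · rw [h.mem_iff] at hx ⊢
    exact ⟨fun h => hx.symm.trans h, fun h => hx.trans h⟩

theorem sameCycle_blockPerm {π : Part N} {x y : Fin N} :
    SameCycle (blockPerm π) x y ↔ π.part x = π.part y := by
  have hV := π.part_mem.2 (Finset.mem_univ x)
  rw [← (isCycleWord_sort hV).mem_iff_sameCycle (x := x) (by simp), Finset.mem_sort,
    π.mem_part_iff_part_eq_part (Finset.mem_univ _) (Finset.mem_univ _)]
  exact eq_comm

theorem blockPerm_injective : Function.Injective (blockPerm (n := N)) := by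
  intro π π' h
  have h1 : ∀ x, π.part x = π'.part x := by
    intro x
    ext y
    rw [π.mem_part_iff_part_eq_part (Finset.mem_univ _) (Finset.mem_univ _),
      π'.mem_part_iff_part_eq_part (Finset.mem_univ _) (Finset.mem_univ _),
      ← sameCycle_blockPerm, ← sameCycle_blockPerm, h]
  ext V
  constructor
  · intro hV
    obtain ⟨x, hx⟩ := π.nonempty_of_mem_parts hV
    rw [← π.part_eq_of_mem hV hx, h1]
    exact π'.part_mem.2 (Finset.mem_univ x)
  · intro hV
    obtain ⟨x, hx⟩ := π'.nonempty_of_mem_parts hV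
    rw [← π'.part_eq_of_mem hV hx, ← h1]
    exact π.part_mem.2 (Finset.mem_univ x)

/-- In the sorted block the image of an element is the next one, so no element of the block lies
between; only the largest element wraps around, and it moves down. -/
theorem blockPerm_gap {π : Part N} {x y : Fin N} (h1 : x < y) (h2 : y < blockPerm π x) :
    π.part x ≠ π.part y := by
  intro h
  have hV := π.part_mem.2 (Finset.mem_univ x)
  have hx : x ∈ (π.part x).sort (· ≤ ·) := by simp
  have hy : y ∈ (π.part x).sort (· ≤ ·) := by simp [h]
  generalize π.part x = V at hx hy hV
  obtain ⟨i, hi, rfl⟩ := List.getElem_of_mem hx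
  obtain ⟨j, hj, rfl⟩ := List.getElem_of_mem hy
  rw [blockPerm_apply hV ((Finset.mem_sort _).1 hx),
    List.formPerm_apply_getElem _ (V.sort_nodup _)] at h2
  have hm : StrictMono (V.sort (· ≤ ·)).get := (Finset.sortedLT_sort V).strictMono_get
  have h3 : i < j := hm.lt_iff_lt (a := ⟨i, hi⟩) (b := ⟨j, hj⟩) |>.1 h1
  have hlen : 0 < (V.sort (· ≤ ·)).length := by omega
  have h4 : j < (i + 1) % (V.sort (· ≤ ·)).length :=
    hm.lt_iff_lt (a := ⟨j, hj⟩) (b := ⟨_, Nat.mod_lt _ hlen⟩) |>.1 h2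
  have := Nat.mod_le (i + 1) (V.sort (· ≤ ·)).length
  omega

/-- If y lies in the gap of x but its image does not, then the arc from y to its image crosses the
arc of x or shares an endpoint with it; either would put y into the block of x. -/
theorem isPlanar_blockPerm {π : Part N} (hπ : π ∈ NC N) : IsPlanar (blockPerm π) := by
  have hπ : IsNonCrossing π := by simpa [NC] using hπ
  intro x y h1 h2
  have e1 : π.part x = π.part (blockPerm π x) := sameCycle_blockPerm.1 ⟨1, by simp⟩
  have e2 : π.part y = π.part (blockPerm π y) := sameCycle_blockPerm.1 ⟨1, by simp⟩
  have h3 := blockPerm_gap h1 h2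
  constructor
  · by_contra! h4
    rcases h4.eq_or_lt with h5 | h5
    · exact h3 (by rw [e2, h5])
    · exact h3 ((hπ _ x y _ h5 h1 h2 e2.symm e1).symm.trans e2.symm |>.symm ▸ rfl)
  · by_contra! h4
    rcases h4.eq_or_lt with h5 | h5
    · exact h3 (by rw [e1, e2, h5])
    · exact h3 (hπ x y _ _ h1 h2 h5 e1 e2)

theorem IsPlanar.not_sameCycle (h : IsPlanar ν) {x y : Fin N} (h1 : x < y) (h2 : y < ν x) :
    ¬ SameCycle ν y x :=
  not_sameCycle_of_mapsTo (s := Set.Ioo x (ν x)) (fun a ha => h x a ha.1 ha.2) ⟨h1, h2⟩ (by simp)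

/-- A point that does not move up is the largest of its cycle. Otherwise the cycle would jump over
it, from some `a` below to `ν a` above, and the invariant gap of `a` would contain `x` but not `a`.
-/
theorem IsPlanar.le_of_sameCycle (h : IsPlanar ν) {x y : Fin N} (h1 : ν x ≤ x)
    (h2 : SameCycle ν x y) : y ≤ x := by
  by_contra! hc
  obtain ⟨a, h3, h4, h5⟩ := exists_of_sameCycle (s := Set.Iic x) h2 (le_refl x)
    (fun hh => absurd (hc.trans_le hh) (lt_irrefl _))
  have h6 : x < ν a := not_le.1 h4
  have h7 : a ≠ x := fun e => absurd (h6.trans_le (e ▸ h1)) (lt_irrefl _)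
  exact h.not_sameCycle (lt_of_le_of_ne h3 h7) h6 h5

/-- A planar permutation is determined by its cycles as sets. -/
theorem IsPlanar.eq_of_sameCycle (h : IsPlanar ν) (h' : IsPlanar ν')
    (hs : ∀ x y, SameCycle ν x y ↔ SameCycle ν' x y) : ν = ν' := by
  have hself : ∀ (μ : Perm (Fin N)) x, SameCycle μ x (μ x) := fun μ x => ⟨1, by simp⟩
  have key : ∀ x, x < ν x → ν' x = ν x := by
    intro x hx
    have hx' : x < ν' x := by
      by_contra! hc
      exact absurd (h'.le_of_sameCycle hc ((hs _ _).1 (hself ν x))) (not_le.2 hx)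
    rcases lt_trichotomy (ν x) (ν' x) with h1 | h1 | h1
    · exact absurd ((hs _ _).1 (hself ν x).symm) (h'.not_sameCycle hx h1)
    · exact h1.symm
    · exact absurd ((hs _ _).2 (hself ν' x).symm) (h.not_sameCycle hx' h1)
  ext1 x
  by_cases hx : x < ν x
  · exact (key x hx).symm
  -- Here `x` is the largest point of its cycle. The `ν`-preimage `z` of `ν' x` either moves up, and
  -- then `key` identifies it with `x`, or it is the largest point of the same cycle.
  · obtain ⟨z, hz⟩ := ν.surjective (ν' x)
    by_cases h1 : z < ν z
    · have := (key z h1).trans hz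
      rw [← ν'.injective this]
      exact (key z h1).symm
    · have h2 : SameCycle ν x z := by
        have := (hs _ _).2 (hself ν' x)
        rw [← hz] at this
        exact this.trans (hself ν z).symm
      have h3 := h.le_of_sameCycle (not_lt.1 hx) h2
      have h4 := h.le_of_sameCycle (not_lt.1 h1) h2.symm
      rw [← hz, le_antisymm h3 h4]

/-- Take the cycles as blocks. In a crossing i < j < k < l, the cycle of i jumps over j along some
arc from x to ν x. The gap of x is invariant, so with j it contains l and hence also k, although k
lies on the cycle of x. -/
theorem IsPlanar.exists_blockPerm (h : IsPlanar ν) : ∃ π ∈ NC N, blockPerm π = ν := by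
  classical
  let π : Part N := Finpartition.ofSetoid (SameCycle.setoid ν)
  have hp : ∀ x y, π.part x = π.part y ↔ SameCycle ν x y := by
    intro x y
    rw [← π.mem_part_iff_part_eq_part (Finset.mem_univ _) (Finset.mem_univ _),
      Finpartition.mem_part_ofSetoid_iff_rel]
    exact sameCycle_comm
  have hπ : π ∈ NC N := by
    simp only [NC, Finset.mem_filter, Finset.mem_univ, true_and]
    intro i j k l hij hjk hkl hik hjl
    rw [hp] at hik hjl ⊢
    by_contra hij'
    obtain ⟨x, h1, h2, h3⟩ := exists_of_sameCycle (s := Set.Iio j) hik hij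
      (fun hh => absurd (hjk.trans hh) (lt_irrefl _))
    have h4 : j < ν x := by
      refine lt_of_le_of_ne (not_lt.1 h2) ?_
      rintro rfl
      exact hij' (by simpa using h3)
    have h5 : l ∈ Set.Ioo x (ν x) := by
      by_contra hc
      exact not_sameCycle_of_mapsTo (s := Set.Ioo x (ν x)) (fun a ha => h x a ha.1 ha.2) ⟨h1, h4⟩
        hc hjl
    exact h.not_sameCycle (y := k) (lt_trans h1 hjk) (lt_trans hkl h5.2) (hik.symm.trans h3)
  refine ⟨π, hπ, (isPlanar_blockPerm hπ).eq_of_sameCycle h fun x y => ?_⟩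
  rw [sameCycle_blockPerm, hp]

end Blocks

/-! ### Loop counts identify the spheres and the projective planes -/

section PairOf

variable {n : ℕ}

/-- The pairing that connects `-i` to `ν i`. -/
def pairOf (ν : Perm (Fin n)) : Perm (Pm n) :=
  Perm.sumCongr ν ν⁻¹ * delta n

theorem pairOf_inl (ν : Perm (Fin n)) (x : Fin n) : pairOf ν (.inl x) = .inr (ν⁻¹ x) := rfl

theorem pairOf_inr (ν : Perm (Fin n)) (x : Fin n) : pairOf ν (.inr x) = .inl (ν x) := rfl

theorem pairOf_one : pairOf (1 : Perm (Fin n)) = delta n := by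
  ext x; rcases x with x | x <;> rfl

theorem pairOf_finRotate : pairOf (finRotate n) = gap n := by
  ext x; rcases x with x | x <;> rfl

theorem isPairing_pairOf (ν : Perm (Fin n)) : IsPairing (pairOf ν) := by
  constructor
  · ext x; rcases x with x | x <;> simp [pairOf_inl, pairOf_inr]
  · rintro (x | x) <;> simp [pairOf_inl, pairOf_inr]

theorem pairOf_injective : Function.Injective (pairOf (n := n)) := by
  intro ν μ h
  ext1 x
  have := congrArg (fun f => f (Sum.inr x)) h
  simpa [pairOf_inr] using this

theorem IsOrientable.exists_pairOf {P : Perm (Pm n)} (hP : IsPairing P) (h : IsOrientable P) :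
    ∃ ν, P = pairOf ν := by
  have h1 : ∀ x : Fin n, ∃ y, P (.inr x) = .inl y := by
    intro x
    have := h (.inr x)
    cases hx : P (.inr x) <;> simp_all
  choose f hf using h1
  have hinj : Function.Injective f := by
    intro x y hxy
    have := (hf x).trans ((congrArg _ hxy).trans (hf y).symm)
    simpa using this
  refine ⟨Equiv.ofBijective f (Finite.injective_iff_bijective.1 hinj), ?_⟩
  set ν := Equiv.ofBijective f (Finite.injective_iff_bijective.1 hinj)
  have h2 : ∀ x, P (.inr x) = .inl (ν x) := hf
  ext1 x
  rcases x with x | x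
  · rw [hP.apply_eq_iff, pairOf_inl, h2]; simp
  · exact h2 x

theorem pairOf_mul_apply (ν μ : Perm (Fin n)) :
    pairOf ν * pairOf μ = Perm.sumCongr (ν * μ⁻¹) (ν⁻¹ * μ) := by
  ext x; rcases x with x | x <;> rfl

theorem sumCongr_zpow {α β : Type*} (σ : Perm α) (τ : Perm β) (k : ℤ) :
    (Perm.sumCongr σ τ) ^ k = Perm.sumCongr (σ ^ k) (τ ^ k) :=
  (map_zpow (Perm.sumCongrHom α β) (σ, τ) k).symm

theorem sameCycle_sumCongr_inl {α β : Type*} {σ : Perm α} {τ : Perm β} {x y : α} :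
    SameCycle (Perm.sumCongr σ τ) (.inl x) (.inl y) ↔ SameCycle σ x y := by
  simp [SameCycle, sumCongr_zpow]

theorem sameCycle_sumCongr_inr {α β : Type*} {σ : Perm α} {τ : Perm β} {x y : β} :
    SameCycle (Perm.sumCongr σ τ) (.inr x) (.inr y) ↔ SameCycle τ x y := by
  simp [SameCycle, sumCongr_zpow]

/-- For such a pairing every loop has one of its two cycles among the positive points and the other
among the negative ones, so counting loops is counting cycles of a permutation of [n]. -/
theorem loops_pairOf {ν μ : Perm (Fin n)} {x y : Fin n} :
    loops (pairOf ν) (pairOf μ) (.inl x) (.inl y) ↔ SameCycle (ν * μ⁻¹) x y := by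
  rw [loops_iff (isPairing_pairOf ν) (isPairing_pairOf μ), pairOf_mul_apply, sameCycle_sumCongr_inl,
    or_iff_left]
  rw [pairOf_inl]
  simp [SameCycle, sumCongr_zpow]

theorem numLoops_pairOf (ν μ : Perm (Fin n)) :
    numLoops (pairOf ν) (pairOf μ) = numCycles (ν * μ⁻¹) := by
  symm
  apply Nat.card_eq_of_bijective
    (Quotient.map Sum.inl fun a b (h : SameCycle (ν * μ⁻¹) a b) => loops_pairOf.2 h)
  constructor
  · intro a b
    induction a, b using Quotient.inductionOn₂ with
    | h a b =>
      intro h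
      have h2 : SameCycle (ν * μ⁻¹) a b := loops_pairOf.1 (Quotient.exact h)
      exact Quotient.sound h2
  · intro c
    induction c using Quotient.inductionOn with
    | h a =>
      rcases a with a | a
      · exact ⟨Quotient.mk _ a, rfl⟩
      · exact ⟨Quotient.mk _ (ν a), Quotient.sound (Setoid.symm' _ (loops_left (pairOf ν) (pairOf μ) (Sum.inr a)))⟩

theorem numCycles_inv {α : Type*} (σ : Perm α) : numCycles σ⁻¹ = numCycles σ := by
  have : SameCycle.setoid σ⁻¹ = SameCycle.setoid σ := by
    ext a b
    exact sameCycle_inv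
  rw [numCycles, this, numCycles]

theorem totalLoops_pairOf (ν : Perm (Fin n)) :
    totalLoops (pairOf ν) = numCycles ν + numCycles (ν⁻¹ * finRotate n) := by
  have h1 := numLoops_pairOf ν 1
  rw [pairOf_one, inv_one, mul_one] at h1
  have h2 := numLoops_pairOf ν (finRotate n)
  rw [pairOf_finRotate, ← numCycles_inv, ← numCycles_conj _ ν⁻¹] at h2
  rw [totalLoops, h1, h2]
  congr 2
  group

/-- The pairings with the maximal number of loops are the non-crossing partitions. -/
theorem totalLoops_eq_iff {P : Perm (Pm (n + 1))} (hP : IsPairing P) :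
    totalLoops P = n + 2 ↔ ∃ π ∈ NC (n + 1), P = pairOf (blockPerm π) := by
  constructor
  · intro h
    obtain ⟨ν, rfl⟩ := ((totalLoops_spec n hP).2.1 h).exists_pairOf hP
    rw [totalLoops_pairOf] at h
    obtain ⟨π, hπ, rfl⟩ := (isPlanar_of_numCycles h).exists_blockPerm
    exact ⟨π, hπ, rfl⟩
  · rintro ⟨π, hπ, rfl⟩
    rw [totalLoops_pairOf]
    exact (isPlanar_blockPerm hπ).numCycles

/-- The pairings with one loop less than the maximal number are the symmetric annular
non-crossing permutations. -/
theorem mem_SNC_iff {σ : Perm (Pm (n + 1))} :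
    σ ∈ SNC (n + 1) ↔ IsPairing (σ * delta (n + 1)) ∧ totalLoops (σ * delta (n + 1)) = n + 1 := by
  simp only [SNC, Finset.mem_filter, Finset.mem_univ, true_and, IsSymmAnnularNC]
  have hδ := isPairing_delta (n + 1)
  have hg := isPairing_gap (n + 1)
  by_cases hP : IsPairing (σ * delta (n + 1))
  swap
  · simp [hP]
  set P := σ * delta (n + 1) with hPσ
  have e1 : σ = P * delta (n + 1) := by rw [hPσ, mul_assoc, hδ.1, mul_one]
  have e2 : numCycles σ = 2 * numLoops P (delta (n + 1)) := by rw [e1, numCycles_mul hP hδ]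
  -- `σ⁻¹ * annulus` equals δ P gap δ, a conjugate of `P * gap`.
  have e3 : numCycles (σ⁻¹ * annulus (n + 1)) = 2 * numLoops P (gap (n + 1)) := by
    rw [← numCycles_mul hP hg, e1, annulus_eq, mul_inv_rev, hP.inv_eq, hδ.inv_eq,
      ← numCycles_conj (P * gap (n + 1)) (delta (n + 1)), hδ.inv_eq]
    simp only [mul_assoc]
  have e4 : numCycles σ + numCycles (σ⁻¹ * annulus (n + 1)) = 2 * (n + 1) ↔
      totalLoops P = n + 1 := by
    rw [e2, e3, totalLoops]; omega
  rw [e4]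
  constructor
  · exact fun h => ⟨h.2.2, h.2.1⟩
  · refine fun h => ⟨?_, h.2, h.1⟩
    have h1 := (totalLoops_spec n hP).2.2
    -- The join condition is automatic. This loop count excludes orientable pairings, so some cycle
    -- of σ contains points of both signs, and `annulus` is transitive on each sign.
    have h2 : ¬ IsOrientable P := fun ho => h1 ho h.2
    have hα : annulus (n + 1) = Perm.sumCongr (finRotate _) (finRotate _)⁻¹ := by
      ext x; rcases x with x | x <;> rfl
    set r := SameCycle.setoid σ ⊔ SameCycle.setoid (annulus (n + 1)) with hr
    have hl : ∀ x y : Fin (n + 1), r (.inl x) (.inl y) := fun x y => by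
      refine le_sup_right (a := SameCycle.setoid σ) (?_ : SameCycle (annulus (n + 1)) _ _)
      rw [hα, sameCycle_sumCongr_inl]
      exact sameCycle_finRotate x y
    have hrr : ∀ x y : Fin (n + 1), r (.inr x) (.inr y) := fun x y => by
      refine le_sup_right (a := SameCycle.setoid σ) (?_ : SameCycle (annulus (n + 1)) _ _)
      rw [hα, sameCycle_sumCongr_inr, sameCycle_inv]
      exact sameCycle_finRotate x y
    have hlr : ∃ x y : Fin (n + 1), r (.inl x) (.inr y) := by
      have h3 : ∃ x, ¬ (P x).isLeft = !x.isLeft := not_forall.1 h2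
      obtain ⟨x, hx⟩ := h3
      have h4 : r (delta (n + 1) x) (P x) := by
        refine le_sup_left (b := SameCycle.setoid (annulus (n + 1))) (?_ : SameCycle σ _ _)
        refine ⟨1, ?_⟩
        rw [zpow_one, hPσ, Perm.mul_apply]
      rcases x with x | x
      · cases hy : P (.inl x) with
        | inl y => rw [hy] at h4; exact ⟨y, x, r.symm h4⟩
        | inr y => rw [hy] at hx; simp at hx
      · cases hy : P (.inr x) with
        | inr y => rw [hy] at h4; exact ⟨x, y, h4⟩
        | inl y => rw [hy] at hx; simp at hx
    obtain ⟨x₀, y₀, h0⟩ := hlr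
    have hlr : ∀ x y : Fin (n + 1), r (.inl x) (.inr y) := fun x y =>
      r.trans (hl x x₀) (r.trans h0 (hrr y₀ y))
    ext x y
    simp only [Setoid.top_def, Pi.top_apply, Prop.top_eq_true, iff_true]
    rcases x with x | x <;> rcases y with y | y
    exacts [hl x y, hlr x y, r.symm (hlr y x), hrr x y]

end PairOf

/-! ### Products over loops -/

section Decomp

variable {X : Type*} {P D : Perm X}

/-- In the applications `c` is 1 or a power of ε. Some symmetries of the cumulants are available
only after multiplication by ε, and one common factor suffices to exchange all factors one by one.
-/
theorem mul_prod_congr {R ι : Type*} [CommMonoid R] (s : Finset ι) {c : R} {f g : ι → R}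
    (h : ∀ i ∈ s, c * f i = c * g i) : c * ∏ i ∈ s, f i = c * ∏ i ∈ s, g i := by
  classical
  induction s using Finset.induction_on with
  | empty => simp
  | insert a s ha ih =>
    rw [Finset.prod_insert ha, Finset.prod_insert ha, ← mul_assoc, h a (by simp), mul_right_comm,
      ih fun i hi => h i (by simp [hi]), mul_right_comm, mul_assoc]

theorem LoopDecomp.mul_prod_congr [Finite X] {R : Type*} [CommMonoid R] (hP : IsPairing P)
    (hD : IsPairing D) {L L' : List (List X)} (h : LoopDecomp P D L) (h' : LoopDecomp P D L')
    {c : R} {f f' : List X → R}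
    (H : ∀ l ∈ L, ∀ l' ∈ L', ∀ x ∈ l, ∀ y ∈ l', loops P D x y → c * f l = c * f' l') :
    c * (L.map f).prod = c * (L'.map f').prod := by
  classical
  have := Fintype.ofFinite (Quotient (loops P D))
  have key : ∀ (L : List (List X)) (f : List X → R),
      (L.map f).prod = ∏ k : Fin L.length, f L[k] := by
    intro L f
    rw [← List.prod_ofFn]
    congr 1
    apply List.ext_getElem <;> simp
  let e := Equiv.ofBijective _ (h.bijective hP hD)
  let e' := Equiv.ofBijective _ (h'.bijective hP hD)
  rw [key, key, ← e.symm.prod_comp, ← e'.symm.prod_comp]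
  refine RealInf.mul_prod_congr _ fun q _ => ?_
  have h1 : e (e.symm q) = q := e.apply_symm_apply q
  have h2 : e' (e'.symm q) = q := e'.apply_symm_apply q
  exact H _ (List.getElem_mem _) _ (List.getElem_mem _) _ (List.head_mem _) _ (List.head_mem _)
    (Quotient.exact (h1.trans h2.symm))

theorem IsCycleWord.eq_rotate_or [Fintype X] [DecidableEq X] (hP : IsPairing P) (hD : IsPairing D)
    {l l' : List X}
    (h : IsCycleWord (P * D) l) (h' : IsCycleWord (P * D) l') {x y : X} (hx : x ∈ l) (hy : y ∈ l')
    (hxy : RealInf.loops P D x y) :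
    (∃ k, l' = l.rotate k) ∨ ∃ k, l' = (l.map D).reverse.rotate k := by
  rcases h'.mem_of_loops hP hD hy (Setoid.symm' _ hxy) with h1 | h1
  · exact .inl (h.eq_rotate h' hx h1)
  · exact .inr ((h.reverse_map hP hD).eq_rotate h' (z := D x) (by simpa using hx) h1)

theorem LoopDecomp.two_mul_length [Fintype X] [DecidableEq X] (hD : IsPairing D)
    {L : List (List X)} (h : LoopDecomp P D L) : 2 * L.flatten.length = Fintype.card X := by
  have h1 : (L.flatten ++ L.flatten.map D).Nodup := by
    rw [List.nodup_append]
    refine ⟨h.nodup, h.nodup.map D.injective, ?_⟩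
    rintro a ha b hb rfl
    obtain ⟨z, hz, rfl⟩ := List.mem_map.1 hb
    rw [h.cover, hD.apply_apply] at ha
    exact ha hz
  have h2 : (L.flatten ++ L.flatten.map D).toFinset = Finset.univ := by
    ext x
    simp only [List.mem_toFinset, List.mem_append, Finset.mem_univ, iff_true]
    by_cases hx : x ∈ L.flatten
    · exact .inl hx
    · right
      rw [h.cover, not_not] at hx
      exact List.mem_map.2 ⟨_, hx, hD.apply_apply x⟩
  rw [← Finset.card_univ, ← h2, List.toFinset_card_of_nodup h1]
  rw [List.length_append, List.length_map, two_mul]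

theorem LoopDecomp.map {L : List (List X)} (h : LoopDecomp P D L) (φ : Perm X)
    (hφ : φ * D = D * φ) : LoopDecomp (φ * P * φ⁻¹) D (L.map (List.map φ)) := by
  have hφ' : ∀ x, φ (D x) = D (φ x) := fun x => by
    rw [← Perm.mul_apply, hφ, Perm.mul_apply]
  have hf : (L.map (List.map φ)).flatten = L.flatten.map φ := by rw [List.map_flatten]
  refine ⟨?_, ?_, ?_⟩
  · intro l hl
    obtain ⟨l, hl', rfl⟩ := List.mem_map.1 hl
    have h1 := h.cyc l hl'
    refine ⟨by simpa using h1.1, h1.2.1.map φ.injective, ?_⟩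
    rw [← List.map_rotate, ← h1.2.2, List.map_map, List.map_map]
    apply List.map_congr_left
    intro x _
    simp [← hφ']
  · rw [hf]; exact h.nodup.map φ.injective
  · intro x
    obtain ⟨x, rfl⟩ := φ.surjective x
    rw [hf, ← hφ', List.mem_map_of_injective φ.injective, List.mem_map_of_injective φ.injective]
    exact h.cover x

theorem numLoops_conj [Finite X] (φ : Perm X) :
    numLoops (φ * P * φ⁻¹) (φ * D * φ⁻¹) = numLoops P D := by
  symm
  have key : ∀ (P D φ : Perm X) x y, loops P D x y →
      loops (φ * P * φ⁻¹) (φ * D * φ⁻¹) (φ x) (φ y) := by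
    intro P D φ
    refine fun x y h => loops_le (r := Setoid.comap φ (loops (φ * P * φ⁻¹) (φ * D * φ⁻¹)))
      (fun x => ?_) (fun x => ?_) h
    · have := loops_left (φ * P * φ⁻¹) (φ * D * φ⁻¹) (φ x)
      simpa [Setoid.comap_rel] using this
    · have := loops_right (φ * P * φ⁻¹) (φ * D * φ⁻¹) (φ x)
      simpa [Setoid.comap_rel] using this
  apply Nat.card_eq_of_bijective (Quotient.map φ fun a b h => key P D φ a b h)
  constructor
  · intro a b
    induction a, b using Quotient.inductionOn₂ with
    | h a b =>
      intro h
      have h1 := key _ _ φ⁻¹ _ _ (Quotient.exact h)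
      have e : ∀ P : Perm X, φ⁻¹ * (φ * P * φ⁻¹) * φ⁻¹⁻¹ = P := fun P => by group
      rw [e, e] at h1
      exact Quotient.sound (by simpa using h1)
  · intro c
    induction c using Quotient.inductionOn with
    | h a => exact ⟨Quotient.mk _ (φ⁻¹ a), by simp⟩

end Decomp

/-! ### The representatives in κ_{σ/2} give a loop decomposition -/

section Reps

variable {n : ℕ} {P : Perm (Pm n)}

open Classical in
/-- The representatives of the conjugate pairs of cycles of `σ`. -/
noncomputable def reps (σ : Perm (Pm n)) : Finset (Fin n) :=
  Finset.univ.filter fun i => ∀ x, σ.SameCycle (Sum.inl i) x → i ≤ Pm.abs x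

theorem mem_reps {σ : Perm (Pm n)} {i : Fin n} :
    i ∈ reps σ ↔ ∀ x, σ.SameCycle (Sum.inl i) x → i ≤ Pm.abs x := by
  simp [reps]

theorem abs_delta (x : Pm n) : Pm.abs (delta n x) = Pm.abs x := by rcases x with x | x <;> rfl

theorem eq_or_eq_delta {x y : Pm n} (h : Pm.abs x = Pm.abs y) : x = y ∨ x = delta n y := by
  rcases x with x | x <;> rcases y with y | y <;> simp_all [Pm.abs, delta]

/-- The words of the representatives. -/
noncomputable def repWords (σ : Perm (Pm n)) : List (List (Pm n)) :=
  (reps σ).toList.map fun i => orbitWord σ (Sum.inl i)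

theorem mem_repWords {σ : Perm (Pm n)} {l : List (Pm n)} :
    l ∈ repWords σ ↔ ∃ i ∈ reps σ, orbitWord σ (Sum.inl i) = l := by
  simp [repWords]

theorem loopDecomp_repWords (hP : IsPairing P) :
    LoopDecomp P (delta n) (repWords (P * delta n)) := by
  have hδ := isPairing_delta n
  have hmem : ∀ x, x ∈ (repWords (P * delta n)).flatten ↔
      ∃ i ∈ reps (P * delta n), SameCycle (P * delta n) (.inl i) x := by
    intro x
    simp [List.mem_flatten, mem_repWords, mem_orbitWord]
  refine ⟨?_, ?_, ?_⟩
  · intro l hl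
    obtain ⟨i, -, rfl⟩ := mem_repWords.1 hl
    exact isCycleWord_orbitWord _ _
  · rw [List.nodup_flatten]
    constructor
    · intro l hl
      obtain ⟨i, -, rfl⟩ := mem_repWords.1 hl
      exact (isCycleWord_orbitWord _ _).2.1
    · rw [repWords, List.pairwise_map]
      refine (Finset.nodup_toList _).imp_of_mem ?_
      intro i j hi hj hij x hxi hxj
      rw [Finset.mem_toList, mem_reps] at hi hj
      rw [mem_orbitWord] at hxi hxj
      have h := hxi.trans hxj.symm
      exact hij (le_antisymm (hi _ h) (hj _ h.symm))
  · intro x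
    rw [hmem, hmem]
    constructor
    · rintro ⟨i, hi, hx⟩ ⟨j, hj, hx'⟩
      rw [mem_reps] at hi hj
      have h1 := hP.sameCycle_conj hδ hx'
      rw [hδ.apply_apply] at h1
      have h2 := hx.trans h1.symm
      have h3 := hP.sameCycle_conj hδ h2.symm
      rw [hδ.apply_apply] at h3
      obtain rfl : i = j := le_antisymm (hi _ h2) (hj _ h3)
      exact hP.not_sameCycle hδ _ h2
    · intro hx
      -- Take the point of smallest absolute value on the cycle of `x`. If it is positive, it
      -- represents this cycle; if it is negative, its opposite represents the mirror cycle.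
      obtain ⟨y, hy, hmin⟩ := Finset.exists_min_image
        (Finset.univ.filter fun y => SameCycle (P * delta n) x y) Pm.abs ⟨x, by simp [SameCycle.refl]⟩
      simp only [Finset.mem_filter, Finset.mem_univ, true_and] at hy hmin
      rcases y with j | j
      · exact ⟨j, mem_reps.2 fun z hz => hmin z (hy.trans hz), hy.symm⟩
      · refine absurd ⟨j, mem_reps.2 fun z hz => ?_, ?_⟩ hx
        · have h1 := hP.sameCycle_conj hδ hz
          rw [← abs_delta z]
          exact hmin _ (hy.trans h1)
        · exact (hP.sameCycle_conj hδ hy).symm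

end Reps

/-! ### The pairing `gap` as the one-block partition -/

section Gap

variable {n : ℕ}

theorem isCycleWord_finRange (n : ℕ) :
    IsCycleWord (gap (n + 1) * delta (n + 1)) ((List.finRange (n + 1)).map Sum.inl) := by
  refine ⟨by simp, (List.nodup_finRange _).map Sum.inl_injective, ?_⟩
  apply List.ext_getElem (by simp)
  intro k h1 h2
  rw [List.getElem_rotate]
  simp only [List.getElem_map, List.getElem_finRange, Perm.mul_apply]
  change gap (n + 1) (.inr _) = _
  rw [gap_inr, finRotate_apply]
  congr 1
  apply Fin.ext
  simp [Fin.val_add]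

theorem totalLoops_gap (n : ℕ) : totalLoops (gap (n + 1)) = n + 2 := by
  rw [← pairOf_finRotate, totalLoops_pairOf, numCycles_finRotate, inv_mul_cancel, numCycles_one,
    Nat.card_eq_fintype_card, Fintype.card_fin]
  omega

theorem repWords_gap (n : ℕ) : repWords (gap (n + 1) * delta (n + 1)) =
    [(List.finRange (n + 1)).map Sum.inl] := by
  have h := isCycleWord_finRange n
  rw [List.finRange_succ, List.map_cons] at h ⊢
  have h1 : reps (gap (n + 1) * delta (n + 1)) = {0} := by
    ext i
    rw [mem_reps, Finset.mem_singleton]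
    constructor
    · intro hi
      have h2 : SameCycle (gap (n + 1) * delta (n + 1)) (.inl 0) (.inl i) := by
        rw [← h.mem_iff, ← List.map_cons, ← List.finRange_succ]
        simp
      exact nonpos_iff_eq_zero.1 (hi _ h2.symm)
    · rintro rfl x _
      exact Fin.zero_le _
  rw [repWords, h1, Finset.toList_singleton, List.map_singleton, h.orbitWord_eq]

/-- The edge of `P` at -j stays within the loop of -j. If that loop has no other negative point, the
edge can only end at the partner of -j under `gap`. -/
theorem eq_gap_of_separated {P : Perm (Pm n)} (hP : IsPairing P)
    (h : ∀ i j, loops P (gap n) (.inr i) (.inr j) → i = j) : P = gap n := by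
  have hg := isPairing_gap n
  have h1 : ∀ j, P (.inr j) = gap n (.inr j) := by
    intro j
    have h2 := loops_left P (gap n) (.inr j)
    cases hx : P (.inr j) with
    | inr k =>
      rw [hx] at h2
      exact absurd (hx.trans (by rw [h _ _ h2])) (hP.2 _)
    | inl k =>
      rw [hx] at h2
      have h3 := Setoid.trans' _ h2 (loops_right P (gap n) (.inl k))
      rw [gap_inl] at h3
      rw [gap_inr, h _ _ h3, ← Perm.mul_apply, mul_inv_cancel, Perm.one_apply]
  ext1 x
  rcases x with x | x
  · rw [hP.apply_eq_iff, gap_inl, h1, gap_inr, ← Perm.mul_apply, mul_inv_cancel, Perm.one_apply]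
  · exact h1 x

/-- Every loop with `gap` contains a negative point, so n loops contain exactly one each. -/
theorem separated_of_numLoops {P : Perm (Pm n)} (h : numLoops P (gap n) = n) {i j : Fin n}
    (hij : loops P (gap n) (.inr i) (.inr j)) : i = j := by
  have hs : Function.Surjective fun j : Fin n => Quotient.mk (loops P (gap n)) (.inr j) := by
    intro c
    induction c using Quotient.inductionOn with
    | h x =>
      rcases x with x | x
      · exact ⟨(finRotate n)⁻¹ x, Quotient.sound (Setoid.symm' _ (loops_right P (gap n) (.inl x)))⟩
      · exact ⟨x, rfl⟩
  have hb := (Nat.bijective_iff_surjective_and_card _).2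
    ⟨hs, by rw [Nat.card_eq_fintype_card, Fintype.card_fin]; exact h.symm⟩
  exact hb.1 (Quotient.sound hij)

/-- The words of a planar pairing other than `gap` are shorter than that of `gap`. -/
theorem length_le_of_ne_gap {P : Perm (Pm (n + 1))} (hP : IsPairing P) (hne : P ≠ gap (n + 1))
    (ht : totalLoops P = n + 2) {L : List (List (Pm (n + 1)))} (hL : LoopDecomp P (delta (n + 1)) L)
    {l : List (Pm (n + 1))} (hl : l ∈ L) : l.length ≤ n := by
  have hδ := isPairing_delta (n + 1)
  by_contra! hc
  have h1 := hL.two_mul_length hδ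
  rw [Fintype.card_sum, Fintype.card_fin] at h1
  have h2 := hL.length_eq hP hδ
  obtain ⟨L₁, L₂, rfl⟩ := List.append_of_mem hl
  have h3 : ∀ L₃ : List (List (Pm (n + 1))), (∀ l' ∈ L₃, l' ≠ []) → L₃.length ≤ L₃.flatten.length := by
    intro L₃ h
    induction L₃ with
    | nil => simp
    | cons a L ih =>
      have h4 := ih fun l hl => h l (by simp [hl])
      have h5 := List.length_pos_iff.2 (h a (by simp))
      simp only [List.length_cons, List.flatten_cons, List.length_append]
      omega
  have h4 := h3 L₁ fun l' h => (hL.cyc l' (by simp [h])).1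
  have h5 := h3 L₂ fun l' h => (hL.cyc l' (by simp [h])).1
  simp only [List.flatten_append, List.flatten_cons, List.length_append, List.length_cons] at h1 h2
  -- A word with all n+1 letters leaves room for no other word. Then there is one loop with `delta`
  -- and hence n+1 loops with `gap`, which determines `P`.
  rw [totalLoops] at ht
  exact hne (eq_gap_of_separated hP fun i j => separated_of_numLoops (by omega))

end Gap

/-! ### Weights of pairings and their behaviour under relabelling -/

section Weight

variable {R : Type*} [CommRing R] {A : Type*} {n : ℕ} {ε : R} {κ : List A → R} {t : A → A}

/-- All words start at a positive point. -/
def StartsPos (L : List (List (Pm n))) : Prop := ∀ l ∈ L, ∃ z v, l = z :: v ∧ z.isLeft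

theorem startsPos_repWords (σ : Perm (Pm n)) : StartsPos (repWords σ) := by
  intro l hl
  obtain ⟨i, -, rfl⟩ := mem_repWords.1 hl
  obtain ⟨w, hw⟩ := orbitWord_eq_cons σ (.inl i)
  exact ⟨_, w, hw, rfl⟩

theorem rotate_invariant {c : R} {N : ℕ}
    (hcyc : ∀ l : List A, l.length ≤ N → c * κ (l.rotate 1) = c * κ l) (k : ℕ) {l : List A}
    (hl : l.length ≤ N) : c * κ (l.rotate k) = c * κ l := by
  induction k with
  | zero => simp
  | succ k ih => rw [← List.rotate_rotate, hcyc _ (by simpa using hl), ih]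

/-- Words of the same loop agree up to rotation and reversed transposition. Reversal cannot occur if
`P` is orientable and both words start at positive points, since the cycles of an orientable pairing
do not change sign. -/
theorem prod_words_congr {P : Perm (Pm n)} (hP : IsPairing P) {L L' : List (List (Pm n))}
    (hL : LoopDecomp P (delta n) L) (hL' : LoopDecomp P (delta n) L') {c : R} {N : ℕ}
    (hN : ∀ l ∈ L, l.length ≤ N)
    (hcyc : ∀ l : List A, l.length ≤ N → c * κ (l.rotate 1) = c * κ l)
    (hrev : (IsOrientable P ∧ StartsPos L ∧ StartsPos L') ∨
      ∀ l : List A, l.length ≤ N → c * κ (l.map t).reverse = c * κ l)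
    {s : Pm n → A} (hs : ∀ x, s (delta n x) = t (s x)) :
    c * (L.map fun l => κ (l.map s)).prod = c * (L'.map fun l => κ (l.map s)).prod := by
  have hδ := isPairing_delta n
  refine hL.mul_prod_congr hP hδ hL' fun l hl l' hl' x hx y hy hxy => ?_
  have hc := hL.cyc l hl
  have hc' := hL'.cyc l' hl'
  rcases hc.eq_rotate_or hP hδ hc' hx hy hxy with ⟨k, hk⟩ | ⟨k, hk⟩
  · rw [hk, List.map_rotate, rotate_invariant hcyc k (by simpa using hN l hl)]
  · rcases hrev with ⟨ho, h1, h2⟩ | hrev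
    · exfalso
      obtain ⟨z, v, rfl, hz⟩ := h1 l hl
      obtain ⟨z', v', rfl, hz'⟩ := h2 l' hl'
      have h3 : delta n z ∈ z' :: v' := by rw [hk]; simp
      have h4 := ho.isLeft_eq (hc'.mem_iff.1 h3)
      rcases z with z | z
      · rw [hz'] at h4; simp [delta] at h4
      · simp at hz
    · rw [hk, List.map_rotate, rotate_invariant hcyc k (by simpa using hN l hl), List.map_reverse,
        List.map_map]
      have : (s ∘ delta n : Pm n → A) = t ∘ s := funext hs
      rw [this, ← List.map_map, hrev _ (by simpa using hN l hl)]

/-- The contribution of a pairing to the expansion of a moment. -/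
noncomputable def weight (ε : R) (κ : List A → R) (P : Perm (Pm n)) (s : Pm n → A) : R :=
  ε ^ (n + 1 - totalLoops P) * ((repWords (P * delta n)).map fun l => κ (l.map s)).prod

theorem weight_gap (s : Pm (n + 1) → A) :
    weight ε κ (gap (n + 1)) s = κ (List.ofFn fun i => s (.inl i)) := by
  rw [weight, totalLoops_gap, repWords_gap, Nat.sub_self, pow_zero, one_mul, List.map_singleton,
    List.prod_singleton, List.map_map, List.ofFn_eq_map]
  rfl

theorem pow_mul_eq {d : ℕ} (hd : d ≠ 0) {a b : R} (h : ε * a = ε * b) :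
    ε ^ d * a = ε ^ d * b := by
  obtain ⟨e, rfl⟩ := Nat.exists_eq_succ_of_ne_zero hd
  rw [pow_succ, mul_assoc, h, mul_assoc]

theorem LoopDecomp.length_le {X : Type*} [Fintype X] {P D : Perm X} {L : List (List X)}
    (h : LoopDecomp P D L) {l : List X} (hl : l ∈ L) : l.length ≤ Fintype.card X :=
  (h.cyc l hl).2.1.length_le_card

/-- The functional τ' is not assumed invariant under the transpose, so reversal is allowed only
after multiplication by ε. That is enough: planar pairings are orientable and need no reversal, and
all others carry a positive power of ε. -/
theorem weight_eq_of_loopDecomp (hcyc : ∀ l : List A, κ (l.rotate 1) = κ l)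
    (hrev : ∀ l : List A, ε * κ (l.map t).reverse = ε * κ l) {P : Perm (Pm (n + 1))}
    (hP : IsPairing P) {L : List (List (Pm (n + 1)))} (hL : LoopDecomp P (delta (n + 1)) L)
    (hpos : StartsPos L) {s : Pm (n + 1) → A} (hs : ∀ x, s (delta (n + 1) x) = t (s x)) :
    weight ε κ P s = ε ^ (n + 2 - totalLoops P) * (L.map fun l => κ (l.map s)).prod := by
  refine prod_words_congr hP (loopDecomp_repWords hP) hL (t := t) (N := _)
    (fun l hl => (loopDecomp_repWords hP).length_le hl) (fun l _ => by rw [hcyc]) ?_ hs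
  have h1 := totalLoops_spec n hP
  by_cases h : totalLoops P = n + 2
  · exact .inl ⟨h1.2.1 h, startsPos_repWords _, hpos⟩
  · exact .inr fun l _ => pow_mul_eq (by omega) (hrev l)

theorem totalLoops_relabel {φ : Perm (Pm n)} (hδ : φ * delta n = delta n * φ)
    (hg : φ * gap n = gap n * φ) (P : Perm (Pm n)) : totalLoops (φ * P * φ⁻¹) = totalLoops P := by
  have h1 := numLoops_conj (P := P) (D := delta n) φ
  have h2 := numLoops_conj (P := P) (D := gap n) φ
  rw [hδ, mul_assoc (delta n), mul_inv_cancel, mul_one] at h1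
  rw [hg, mul_assoc (gap n), mul_inv_cancel, mul_one] at h2
  rw [totalLoops, h1, h2, totalLoops]

theorem isPairing_conj_inv {X : Type*} {P : Perm X} (hP : IsPairing P) (φ : Perm X) :
    IsPairing (φ * P * φ⁻¹) := by
  constructor
  · have : φ * P * φ⁻¹ * (φ * P * φ⁻¹) = φ * (P * P) * φ⁻¹ := by group
    rw [this, hP.1, mul_one, mul_inv_cancel]
  · intro x h
    apply hP.2 (φ⁻¹ x)
    apply φ.injective
    simpa using h

/-- Symmetry is needed only for words shorter than the full one: this holds for planar pairings by
`length_le_of_ne_gap`, and the other pairings have a factor ε, where the primed hypotheses apply. -/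
theorem weight_relabel {P : Perm (Pm (n + 1))} (hP : IsPairing P) (hne : P ≠ gap (n + 1))
    (hcyc : ∀ l : List A, l.length ≤ n → κ (l.rotate 1) = κ l)
    (hcyc' : ∀ l : List A, ε * κ (l.rotate 1) = ε * κ l)
    (hrev' : ∀ l : List A, ε * κ (l.map t).reverse = ε * κ l)
    {φ : Perm (Pm (n + 1))} (hδ : φ * delta (n + 1) = delta (n + 1) * φ)
    (hg : φ * gap (n + 1) = gap (n + 1) * φ)
    (hrev : (∀ x, (φ x).isLeft = x.isLeft) ∨
      ∀ l : List A, l.length ≤ n → κ (l.map t).reverse = κ l)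
    {s : Pm (n + 1) → A} (hs : ∀ x, s (delta (n + 1) x) = t (s x)) :
    weight ε κ P (s ∘ φ) = weight ε κ (φ * P * φ⁻¹) s := by
  set Q := φ * P * φ⁻¹ with hQ
  have hQP : IsPairing Q := isPairing_conj_inv hP φ
  have ht : totalLoops Q = totalLoops P := totalLoops_relabel hδ hg P
  have hL := (loopDecomp_repWords hP).map φ hδ
  rw [← hQ] at hL
  have e1 : ((repWords (P * delta (n + 1))).map fun l => κ (l.map (s ∘ φ))) =
      ((repWords (P * delta (n + 1))).map (List.map φ)).map fun l => κ (l.map s) := by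
    rw [List.map_map]
    apply List.map_congr_left
    intro l _
    simp
  rw [weight, weight, ht, e1]
  have hspec := totalLoops_spec n hQP
  by_cases h : totalLoops P = n + 2
  · refine prod_words_congr hQP hL (loopDecomp_repWords hQP) (t := t) (N := n) ?_
      (fun l hl => by rw [hcyc l hl]) ?_ hs
    · intro l hl
      obtain ⟨l, hl', rfl⟩ := List.mem_map.1 hl
      rw [List.length_map]
      exact length_le_of_ne_gap hP hne h (loopDecomp_repWords hP) hl'
    · rcases hrev with h1 | h1
      · refine .inl ⟨hspec.2.1 (ht.trans h), ?_, startsPos_repWords _⟩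
        intro l hl
        obtain ⟨l, hl', rfl⟩ := List.mem_map.1 hl
        obtain ⟨z, v, rfl, hz⟩ := startsPos_repWords _ l hl'
        exact ⟨φ z, v.map φ, rfl, (h1 z).trans hz⟩
      · exact .inr fun l hl => by rw [h1 l hl]
  · have hd : n + 1 + 1 - totalLoops P ≠ 0 := by omega
    exact prod_words_congr hQP hL (loopDecomp_repWords hQP) (t := t)
      (fun l hl => hL.length_le hl)
      (fun l _ => pow_mul_eq hd (hcyc' l)) (.inr fun l _ => pow_mul_eq hd (hrev' l)) hs

/-- The expansion of the moments in terms of pairings. -/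
def MomentFormula [Monoid A] (ε : R) (κ : List A → R) (t : A → A) (T : A → R) : Prop :=
  ∀ (n : ℕ) (s : Pm (n + 1) → A), (∀ x, s (delta (n + 1) x) = t (s x)) →
    T (List.ofFn fun i => s (.inl i)).prod = ∑ P ∈ pairings (Pm (n + 1)), weight ε κ P s

/-- Conjugation by φ permutes the pairings and fixes `gap`. If the two moments agree and so do all
the other terms, then the terms of `gap`, which are the full cumulants, agree too. -/
theorem cumulant_relabel [Monoid A] {T : A → R} (hM : MomentFormula ε κ t T)
    {φ : Perm (Pm (n + 1))} (hδ : φ * delta (n + 1) = delta (n + 1) * φ)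
    (hg : φ * gap (n + 1) = gap (n + 1) * φ)
    {s : Pm (n + 1) → A} (hs : ∀ x, s (delta (n + 1) x) = t (s x))
    (hT : T (List.ofFn fun i => s (φ (.inl i))).prod = T (List.ofFn fun i => s (.inl i)).prod)
    (hw : ∀ P, IsPairing P → P ≠ gap (n + 1) →
      weight ε κ P (s ∘ φ) = weight ε κ (φ * P * φ⁻¹) s) :
    κ (List.ofFn fun i => s (φ (.inl i))) = κ (List.ofFn fun i => s (.inl i)) := by
  have h1 := hM n (s ∘ φ) fun x => by
    rw [Function.comp_apply, ← Perm.mul_apply, hδ, Perm.mul_apply, hs]; rfl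
  have h2 := hM n s hs
  have h3 : ∑ P ∈ pairings (Pm (n + 1)), weight ε κ P s =
      ∑ P ∈ pairings (Pm (n + 1)), weight ε κ (φ * P * φ⁻¹) s := by
    symm
    refine Finset.sum_equiv (MulAut.conj φ).toEquiv (fun P => ?_) (fun P _ => rfl)
    rw [mem_pairings, mem_pairings]
    refine ⟨fun h => isPairing_conj_inv h φ, fun h => ?_⟩
    have := isPairing_conj_inv h φ⁻¹
    have e : φ⁻¹ * (φ * P * φ⁻¹) * φ⁻¹⁻¹ = P := by group
    rwa [show (MulAut.conj φ).toEquiv P = φ * P * φ⁻¹ from rfl, e] at this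
  have hgm : gap (n + 1) ∈ pairings (Pm (n + 1)) := mem_pairings.2 (isPairing_gap _)
  have h4 := h1.symm.trans (hT.trans (h2.trans h3))
  rw [← Finset.add_sum_erase _ _ hgm, ← Finset.add_sum_erase _ _ hgm,
    Finset.sum_congr rfl (fun P hP => hw P (mem_pairings.1 (Finset.mem_of_mem_erase hP))
      (Finset.ne_of_mem_erase hP))] at h4
  have h5 := add_right_cancel h4
  rw [weight_gap, hg, mul_assoc, mul_inv_cancel, mul_one, weight_gap] at h5
  exact h5

end Weight

/-! ### Cumulants inherit the symmetries of the functionals -/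

section Symmetry

variable {R : Type*} [CommRing R] {A : Type*} [Monoid A] {n : ℕ} {ε : R} {κ : List A → R}
  {t : A → A} {T : A → R}

/-- The extension of a tuple to `[±n]`. -/
def extend (t : A → A) (a : Fin n → A) : Pm n → A := Sum.elim a (t ∘ a)

omit [Monoid A] in
theorem extend_delta (ht : ∀ a, t (t a) = a) (a : Fin n → A) (x : Pm n) :
    extend t a (delta n x) = t (extend t a x) := by
  rcases x with x | x
  · rfl
  · exact (ht _).symm

theorem exists_ofFn_eq {B : Type*} {l : List B} (hl : l.length = n) :
    ∃ a : Fin n → B, l = List.ofFn a := by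
  subst hl
  exact ⟨l.get, (List.ofFn_get l).symm⟩

/-- `cumulant_relabel` for the simultaneous rotation of positive and negative points, by induction
on the length; for the moments this is the trace property. -/
theorem cumulant_rotate (hM : MomentFormula ε κ t T) (ht : ∀ a, t (t a) = a)
    (htr : ∀ a b, T (a * b) = T (b * a))
    (hcyc' : ∀ l : List A, ε * κ (l.rotate 1) = ε * κ l)
    (hrev' : ∀ l : List A, ε * κ (l.map t).reverse = ε * κ l) (l : List A) :
    κ (l.rotate 1) = κ l := by
  induction hl : l.length using Nat.strong_induction_on generalizing l with
  | h k ih =>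
    obtain _ | n := k
    · rw [List.length_eq_zero_iff.1 hl]; rfl
    obtain ⟨a, rfl⟩ := exists_ofFn_eq hl
    set φ : Perm (Pm (n + 1)) := Perm.sumCongr (finRotate _) (finRotate _) with hφ
    have hδ : φ * delta (n + 1) = delta (n + 1) * φ := by
      ext x; rcases x with x | x <;> rfl
    have hg : φ * gap (n + 1) = gap (n + 1) * φ := by
      ext1 x
      rcases x with x | x
      · change Sum.inr (finRotate _ ((finRotate _)⁻¹ x)) = Sum.inr ((finRotate _)⁻¹ (finRotate _ x))
        rw [← Perm.mul_apply, ← Perm.mul_apply, mul_inv_cancel, inv_mul_cancel]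
      · rfl
    have e1 : (List.ofFn a).rotate 1 = List.ofFn fun i => extend t a (φ (.inl i)) := by
      apply List.ext_getElem (by simp)
      intro k h1 h2
      rw [List.getElem_rotate, List.getElem_ofFn, List.getElem_ofFn]
      change a _ = a (finRotate _ _)
      rw [finRotate_apply]
      congr 1
      apply Fin.ext
      simp [Fin.val_add]
    rw [e1]
    refine cumulant_relabel hM hδ hg (extend_delta ht a) ?_ fun P hP hne => ?_
    · rw [← e1]
      change T ((List.ofFn a).rotate 1).prod = T (List.ofFn a).prod
      rw [List.ofFn_succ, List.rotate_cons_succ, List.rotate_zero, List.prod_append, htr]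
      simp
    · exact weight_relabel hP hne (fun l hl => ih l.length (by omega) l rfl) hcyc' hrev' hδ hg
        (.inl fun x => by rcases x with x | x <;> rfl) (extend_delta ht a)

theorem transpose_prod (ht : ∀ a, t (t a) = a) (hmul : ∀ a b, t (a * b) = t b * t a) (l : List A) :
    t l.prod = (l.map t).reverse.prod := by
  have h1 : t 1 = 1 := by
    have := hmul 1 (t 1)
    rw [one_mul, ht, one_mul] at this
    exact this.symm
  induction l with
  | nil => simpa using h1
  | cons a l ih => simp [hmul, ih]

/-- `cumulant_relabel` for the reflection that sends i to -(n+1-i). It is applied with ε = 0 because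
only τ is known to be invariant under the transpose. -/
theorem cumulant_reverse (hM : MomentFormula 0 κ t T) (ht : ∀ a, t (t a) = a)
    (hmul : ∀ a b, t (a * b) = t b * t a) (htt : ∀ a, T (t a) = T a)
    (hcyc : ∀ l : List A, κ (l.rotate 1) = κ l) (l : List A) :
    κ (l.map t).reverse = κ l := by
  induction hl : l.length using Nat.strong_induction_on generalizing l with
  | h k ih =>
    obtain _ | n := k
    · rw [List.length_eq_zero_iff.1 hl]; rfl
    obtain ⟨a, rfl⟩ := exists_ofFn_eq hl
    set φ : Perm (Pm (n + 1)) := delta (n + 1) * Perm.sumCongr Fin.revPerm Fin.revPerm with hφ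
    have hδ : φ * delta (n + 1) = delta (n + 1) * φ := by
      ext x; rcases x with x | x <;> rfl
    have hr : ∀ x : Fin (n + 1), finRotate (n + 1) (finRotate (n + 1) x).rev = x.rev := by
      intro x
      rw [finRotate_apply, finRotate_apply]
      rw [Fin.rev_add, sub_add_cancel]
    have hg : φ * gap (n + 1) = gap (n + 1) * φ := by
      ext1 x
      rcases x with x | x
      · change Sum.inl ((finRotate _)⁻¹ x).rev = Sum.inl (finRotate _ x.rev)
        congr 1
        have := hr ((finRotate _)⁻¹ x)
        rw [← Perm.mul_apply (finRotate (n + 1)) (finRotate (n + 1))⁻¹, mul_inv_cancel,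
          Perm.one_apply] at this
        exact this.symm
      · change Sum.inr (finRotate _ x).rev = Sum.inr ((finRotate _)⁻¹ x.rev)
        congr 1
        rw [← hr x, ← Perm.mul_apply (finRotate (n + 1))⁻¹, inv_mul_cancel, Perm.one_apply]
    have e1 : ((List.ofFn a).map t).reverse = List.ofFn fun i => extend t a (φ (.inl i)) := by
      apply List.ext_getElem (by simp)
      intro k h1 h2
      rw [List.getElem_reverse, List.getElem_map, List.getElem_ofFn, List.getElem_ofFn]
      change t (a _) = t (a (Fin.rev _))
      congr 2
      apply Fin.ext
      simp [Fin.val_rev]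
    rw [e1]
    refine cumulant_relabel hM hδ hg (extend_delta ht a) ?_ fun P hP hne => ?_
    · rw [← e1, ← transpose_prod ht hmul, htt]
      rfl
    · exact weight_relabel hP hne (fun l _ => hcyc l) (by simp) (by simp) hδ hg
        (.inr fun l hl => ih l.length (by omega) l rfl) (extend_delta ht a)

end Symmetry

/-! ### Expanding one product: all insertions into a fixed pairing -/

section Step

variable {R : Type*} [CommRing R] {A : Type*} [Monoid A] {n : ℕ} {ε : R} {κ : List A → R}
  {t : A → A} {T : A → R}

/-- The expansion of a cumulant with the product of `x` and `y` as first entry. -/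
def splitExpansion (ε : R) (κ : List A → R) (t : A → A) (x y : A) (w : List A) : R :=
  κ (x :: y :: w) +
    ((List.range (w.length + 1)).map fun k => κ (x :: w.drop k) * κ (y :: w.take k)).sum +
    ε * ((List.range (w.length + 1)).map fun k =>
      κ (x :: (((w.take k).map t).reverse ++ t y :: w.drop k))).sum

/-- The entries after the multiplication of the entries at `i` and `i + 1`. -/
def mergeEntries (i : Fin n) (s : Pm (n + 1) → A) (x : Pm n) : A :=
  if x = .inl i then s (.inl i.castSucc) * s (.inl i.succ)
  else if x = .inr i then s (.inr i.succ) * s (.inr i.castSucc)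
  else s (contractEmb i x)

theorem contractEmb_delta {i : Fin n} {z : Pm n} (h1 : z ≠ .inl i) (h2 : z ≠ .inr i) :
    contractEmb i (delta n z) = delta (n + 1) (contractEmb i z) :=
  ((isContraction_delta i).D_e z h1 h2).symm

theorem mergeEntries_delta (hmul : ∀ a b, t (a * b) = t b * t a) (i : Fin n)
    {s : Pm (n + 1) → A} (hs : ∀ x, s (delta (n + 1) x) = t (s x)) (x : Pm n) :
    mergeEntries i s (delta n x) = t (mergeEntries i s x) := by
  have h1 : ∀ j, s (.inr j) = t (s (.inl j)) := fun j => hs (.inl j)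
  have h2 : ∀ j, s (.inl j) = t (s (.inr j)) := fun j => hs (.inr j)
  by_cases hl : x = .inl i
  · subst hl
    simp only [mergeEntries, delta, sumComm_apply, Sum.swap_inl, reduceCtorEq, if_true, if_false,
      hmul, h1]
  by_cases hr : x = .inr i
  · subst hr
    simp only [mergeEntries, delta, sumComm_apply, Sum.swap_inr, reduceCtorEq, if_true, if_false,
      hmul, ← h2]
  · have h3 : delta n x ≠ .inl i := fun h => hr (((isPairing_delta n).apply_eq_iff).1 h)
    have h4 : delta n x ≠ .inr i := fun h => hl (((isPairing_delta n).apply_eq_iff).1 h)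
    rw [mergeEntries, if_neg h3, if_neg h4, mergeEntries, if_neg hl, if_neg hr,
      contractEmb_delta hl hr, hs]

theorem sum_eq_sum_map_add {X : Type*} [Fintype X] [DecidableEq X] {l l' : List X} (hl : l.Nodup)
    (hl' : l'.Nodup) (hd : l.Disjoint l') {g : X → R} (hg : ∀ x, x ∉ l → x ∉ l' → g x = 0) :
    ∑ x, g x = (l.map g).sum + (l'.map g).sum := by
  rw [← List.sum_toFinset g hl, ← List.sum_toFinset g hl', ← Finset.sum_union]
  · symm
    apply Finset.sum_subset (Finset.subset_univ _)
    intro x _ hx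
    rw [Finset.mem_union, List.mem_toFinset, List.mem_toFinset, not_or] at hx
    exact hg x hx.1 hx.2
  · rw [Finset.disjoint_left]
    intro x h1 h2
    exact hd (List.mem_toFinset.1 h1) (List.mem_toFinset.1 h2)

section

variable (hcyc : ∀ l : List A, κ (l.rotate 1) = κ l)
  (hrev : ∀ l : List A, ε * κ (l.map t).reverse = ε * κ l)
  {P' : Perm (Pm (n + 1))} (hP' : IsPairing P') {i : Fin (n + 1)}
  {w : List (Pm (n + 1))} {W : List (List (Pm (n + 1)))}
  (hW : LoopDecomp P' (delta (n + 1)) ((.inl i :: w) :: W)) (hpos : StartsPos W)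
  {s : Pm (n + 2) → A} (hs : ∀ x, s (delta (n + 2) x) = t (s x))

include hW in
theorem LoopDecomp.ne_of_mem :
    (∀ z ∈ w, z ≠ .inl i ∧ z ≠ .inr i) ∧ ∀ l ∈ W, ∀ z ∈ l, z ≠ .inl i ∧ z ≠ .inr i := by
  have h1 := hW.nodup
  have h2 := (hW.cover (.inl i)).1 (by simp)
  change Sum.inr i ∉ _ at h2
  rw [List.flatten_cons, List.cons_append, List.nodup_cons] at h1
  rw [List.flatten_cons, List.cons_append, List.mem_cons, not_or] at h2
  constructor
  · refine fun z hz => ⟨?_, ?_⟩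
    · rintro rfl; exact h1.1 (List.mem_append_left _ hz)
    · rintro rfl; exact h2.2 (List.mem_append_left _ hz)
  · refine fun l hl z hz => ⟨?_, ?_⟩
    · rintro rfl; exact h1.1 (List.mem_append_right _ (List.mem_flatten.2 ⟨l, hl, hz⟩))
    · rintro rfl; exact h2.2 (List.mem_append_right _ (List.mem_flatten.2 ⟨l, hl, hz⟩))

include hcyc hrev hP' hW hpos in
theorem weight_mergeEntries (hmul : ∀ a b, t (a * b) = t b * t a)
    (hs : ∀ x, s (delta (n + 2) x) = t (s x)) :
    weight ε κ P' (mergeEntries i s) = ε ^ (n + 2 - totalLoops P') *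
      (κ (s (.inl i.castSucc) * s (.inl i.succ) :: w.map (s ∘ contractEmb i)) *
        (W.map fun l => κ (l.map (s ∘ contractEmb i))).prod) := by
  have hne := hW.ne_of_mem
  have hm : ∀ z : Pm (n + 1), z ≠ .inl i ∧ z ≠ .inr i →
      mergeEntries i s z = (s ∘ contractEmb i) z := fun z hz => by
    rw [mergeEntries, if_neg hz.1, if_neg hz.2]; rfl
  rw [weight_eq_of_loopDecomp hcyc hrev hP' hW ?_ (mergeEntries_delta hmul i hs)]
  · rw [List.map_cons, List.prod_cons, List.map_cons, List.map_congr_left (fun z hz => hm z (hne.1 z hz)),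
      List.map_congr_left (l := W) fun l hl => by
        rw [List.map_congr_left fun z hz => hm z (hne.2 l hl z hz)]]
    simp [mergeEntries]
  · intro l hl
    rcases List.mem_cons.1 hl with rfl | hl
    · exact ⟨_, _, rfl, rfl⟩
    · exact hpos l hl

theorem StartsPos.map_contractEmb {n : ℕ} {W : List (List (Pm n))} (hpos : StartsPos W) (i : Fin n) :
    StartsPos (W.map (List.map (contractEmb i))) := by
  intro l hl
  obtain ⟨l, hl', rfl⟩ := List.mem_map.1 hl
  obtain ⟨z, v, rfl, hz⟩ := hpos l hl'
  exact ⟨_, _, rfl, by rwa [isLeft_contractEmb]⟩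

theorem StartsPos.cons {n : ℕ} {W : List (List (Pm n))} (hpos : StartsPos W) (i : Fin n)
    (w : List (Pm n)) : StartsPos ((.inl i :: w) :: W) := by
  intro l hl
  rcases List.mem_cons.1 hl with rfl | hl
  · exact ⟨_, _, rfl, rfl⟩
  · exact hpos l hl

omit [Monoid A] in
include hcyc hrev hP' hW hpos hs in
theorem weight_insertEdge :
    weight ε κ (insertEdge i P') s = ε ^ (n + 2 - totalLoops P') *
      (κ (s (.inl i.castSucc) :: s (.inl i.succ) :: w.map (s ∘ contractEmb i)) *
        (W.map fun l => κ (l.map (s ∘ contractEmb i))).prod) := by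
  rw [weight_eq_of_loopDecomp hcyc hrev (isTrivialExpansion_insertEdge hP').P_pairing
    (loopDecomp_insertEdge hP' hW) ((hpos.map_contractEmb i).cons _ _) hs,
    totalLoops_insertEdge hP', show n + 1 + 2 - (totalLoops P' + 1) = n + 2 - totalLoops P' by omega,
    List.map_cons, List.prod_cons]
  simp [Function.comp_def]

omit [Monoid A] in
include hcyc hrev hP' hW hpos hs in
theorem weight_split {k : ℕ} (hk : k < (w ++ [Sum.inl i]).length) :
    weight ε κ (insertOn i P' (w ++ [Sum.inl i])[k]) s = ε ^ (n + 2 - totalLoops P') *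
      (κ (s (.inl i.castSucc) :: (w.map (s ∘ contractEmb i)).drop k) *
        κ (s (.inl i.succ) :: (w.map (s ∘ contractEmb i)).take k) *
        (W.map fun l => κ (l.map (s ∘ contractEmb i))).prod) := by
  set y := (w ++ [Sum.inl i])[k] with hy
  have hk' : k ≤ w.length := by simp at hk; omega
  -- The position `k = w.length` is the point i itself, with nothing left after it.
  have h1 : (w.drop k ++ [Sum.inl i]).head (by simp) = y := by
    rw [List.head_eq_getElem, hy, List.getElem_append, List.getElem_append]
    by_cases h : k < w.length
    · simp [h]
    · obtain rfl : k = w.length := by omega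
      simp
  have h2 : SameCycle (P' * delta (n + 1)) (.inl i) y := by
    rw [← (hW.cyc _ (List.mem_cons_self ..)).mem_iff]
    have : y ∈ w ++ [Sum.inl i] := List.getElem_mem _
    simpa [or_comm] using this
  rw [weight_eq_of_loopDecomp hcyc hrev (isExpansion_insertOn hP' y).P_pairing
    (loopDecomp_split hP' hW (List.take_append_drop k w).symm h1)
    (((hpos.map_contractEmb i).cons _ _).cons _ _) hs,
    totalLoops_split hP' h2, show n + 1 + 2 - (totalLoops P' + 1) = n + 2 - totalLoops P' by omega]
  simp [Function.comp_def, mul_assoc]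

omit [Monoid A] in
include hcyc hrev hP' hW hpos hs in
theorem weight_twist {k : ℕ} (hk : k < (Sum.inl i :: w).length) :
    weight ε κ (insertOn i P' (delta (n + 1) (Sum.inl i :: w)[k])) s =
      ε ^ (n + 2 - totalLoops P') * (ε *
      (κ (s (.inl i.castSucc) :: ((((w.map (s ∘ contractEmb i)).take k).map t).reverse ++
        t (s (.inl i.succ)) :: (w.map (s ∘ contractEmb i)).drop k)) *
        (W.map fun l => κ (l.map (s ∘ contractEmb i))).prod)) := by
  have hδ := isPairing_delta (n + 1)
  set y := delta (n + 1) (Sum.inl i :: w)[k] with hy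
  have hy' : delta (n + 1) y = (Sum.inl i :: w)[k] := hδ.apply_apply _
  have h1 : Sum.inl i :: w = (Sum.inl i :: w).take k ++ delta (n + 1) y :: w.drop k := by
    have := List.getElem_cons_drop hk
    rw [List.drop_succ_cons] at this
    rw [hy', this, List.take_append_drop]
  have h2 : SameCycle (P' * delta (n + 1)) (.inl i) (delta (n + 1) y) := by
    rw [← (hW.cyc _ (List.mem_cons_self ..)).mem_iff, hy']
    exact List.getElem_mem _
  have h3 : (Sum.inl i :: w).take k ++ [delta (n + 1) y] = Sum.inl i :: w.take k := by
    rw [hy', List.take_concat_get', List.take_succ_cons]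
  have h4 := totalLoops_spec n hP'
  -- The bound on `totalLoops P'` makes the truncated subtraction exact; the additional power is the
  -- loop lost relative to the maximum.
  have h5 : n + 2 + 1 - totalLoops P' = (n + 2 - totalLoops P') + 1 := by omega
  have h6 : ((w.take k).map (delta (n + 1))).map (s ∘ contractEmb i) =
      ((w.take k).map (s ∘ contractEmb i)).map t := by
    rw [List.map_map, List.map_map]
    apply List.map_congr_left
    intro z hz
    have := hW.ne_of_mem.1 z (List.mem_of_mem_take hz)
    simp only [Function.comp_apply, contractEmb_delta this.1 this.2, hs]
  -- The mirror image of i is -i in [±n], which corresponds to -(i+1) in [±(n+1)]. This is how the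
  -- transposed second factor enters.
  have h7 : (s ∘ contractEmb i) (delta (n + 1) (.inl i)) = t (s (.inl i.succ)) := by
    rw [← hs]
    change s (contractEmb i (.inr i)) = s (.inr i.succ)
    rw [contractEmb_inr, castSucc_succAbove_self]
  have h8 := loopDecomp_twist hP' hW h1
  rw [h3, ← List.map_append] at h8
  rw [weight_eq_of_loopDecomp hcyc hrev (isExpansion_insertOn hP' y).P_pairing
    h8 ((hpos.map_contractEmb i).cons _ _) hs,
    totalLoops_twist hP' h2, h5, pow_succ, mul_assoc, List.map_cons, List.prod_cons]
  congr 3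
  · rw [List.map_cons, List.map_map, List.map_append, List.map_reverse, List.map_cons,
      List.map_cons, h6, h7]
    simp
  · simp [Function.comp_def]

omit [Monoid A] in
include hP' in
theorem weight_merge (hε : ε * ε = 0) {y : Pm (n + 1)} (h : ¬ loops P' (delta (n + 1)) (.inl i) y) :
    weight ε κ (insertOn i P' y) s = 0 := by
  have h1 := totalLoops_merge hP' h
  have h4 := totalLoops_spec n hP'
  obtain ⟨e, he⟩ : ∃ e, n + 1 + 1 + 1 - totalLoops (insertOn i P' y) = e + 2 :=
    ⟨n + 2 - totalLoops P', by omega⟩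
  rw [weight, he, pow_add, pow_two, hε, mul_zero, zero_mul]

omit [Monoid A] in
include hcyc hrev hP' hW hpos hs in
-- The points of [±n] fall into the cycle of i, its mirror image, and the rest. They give the
-- splits, the reversals and the merges; the last have weight zero, and together with the new edge
-- the others are the three terms of `splitExpansion`.
theorem weight_insert_sum (hε : ε * ε = 0) :
    weight ε κ (insertEdge i P') s + ∑ y, weight ε κ (insertOn i P' y) s =
      ε ^ (n + 2 - totalLoops P') *
      (splitExpansion ε κ t (s (.inl i.castSucc)) (s (.inl i.succ)) (w.map (s ∘ contractEmb i)) *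
        (W.map fun l => κ (l.map (s ∘ contractEmb i))).prod) := by
  have hδ := isPairing_delta (n + 1)
  have hc := hW.cyc _ (List.mem_cons_self ..)
  -- The cycle is listed from the successor of i onward, so that inserting at position k cuts off
  -- the first k letters of `w`.
  have hp : (w ++ [Sum.inl i]).Perm (Sum.inl i :: w) := by
    simp
  rw [sum_eq_sum_map_add (l := w ++ [Sum.inl i]) (l' := (Sum.inl i :: w).map (delta (n + 1)))
    (hp.nodup_iff.2 hc.2.1) (hc.2.1.map (delta (n + 1)).injective) ?_ ?_,
    weight_insertEdge hcyc hrev hP' hW hpos hs]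
  · have e1 : (w ++ [Sum.inl i]).map (fun y => weight ε κ (insertOn i P' y) s) =
        (List.range (w.length + 1)).map fun k => ε ^ (n + 2 - totalLoops P') *
          (κ (s (.inl i.castSucc) :: (w.map (s ∘ contractEmb i)).drop k) *
            κ (s (.inl i.succ) :: (w.map (s ∘ contractEmb i)).take k) *
            (W.map fun l => κ (l.map (s ∘ contractEmb i))).prod) := by
      apply List.ext_getElem (by simp)
      intro k h1 h2
      rw [List.getElem_map, List.getElem_map, List.getElem_range,
        weight_split hcyc hrev hP' hW hpos hs]
    have e2 : ((Sum.inl i :: w).map (delta (n + 1))).map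
        (fun y => weight ε κ (insertOn i P' y) s) =
        (List.range (w.length + 1)).map fun k => ε ^ (n + 2 - totalLoops P') * (ε *
          (κ (s (.inl i.castSucc) :: ((((w.map (s ∘ contractEmb i)).take k).map t).reverse ++
            t (s (.inl i.succ)) :: (w.map (s ∘ contractEmb i)).drop k)) *
            (W.map fun l => κ (l.map (s ∘ contractEmb i))).prod)) := by
      apply List.ext_getElem (by simp)
      intro k h1 h2
      rw [List.getElem_map, List.getElem_map, List.getElem_map, List.getElem_range,
        weight_twist hcyc hrev hP' hW hpos hs]
    rw [e1, e2, splitExpansion, List.length_map, List.sum_map_mul_left, List.sum_map_mul_left,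
      List.sum_map_mul_left, List.sum_map_mul_right, List.sum_map_mul_right]
    ring
  · intro z h1 h2
    rw [hp.mem_iff] at h1
    obtain ⟨z', hz', rfl⟩ := List.mem_map.1 h2
    exact hP'.not_sameCycle hδ z' ((hc.mem_iff.1 hz').symm.trans (hc.mem_iff.1 h1))
  · intro z h1 h2
    refine weight_merge hP' hε fun hz => ?_
    rw [hp.mem_iff] at h1
    rcases hc.mem_of_loops hP' hδ (List.mem_cons_self ..) hz with h | h
    · exact h1 h
    · exact h2 (List.mem_map.2 ⟨_, h, hδ.apply_apply z⟩)

end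

end Step

/-! ### Products of tuples -/

section Products

variable {A : Type*} [Monoid A] {n : ℕ}

theorem prod_ofFn_merge (i : Fin n) (b : Fin (n + 1) → A) :
    (List.ofFn b).prod = (List.ofFn fun j => if j = i then b i.castSucc * b i.succ
      else b (i.succ.succAbove j)).prod := by
  induction n with
  | zero => exact i.elim0
  | succ n ih =>
    rw [List.ofFn_succ (n := n + 1), List.prod_cons]
    cases i using Fin.cases with
    | zero =>
      rw [List.ofFn_succ, List.ofFn_succ, List.prod_cons, List.prod_cons, ← mul_assoc]
      simp [Fin.succ_ne_zero, Fin.succAbove, Fin.lt_def]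
    | succ i =>
      rw [ih i (fun x => b x.succ)]
      obtain _ | n := n
      · exact i.elim0
      have h : (0 : Fin (n + 1 + 1)) ≠ i.succ := (Fin.succ_ne_zero i).symm
      simp [h]

theorem prod_ofFn_single (a : Fin n → A) (j : Fin n) :
    (List.ofFn fun x => if x = j then a x else 1).prod = a j := by
  induction n with
  | zero => exact j.elim0
  | succ n ih =>
    rw [List.ofFn_succ, List.prod_cons]
    cases j using Fin.cases with
    | zero => simp [Fin.succ_ne_zero]
    | succ j =>
      have h : (0 : Fin (n + 1)) ≠ j.succ := (Fin.succ_ne_zero j).symm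
      simp only [h, if_false, one_mul, Fin.succ_inj]
      exact ih (fun x => a x.succ) j

theorem mergeEntries_inl (i j : Fin n) (s : Pm (n + 1) → A) : mergeEntries i s (.inl j) =
    if j = i then s (.inl i.castSucc) * s (.inl i.succ) else s (.inl (i.succ.succAbove j)) := by
  simp [mergeEntries, contractEmb_inl]

end Products

/-! ### The cumulant with one product as entry -/

section Expansion

variable {R : Type*} [CommRing R] {A : Type*} [Monoid A] {n : ℕ} {ε : R} {κ : List A → R}
  {t : A → A} {T : A → R}

/-- The tuples (x, y, w) and (xy, w) have the same moment. Group the pairings of the longer tuple by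
the pairing P' from which they arise: each P' other than `gap` contributes equally to both moments
by induction on the length, so the terms of `gap` agree, which is the claim. -/
theorem cumulant_mul_cons (hM : MomentFormula ε κ t T) (hε : ε * ε = 0) (ht : ∀ a, t (t a) = a)
    (hmul : ∀ a b, t (a * b) = t b * t a) (hcyc : ∀ l : List A, κ (l.rotate 1) = κ l)
    (hrev : ∀ l : List A, ε * κ (l.map t).reverse = ε * κ l)
    (hsplit : ∀ x y w, ε * κ (x * y :: w) = ε * splitExpansion ε κ t x y w) (x y : A) (w : List A) :
    κ (x * y :: w) = splitExpansion ε κ t x y w := by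
  induction hn : w.length using Nat.strong_induction_on generalizing x y w with
  | h n ih =>
    obtain ⟨b, rfl⟩ := exists_ofFn_eq hn
    set a : Fin (n + 2) → A := Fin.cons x (Fin.cons y b) with ha
    set s := extend t a with hs'
    have hs := extend_delta ht a
    rw [← hs'] at hs
    have h1 := hM (n + 1) s hs
    have h2 := hM n (mergeEntries 0 s) (mergeEntries_delta hmul 0 hs)
    have h3 : (List.ofFn fun i => mergeEntries 0 s (.inl i)) = x * y :: List.ofFn b := by
      rw [List.ofFn_succ, mergeEntries_inl, if_pos rfl]
      congr 1
    have h4 : (List.ofFn fun i => s (.inl i)) = x :: y :: List.ofFn b := by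
      rw [List.ofFn_succ, List.ofFn_succ]
      rfl
    rw [h3] at h2
    rw [h4, List.prod_cons, List.prod_cons, ← mul_assoc, ← List.prod_cons, h2,
      sum_pairings_succ (n := n + 1) 0] at h1
    have hgm : gap (n + 1) ∈ pairings (Pm (n + 1)) := mem_pairings.2 (isPairing_gap _)
    have h5 : ∀ P' ∈ (pairings (Pm (n + 1))).erase (gap (n + 1)),
        weight ε κ P' (mergeEntries 0 s) =
          weight ε κ (insertEdge 0 P') s + ∑ z, weight ε κ (insertOn 0 P' z) s := by
      intro P' hP
      have hP' := mem_pairings.1 (Finset.mem_of_mem_erase hP)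
      have hne := Finset.ne_of_mem_erase hP
      obtain ⟨v, W, -, hW, hpos⟩ := exists_loopDecomp (0 : Fin (n + 1)) hP'
      rw [weight_insert_sum hcyc hrev hP' hW hpos hs hε,
        weight_mergeEntries hcyc hrev hP' hW hpos hmul hs, ← mul_assoc, ← mul_assoc]
      congr 1
      -- If `P'` is planar, its word through the first point is shorter than the full one and the
      -- induction applies. If not, there is a factor ε and `hsplit` suffices.
      by_cases hl : totalLoops P' = n + 2
      · have := length_le_of_ne_gap hP' hne hl hW (List.mem_cons_self ..)
        rw [List.length_cons] at this
        rw [ih v.length (by omega) _ _ _ (by simp)]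
      · have := totalLoops_spec n hP'
        exact pow_mul_eq (by omega) (hsplit _ _ _)
    rw [← Finset.add_sum_erase _ _ hgm, ← Finset.add_sum_erase _ _ hgm,
      Finset.sum_congr rfl h5] at h1
    have h6 := add_right_cancel h1
    have hW := loopDecomp_repWords (isPairing_gap (n + 1))
    rw [repWords_gap, List.finRange_succ, List.map_cons] at hW
    rw [weight_insert_sum hcyc hrev (isPairing_gap _) hW (by simp [StartsPos]) hs hε, weight_gap,
      totalLoops_gap, Nat.sub_self, pow_zero, one_mul, List.map_nil, List.prod_nil, mul_one, h3]
      at h6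
    rw [h6]
    congr 1
    rw [List.map_map, List.map_map, List.ofFn_eq_map]
    rfl

end Expansion

/-! ### Products as entries, one merge at a time -/

section Fibers

variable {n r : ℕ} {ι : Type*}

/-- `x` is the last point of its fiber. -/
def IsLast (f : Fin n → ι) (x : Fin n) : Prop := ∀ y, x < y → f y ≠ f x

/-- The loops formed by `P` and `gap n` separate the last points of the fibers of `f`. -/
def SeparatesFibers (f : Fin n → ι) (P : Perm (Pm n)) : Prop :=
  ∀ x y, IsLast f x → IsLast f y → loops P (gap n) (.inr x) (.inr y) → x = y

/-- Since i and i+1 lie in a common fiber, i is never the last point, and its removal does not alter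
which points are last. -/
theorem isLast_iff {i : Fin n} {f : Fin (n + 1) → ι} (hf : f i.castSucc = f i.succ)
    {x : Fin (n + 1)} :
    IsLast f x ↔ ∃ j, i.castSucc.succAbove j = x ∧ IsLast (f ∘ i.castSucc.succAbove) j := by
  have hm := Fin.strictMono_succAbove i.castSucc
  constructor
  · intro h
    have hx : x ≠ i.castSucc := by
      rintro rfl
      exact h i.succ i.castSucc_lt_succ hf.symm
    obtain ⟨j, rfl⟩ := Fin.exists_succAbove_eq hx
    exact ⟨j, rfl, fun k hk => h _ (hm hk)⟩
  · rintro ⟨j, rfl, hj⟩ y hy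
    by_cases hyi : y = i.castSucc
    · subst hyi
      rw [hf, ← castSucc_succAbove_self]
      apply hj
      rw [← hm.lt_iff_lt, castSucc_succAbove_self]
      exact hy.trans i.castSucc_lt_succ
    · obtain ⟨k, rfl⟩ := Fin.exists_succAbove_eq hyi
      exact hj k (hm.lt_iff_lt.1 hy)

theorem separatesFibers_iff {i : Fin n} {f : Fin (n + 1) → ι} (hf : f i.castSucc = f i.succ)
    {P : Perm (Pm (n + 1))} {P' : Perm (Pm n)}
    (h : ∀ a b, loops P (gap (n + 1)) (contractEmb i a) (contractEmb i b) ↔ loops P' (gap n) a b) :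
    SeparatesFibers f P ↔ SeparatesFibers (f ∘ i.castSucc.succAbove) P' := by
  have h' : ∀ a b, loops P (gap (n + 1)) (.inr (i.castSucc.succAbove a))
      (.inr (i.castSucc.succAbove b)) ↔ loops P' (gap n) (.inr a) (.inr b) :=
    fun a b => h (.inr a) (.inr b)
  constructor
  · intro hs x y hx hy hxy
    exact Fin.succAbove_right_injective (hs _ _ ((isLast_iff hf).2 ⟨x, rfl, hx⟩)
      ((isLast_iff hf).2 ⟨y, rfl, hy⟩) ((h' x y).2 hxy))
  · intro hs x y hx hy hxy
    obtain ⟨x, rfl, hx'⟩ := (isLast_iff hf).1 hx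
    obtain ⟨y, rfl, hy'⟩ := (isLast_iff hf).1 hy
    rw [hs x y hx' hy' ((h' x y).1 hxy)]

theorem exists_eq_of_not_injective {f : Fin (n + 1) → Fin r} (hf : Monotone f)
    (h : ¬ Function.Injective f) : ∃ i : Fin n, f i.castSucc = f i.succ := by
  by_contra! hc
  exact h (Fin.strictMono_iff_lt_succ.2 fun i =>
    lt_of_le_of_ne (hf i.castSucc_lt_succ.le) (hc i)).injective

theorem surjective_comp_succAbove {i : Fin n} {f : Fin (n + 1) → ι} (hf : f i.castSucc = f i.succ)
    (hs : Function.Surjective f) : Function.Surjective (f ∘ i.castSucc.succAbove) := by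
  intro j
  obtain ⟨x, rfl⟩ := hs j
  by_cases hx : x = i.castSucc
  · exact ⟨i, by rw [Function.comp_apply, castSucc_succAbove_self, hx, hf]⟩
  · obtain ⟨k, rfl⟩ := Fin.exists_succAbove_eq hx
    exact ⟨k, rfl⟩

/-- The product of the entries in a fiber. -/
def fiberProd {A : Type*} [Monoid A] [DecidableEq ι] (f : Fin n → ι) (a : Fin n → A) (j : ι) : A :=
  (List.ofFn fun x => if f x = j then a x else 1).prod

theorem fiberProd_mergeEntries {A : Type*} [Monoid A] [DecidableEq ι] {i : Fin n}
    {f : Fin (n + 1) → ι} (hf : f i.castSucc = f i.succ) (s : Pm (n + 1) → A) (j : ι) :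
    fiberProd (f ∘ i.castSucc.succAbove) (fun x => mergeEntries i s (.inl x)) j =
      fiberProd f (fun x => s (.inl x)) j := by
  rw [fiberProd, fiberProd, prod_ofFn_merge i]
  congr 2
  funext x
  rw [mergeEntries_inl, Function.comp_apply]
  by_cases hx : x = i
  · subst hx
    rw [castSucc_succAbove_self, if_pos rfl, if_pos rfl, hf]
    split_ifs <;> simp
  · rw [if_neg hx, if_neg hx, succAbove_succ_eq _ hx]

variable {R : Type*} [CommRing R] {A : Type*} [Monoid A] {ε : R} {κ : List A → R}
  {t : A → A}

open Classical in
-- A monotone bijection is the identity, so every point is last in its fiber and only `gap`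
-- separates them all.
theorem cumulant_fiberProd_of_injective {f : Fin (n + 1) → Fin r} (hf : Monotone f)
    (hsurj : Function.Surjective f) (hinj : Function.Injective f) (s : Pm (n + 1) → A) :
    κ (List.ofFn (fiberProd f fun x => s (.inl x))) =
      ∑ P ∈ pairings (Pm (n + 1)) with SeparatesFibers f P, weight ε κ P s := by
  obtain rfl : n + 1 = r := by
    simpa using Fintype.card_congr (Equiv.ofBijective f ⟨hinj, hsurj⟩)
  have hid : f = id := (hf.strictMono_of_injective hinj).eq_id
  subst hid
  have h1 : (pairings (Pm (n + 1))).filter (SeparatesFibers id) = {gap (n + 1)} := by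
    ext P
    rw [Finset.mem_filter, mem_pairings, Finset.mem_singleton]
    constructor
    · rintro ⟨hP, h⟩
      exact eq_gap_of_separated hP fun x y => h x y (fun z hz => hz.ne') fun z hz => hz.ne'
    · rintro rfl
      refine ⟨isPairing_gap _, fun x y _ _ => separated_of_numLoops ?_⟩
      rw [← pairOf_finRotate, numLoops_pairOf, mul_inv_cancel, numCycles_one,
        Nat.card_eq_fintype_card, Fintype.card_fin]
  rw [h1, Finset.sum_singleton, weight_gap]
  congr 2
  funext j
  exact prod_ofFn_single (fun x => s (.inl x)) j

open Classical in
/-- The cumulant with products as entries. -/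
theorem cumulant_fiberProd (hε : ε * ε = 0)
    (hmul : ∀ a b, t (a * b) = t b * t a) (hcyc : ∀ l : List A, κ (l.rotate 1) = κ l)
    (hrev : ∀ l : List A, ε * κ (l.map t).reverse = ε * κ l)
    (hsplit : ∀ x y w, κ (x * y :: w) = splitExpansion ε κ t x y w)
    {f : Fin (n + 1) → Fin r} (hf : Monotone f) (hsurj : Function.Surjective f)
    {s : Pm (n + 1) → A} (hs : ∀ x, s (delta (n + 1) x) = t (s x)) :
    κ (List.ofFn (fiberProd f fun x => s (.inl x))) =
      ∑ P ∈ pairings (Pm (n + 1)) with SeparatesFibers f P, weight ε κ P s := by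
  induction n with
  | zero =>
    have hinj : Function.Injective f := fun x y _ => Fin.ext (by omega)
    exact cumulant_fiberProd_of_injective hf hsurj hinj s
  | succ n ih =>
    by_cases hinj : Function.Injective f
    · exact cumulant_fiberProd_of_injective hf hsurj hinj s
    obtain ⟨i, hi⟩ := exists_eq_of_not_injective hf hinj
    have h1 := ih (hf.comp (Fin.strictMono_succAbove i.castSucc).monotone)
      (surjective_comp_succAbove hi hsurj) (mergeEntries_delta hmul i hs)
    rw [funext (fiberProd_mergeEntries hi s)] at h1
    rw [h1, Finset.sum_filter, Finset.sum_filter, sum_pairings_succ i]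
    refine Finset.sum_congr rfl fun P' hP => ?_
    have hP' := mem_pairings.1 hP
    -- The condition depends only on `P'`, so either all expansions of `P'` are admitted or none is,
    -- and `weight_insert_sum` sums a complete family.
    rw [separatesFibers_iff hi (loops_gap_insertEdge hP').1]
    simp_rw [separatesFibers_iff hi (loops_gap_insertOn hP' _).1]
    split_ifs with h
    · obtain ⟨v, W, -, hW, hpos⟩ := exists_loopDecomp i hP'
      rw [weight_insert_sum hcyc hrev hP' hW hpos hs hε,
        weight_mergeEntries hcyc hrev hP' hW hpos hmul hs, hsplit]
    · simp

end Fibers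

/-! ### Sums over pairings as sums over partitions and annular permutations -/

section Weights

variable {R R' : Type*} [CommRing R] [CommRing R'] {A : Type*} {n : ℕ} {ε : R} {κ : List A → R}
  {t : A → A}

theorem map_weight (g : R →+* R') (P : Perm (Pm n)) (s : Pm n → A) :
    g (weight ε κ P s) = weight (g ε) (g ∘ κ) P s := by
  simp [weight, map_list_prod, Function.comp_def]

theorem map_splitExpansion (g : R →+* R') (x y : A) (w : List A) :
    g (splitExpansion ε κ t x y w) = splitExpansion (g ε) (g ∘ κ) t x y w := by
  simp [splitExpansion, map_list_sum, Function.comp_def]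

theorem loopDecomp_blocks (π : Part n) : LoopDecomp (pairOf (blockPerm π)) (delta n)
    (π.parts.toList.map fun V => (V.sort (· ≤ ·)).map Sum.inl) := by
  have hmem : ∀ x, x ∈ (π.parts.toList.map fun V => (V.sort (· ≤ ·)).map
      (Sum.inl : Fin n → Pm n)).flatten ↔ x.isLeft := by
    intro x
    simp only [List.mem_flatten, List.mem_map, Finset.mem_toList, exists_exists_and_eq_and,
      Finset.mem_sort]
    constructor
    · rintro ⟨V, -, y, -, rfl⟩; rfl
    · intro h
      rcases x with x | x
      · exact ⟨_, π.part_mem.2 (Finset.mem_univ x), x, by simp, rfl⟩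
      · simp at h
  refine ⟨?_, ?_, ?_⟩
  · intro l hl
    simp only [List.mem_map, Finset.mem_toList] at hl
    obtain ⟨V, hV, rfl⟩ := hl
    have h := isCycleWord_sort hV
    refine ⟨by simpa using h.1, h.2.1.map Sum.inl_injective, ?_⟩
    rw [← List.map_rotate, ← h.2.2, List.map_map, List.map_map]
    rfl
  · rw [List.nodup_flatten]
    constructor
    · intro l hl
      simp only [List.mem_map, Finset.mem_toList] at hl
      obtain ⟨V, hV, rfl⟩ := hl
      exact (V.sort_nodup _).map Sum.inl_injective
    · rw [List.pairwise_map]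
      refine (Finset.nodup_toList _).imp_of_mem ?_
      intro V W hV hW hVW x hx hx'
      rw [Finset.mem_toList] at hV hW
      obtain ⟨y, hy, rfl⟩ := List.mem_map.1 hx
      obtain ⟨z, hz, h⟩ := List.mem_map.1 hx'
      obtain rfl := Sum.inl_injective h
      rw [Finset.mem_sort] at hy hz
      exact hVW (π.eq_of_mem_parts hV hW hy hz)
  · intro x
    rw [hmem, hmem]
    rcases x with x | x <;> simp [delta]

/-- No symmetry of κ is required: the representative of a block is its smallest element, so the word
read from it is the sorted block. This matters because the moment formula precedes the symmetries.
-/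
theorem prod_repWords_blockPerm (π : Part n) (s : Pm n → A) :
    ((repWords (pairOf (blockPerm π) * delta n)).map fun l => κ (l.map s)).prod =
      ∏ V ∈ π.parts, κ ((V.sort (· ≤ ·)).map fun i => s (.inl i)) := by
  have hP := isPairing_pairOf (blockPerm π)
  have hδ := isPairing_delta n
  have h := (loopDecomp_repWords hP).mul_prod_congr hP hδ (loopDecomp_blocks π) (c := (1 : R))
    (f := fun l => κ (l.map s)) (f' := fun l => κ (l.map s)) ?_
  · rw [one_mul, one_mul] at h
    rw [h, List.map_map, Finset.prod_map_toList]
    refine Finset.prod_congr rfl fun V _ => ?_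
    simp [Function.comp_def]
  · intro l hl l' hl' x hx y hy hxy
    obtain ⟨i, hi, rfl⟩ := mem_repWords.1 hl
    have hc' := (loopDecomp_blocks π).cyc l' hl'
    simp only [List.mem_map, Finset.mem_toList] at hl'
    obtain ⟨V, hV, rfl⟩ := hl'
    rw [mem_orbitWord] at hx
    have h1 : (Sum.inl i : Pm n) ∈ (V.sort (· ≤ ·)).map (Sum.inl : Fin n → Pm n) := by
      rcases hc'.mem_of_loops hP hδ hy (Setoid.symm' _ (Setoid.trans' _ (loops_of_sameCycle hx) hxy))
        with h | h
      · exact h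
      · simp [delta] at h
    have hiV : i ∈ V.sort (· ≤ ·) := by simpa using h1
    obtain ⟨v, w, hvw⟩ := List.exists_cons_of_ne_nil (List.ne_nil_of_mem hiV)
    have hsort : (v :: w).Pairwise (· ≤ ·) := hvw ▸ V.pairwise_sort (· ≤ ·)
    have h2 : v ≤ i := by
      rw [hvw] at hiV
      rcases List.mem_cons.1 hiV with h | h
      · exact h.ge
      · exact (List.pairwise_cons.1 hsort).1 i h
    rw [hvw, List.map_cons] at hc' h1 ⊢
    have h3 : i ≤ v := mem_reps.1 hi _ (hc'.mem_iff.1 h1).symm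
    rw [le_antisymm h3 h2, hc'.orbitWord_eq]

theorem weight_blockPerm {π : Part (n + 1)} (hπ : π ∈ NC (n + 1)) (s : Pm (n + 1) → A) :
    weight ε κ (pairOf (blockPerm π)) s =
      ∏ V ∈ π.parts, κ ((V.sort (· ≤ ·)).map fun i => s (.inl i)) := by
  rw [weight, (totalLoops_eq_iff (isPairing_pairOf _)).2 ⟨π, hπ, rfl⟩, Nat.sub_self, pow_zero,
    one_mul, prod_repWords_blockPerm]

open Classical in
theorem sum_pairings_eq {M : Type*} [AddCommMonoid M] (q : Perm (Pm (n + 1)) → Prop)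
    {F : Perm (Pm (n + 1)) → M}
    (hF : ∀ P, IsPairing P → totalLoops P < n + 1 → F P = 0) :
    ∑ P ∈ pairings (Pm (n + 1)) with q P, F P =
      ∑ π ∈ NC (n + 1) with q (pairOf (blockPerm π)), F (pairOf (blockPerm π)) +
        ∑ σ ∈ SNC (n + 1) with q (σ * delta (n + 1)), F (σ * delta (n + 1)) := by
  have hδ := isPairing_delta (n + 1)
  have h1 : ∑ π ∈ NC (n + 1) with q (pairOf (blockPerm π)), F (pairOf (blockPerm π)) =
      ∑ P ∈ (pairings (Pm (n + 1))).filter q with totalLoops P = n + 2, F P := by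
    refine Finset.sum_bij (fun π _ => pairOf (blockPerm π)) ?_ ?_ ?_ (fun _ _ => rfl)
    · intro π hπ
      rw [Finset.mem_filter] at hπ
      simp only [Finset.mem_filter, mem_pairings]
      exact ⟨⟨isPairing_pairOf _, hπ.2⟩, (totalLoops_eq_iff (isPairing_pairOf _)).2 ⟨π, hπ.1, rfl⟩⟩
    · intro π _ π' _ h
      exact blockPerm_injective (pairOf_injective h)
    · intro P hP
      simp only [Finset.mem_filter, mem_pairings] at hP
      obtain ⟨π, hπ, rfl⟩ := (totalLoops_eq_iff hP.1.1).1 hP.2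
      exact ⟨π, Finset.mem_filter.2 ⟨hπ, hP.1.2⟩, rfl⟩
  have h2 : ∑ σ ∈ SNC (n + 1) with q (σ * delta (n + 1)), F (σ * delta (n + 1)) =
      ∑ P ∈ (pairings (Pm (n + 1))).filter q with totalLoops P = n + 1, F P := by
    refine Finset.sum_bij (fun σ _ => σ * delta (n + 1)) ?_ ?_ ?_ (fun _ _ => rfl)
    · intro σ hσ
      rw [Finset.mem_filter, mem_SNC_iff] at hσ
      simp only [Finset.mem_filter, mem_pairings]
      exact ⟨⟨hσ.1.1, hσ.2⟩, hσ.1.2⟩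
    · intro σ _ σ' _ h
      exact mul_right_cancel h
    · intro P hP
      simp only [Finset.mem_filter, mem_pairings] at hP
      have e : P * delta (n + 1) * delta (n + 1) = P := by rw [mul_assoc, hδ.1, mul_one]
      exact ⟨P * delta (n + 1), by rw [Finset.mem_filter, mem_SNC_iff, e]; exact ⟨⟨hP.1.1, hP.2⟩, hP.1.2⟩, e⟩
  rw [h1, h2, ← Finset.sum_filter_add_sum_filter_not _ (fun P => totalLoops P = n + 2)]
  congr 1
  rw [← Finset.sum_filter_add_sum_filter_not _ (fun P => totalLoops P = n + 1)]
  rw [Finset.filter_filter, Finset.sum_eq_zero (s := Finset.filter (fun P => ¬ totalLoops P = n + 1) _),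
    add_zero]
  · apply Finset.sum_congr _ fun _ _ => rfl
    apply Finset.filter_congr
    intro P _
    omega
  · intro P hP
    simp only [Finset.mem_filter, mem_pairings] at hP
    have := totalLoops_spec n hP.1.1.1
    exact hF P hP.1.1.1 (by omega)

end Weights

/-! ### The moment-cumulant formulas over ℂ and over the dual numbers -/

section Cumulants

variable {A : Type*} [Ring A] [Algebra ℂ A] (S : RealInfProbSpace A) {n : ℕ}

/-- The free cumulants of lists. -/
noncomputable def listCumulant (l : List A) : ℂ := S.cumulant l.length l.get

/-- The infinitesimal cumulants of lists. -/
noncomputable def listInfCumulant (l : List A) : ℂ := S.infCumulant l.length l.get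

omit [Ring A] [Algebra ℂ A] in
theorem apply_ofFn {B : Type*} (F : (n : ℕ) → (Fin n → A) → B) (a : Fin n → A) :
    F (List.ofFn a).length (List.ofFn a).get = F n a :=
  congrArg (fun p : Σ n, Fin n → A => F p.1 p.2) (List.equivSigmaTuple.apply_symm_apply ⟨n, a⟩)

omit [Ring A] [Algebra ℂ A] in
theorem ofFn_restr (a : Fin n → A) (V : Finset (Fin n)) :
    List.ofFn (restr a V) = (V.sort (· ≤ ·)).map a := by
  apply List.ext_getElem (by simp)
  intro k h1 h2
  rw [List.getElem_ofFn, List.getElem_map, restr, Finset.orderEmbOfFin_apply]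
  rfl

theorem listCumulant_sort (a : Fin n → A) (V : Finset (Fin n)) :
    listCumulant S ((V.sort (· ≤ ·)).map a) = S.cumulant V.card (restr a V) := by
  rw [← ofFn_restr]
  exact apply_ofFn S.cumulant _

theorem listInfCumulant_sort (a : Fin n → A) (V : Finset (Fin n)) :
    listInfCumulant S ((V.sort (· ≤ ·)).map a) = S.infCumulant V.card (restr a V) := by
  rw [← ofFn_restr]
  exact apply_ofFn S.infCumulant _

theorem cumulantHalf_eq (σ : Perm (Pm n)) (a : Fin n → A) : S.cumulantHalf σ a =
    ((repWords σ).map fun l => listCumulant S (l.map (S.signed a))).prod := by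
  rw [repWords, List.map_map, Finset.prod_map_toList]
  refine Finset.prod_congr rfl fun i _ => ?_
  have : (orbitWord σ (Sum.inl i)).map (S.signed a) = List.ofFn
      (fun j : Fin (Function.minimalPeriod σ (Sum.inl i)) => S.signed a ((σ ^ (j : ℕ)) (Sum.inl i))) := by
    apply List.ext_getElem (by simp [orbitWord])
    intro k h1 h2
    simp [orbitWord]
  rw [Function.comp_apply, this]
  exact (apply_ofFn S.cumulant _).symm

theorem signed_eq (s : Pm n → A) (hs : ∀ x, s (delta n x) = S.t (s x)) :
    S.signed (fun i => s (.inl i)) = s := by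
  funext x
  rcases x with x | x
  · rfl
  · exact (hs (.inl x)).symm

/-- With ε = 0 only the pairings of maximal loop count survive, and they are the non-crossing
partitions. -/
theorem momentFormula : MomentFormula (0 : ℂ) (listCumulant S) S.t S.τ := by
  classical
  intro n s hs
  have h := sum_pairings_eq (fun _ => True) (F := fun P => weight 0 (listCumulant S) P s)
    fun P hP h => by
      rw [weight, zero_pow (by omega), zero_mul]
  simp only [Finset.filter_true] at h
  rw [S.moment_eq (Nat.succ_pos n), h]
  rw [Finset.sum_eq_zero (s := SNC (n + 1)), add_zero]
  · refine Finset.sum_congr rfl fun π hπ => ?_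
    rw [weight_blockPerm hπ]
    exact Finset.prod_congr rfl fun V _ => (listCumulant_sort S _ V).symm
  · intro σ hσ
    rw [mem_SNC_iff] at hσ
    rw [weight, hσ.2, Nat.add_sub_cancel_left, pow_one, zero_mul]

/-- The free and the infinitesimal cumulants of lists, combined into a dual number. -/
noncomputable def dualCumulant (l : List A) : DualNumber ℂ :=
  TrivSqZeroExt.inl (listCumulant S l) + TrivSqZeroExt.inr (listInfCumulant S l)

/-- The functionals `τ` and `τ'`, combined into a dual number. -/
noncomputable def dualMoment (a : A) : DualNumber ℂ :=
  TrivSqZeroExt.inl (S.τ a) + TrivSqZeroExt.inr (S.τ' a)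

theorem eps_mul_eq (z : DualNumber ℂ) : DualNumber.eps * z = TrivSqZeroExt.inr z.fst := by
  ext
  · rw [TrivSqZeroExt.fst_mul, DualNumber.fst_eps, zero_mul, TrivSqZeroExt.fst_inr]
  · rw [DualNumber.snd_mul, DualNumber.fst_eps, DualNumber.snd_eps, zero_mul, zero_add, one_mul,
      TrivSqZeroExt.snd_inr]

/-- The Leibniz rule; applied to the blocks of π it produces ∂κ_π. -/
theorem snd_prod {ι : Type*} [DecidableEq ι] (s : Finset ι) (k k' : ι → ℂ) :
    (∏ i ∈ s, (TrivSqZeroExt.inl (k i) + TrivSqZeroExt.inr (k' i) : DualNumber ℂ)).snd =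
      ∑ i ∈ s, k' i * ∏ j ∈ s.erase i, k j := by
  induction s using Finset.induction_on with
  | empty => simp
  | insert a s ha ih =>
    have h1 : (∏ i ∈ s, (TrivSqZeroExt.inl (k i) + TrivSqZeroExt.inr (k' i) : DualNumber ℂ)).fst =
        ∏ i ∈ s, k i := by
      refine (map_prod (TrivSqZeroExt.fstHom ℂ ℂ ℂ) _ s).trans (Finset.prod_congr rfl fun i _ => ?_)
      change (TrivSqZeroExt.inl (k i) + TrivSqZeroExt.inr (k' i) : DualNumber ℂ).fst = _
      rw [TrivSqZeroExt.fst_add, TrivSqZeroExt.fst_inl, TrivSqZeroExt.fst_inr, add_zero]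
    rw [Finset.prod_insert ha, TrivSqZeroExt.snd_mul, ih, h1, Finset.sum_insert ha,
      Finset.erase_insert ha]
    simp only [TrivSqZeroExt.fst_add, TrivSqZeroExt.fst_inl, TrivSqZeroExt.fst_inr, add_zero,
      TrivSqZeroExt.snd_add, TrivSqZeroExt.snd_inl, TrivSqZeroExt.snd_inr, zero_add, smul_eq_mul,
      MulOpposite.smul_eq_mul_unop, MulOpposite.unop_op]
    rw [add_comm, Finset.mul_sum]
    congr 1
    refine Finset.sum_congr rfl fun i hi => ?_
    have hia : i ≠ a := fun h => ha (h ▸ hi)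
    rw [Finset.erase_insert_of_ne hia.symm, Finset.prod_insert (by simp [ha])]
    ring

theorem fst_weight (P : Perm (Pm n)) (s : Pm n → A) :
    (weight DualNumber.eps (dualCumulant S) P s).fst = weight 0 (listCumulant S) P s := by
  have h := map_weight (TrivSqZeroExt.fstHom ℂ ℂ ℂ).toRingHom (ε := DualNumber.eps)
    (κ := dualCumulant S) P s
  have e1 : (TrivSqZeroExt.fstHom ℂ ℂ ℂ).toRingHom DualNumber.eps = 0 := rfl
  have e2 : (TrivSqZeroExt.fstHom ℂ ℂ ℂ).toRingHom ∘ dualCumulant S = listCumulant S := by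
    funext l; simp [dualCumulant]
  rw [e1, e2] at h
  exact h

open Classical in
-- A planar pairing contributes through the Leibniz rule. One missing loop gives a factor ε, which
-- reduces the cumulants to free ones and leaves κ_{σ/2}. Two or more missing loops give ε² = 0.
theorem snd_sum_weight (q : Perm (Pm (n + 1)) → Prop) {s : Pm (n + 1) → A}
    (hs : ∀ x, s (delta (n + 1) x) = S.t (s x)) :
    (∑ P ∈ pairings (Pm (n + 1)) with q P, weight DualNumber.eps (dualCumulant S) P s).snd =
      ∑ π ∈ NC (n + 1) with q (pairOf (blockPerm π)), S.dCumulantPart π (fun i => s (.inl i)) +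
        ∑ σ ∈ SNC (n + 1) with q (σ * delta (n + 1)),
          S.cumulantHalf σ (fun i => s (.inl i)) := by
  rw [sum_pairings_eq q, TrivSqZeroExt.snd_add, TrivSqZeroExt.snd_sum, TrivSqZeroExt.snd_sum]
  · congr 1
    · refine Finset.sum_congr rfl fun π hπ => ?_
      rw [weight_blockPerm (Finset.mem_filter.1 hπ).1]
      simp only [dualCumulant, listCumulant_sort, listInfCumulant_sort]
      exact snd_prod _ _ _
    · refine Finset.sum_congr rfl fun σ hσ => ?_
      have h := (Finset.mem_filter.1 hσ).1
      rw [mem_SNC_iff] at h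
      rw [weight, h.2, Nat.add_sub_cancel_left, pow_one, eps_mul_eq, TrivSqZeroExt.snd_inr,
        cumulantHalf_eq, signed_eq S s hs, mul_assoc, (isPairing_delta _).1, mul_one]
      have := map_list_prod (TrivSqZeroExt.fstHom ℂ ℂ ℂ)
        ((repWords σ).map fun l => dualCumulant S (l.map s))
      rw [List.map_map] at this
      refine this.trans ?_
      congr 2
      funext l
      simp [dualCumulant]
  · intro P hP h
    have h1 : n + 1 + 1 - totalLoops P = (n - totalLoops P) + 2 := by omega
    have h2 : (DualNumber.eps : DualNumber ℂ) * DualNumber.eps = 0 := DualNumber.eps_mul_eps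
    rw [weight, h1, pow_add, pow_two, h2, mul_zero, zero_mul]

theorem dualMomentFormula :
    MomentFormula DualNumber.eps (dualCumulant S) S.t (dualMoment S) := by
  classical
  intro n s hs
  ext
  · rw [TrivSqZeroExt.fst_sum]
    simp only [fst_weight]
    rw [← momentFormula S n s hs]
    simp [dualMoment]
  · have h := snd_sum_weight S (fun _ => True) hs
    simp only [Finset.filter_true] at h
    rw [h, ← S.infMoment_eq (Nat.succ_pos n)]
    simp [dualMoment]

end Cumulants

/-! ### Intervals, their endpoints and the Kreweras complements -/

section Composition

variable {m : ℕ} (c : Composition m)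

theorem index_lt_of_lt_sizeUpTo {x : Fin m} {k : ℕ} (h : (x : ℕ) < c.sizeUpTo (k + 1)) :
    (c.index x : ℕ) ≤ k := by
  by_contra! hc
  have h1 := c.monotone_sizeUpTo (Nat.succ_le_of_lt hc)
  have h2 := c.sizeUpTo_index_le x
  exact absurd (h.trans_le (h1.trans h2)) (lt_irrefl _)

theorem monotone_index : Monotone c.index := by
  intro x y hxy
  exact index_lt_of_lt_sizeUpTo c (lt_of_le_of_lt hxy (c.lt_sizeUpTo_index_succ y))

theorem surjective_index : Function.Surjective c.index := fun j =>
  ⟨c.embedding j ⟨0, c.blocks_pos (by simp [Composition.blocksFun])⟩, c.index_embedding _ _⟩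

theorem mem_endpoints_iff {x : Fin m} : x ∈ endpoints c ↔ IsLast c.index x := by
  constructor
  · rintro ⟨j, hj⟩ y hy h
    have h1 : (c.index x : ℕ) ≤ j := index_lt_of_lt_sizeUpTo c (by omega)
    have h2 := c.monotone_sizeUpTo (Nat.succ_le_succ h1)
    have h3 := c.lt_sizeUpTo_index_succ y
    rw [h] at h3
    simp only [Fin.val_succ, Nat.succ_eq_add_one] at h2 h3
    have : (x : ℕ) < y := hy
    omega
  · intro h
    refine ⟨c.index x, ?_⟩
    have h1 : (x : ℕ) < c.sizeUpTo (c.index x + 1) := c.lt_sizeUpTo_index_succ x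
    by_contra hne
    have h2 : (x : ℕ) + 1 < c.sizeUpTo (c.index x + 1) := by omega
    have h3 := c.sizeUpTo_le (c.index x + 1)
    refine h ⟨x + 1, by omega⟩ (by simp [Fin.lt_def]) (le_antisymm ?_ ?_)
    · exact index_lt_of_lt_sizeUpTo c h2
    · exact monotone_index c (by simp [Fin.le_def])

theorem prod_map_filter {A B : Type*} [Monoid A] (p : B → Prop) [DecidablePred p] (a : B → A)
    (l : List B) : ((l.filter p).map a).prod = (l.map fun x => if p x then a x else 1).prod := by
  induction l with
  | nil => rfl
  | cons b l ih => by_cases h : p b <;> simp [h, ih]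

theorem ofFn_embedding (j : Fin c.length) :
    List.ofFn (c.embedding j) = (List.finRange m).filter fun x => c.index x = j := by
  have h1 : (List.ofFn (c.embedding j)).Pairwise (· < ·) := by
    rw [List.pairwise_ofFn]
    exact fun _ _ h => (c.embedding j).strictMono h
  have h2 : ((List.finRange m).filter fun x => c.index x = j).Pairwise (· < ·) :=
    (List.pairwise_lt_finRange m).filter _
  refine List.Perm.eq_of_pairwise (le := (· < ·)) (fun a b _ _ h h' => absurd h (lt_asymm h')) h1 h2 ?_
  rw [List.perm_ext_iff_of_nodup (h1.imp ne_of_lt) (h2.imp ne_of_lt)]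
  intro x
  rw [List.mem_ofFn', c.mem_range_embedding_iff']
  simp [eq_comm]

theorem consecutiveProducts_eq {A : Type*} [Ring A] (a : Fin m → A) :
    consecutiveProducts c a = fiberProd c.index a := by
  funext j
  rw [fiberProd, List.ofFn_eq_map, ← prod_map_filter, ← ofFn_embedding, List.map_ofFn]
  rfl

/-- Conjugation by γ turns K^δ(σ) into `gap * P` and takes the points -x and x to the two ends of
the edge {-x, γ x} of `gap`. These ends always lie on the two different cycles of one loop. So it is
no restriction to separate x from -x, and separating ±M by cycles is the same as separating M by
loops. -/
theorem separates_krewerasDelta {σ : Perm (Pm m)} (hP : IsPairing (σ * delta m)) :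
    Separates (krewerasDelta σ) (pmEndpoints c) ↔ SeparatesFibers c.index (σ * delta m) := by
  set P := σ * delta m with hPσ
  have hg := isPairing_gap m
  have hδ := isPairing_delta m
  have e1 : krewerasDelta σ = (gammaPm m)⁻¹ * (gap m * P) * gammaPm m := by
    have : σ⁻¹ = delta m * P := by
      rw [← hP.inv_eq, hPσ, mul_inv_rev, hδ.inv_eq, ← mul_assoc, hδ.1, one_mul]
    rw [krewerasDelta, this, gap]
    simp only [mul_assoc, inv_mul_cancel_left]
    rw [← mul_assoc (delta m) (delta m), hδ.1, one_mul]
  have e2 : ∀ x y, SameCycle (krewerasDelta σ) x y ↔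
      SameCycle (gap m * P) (gammaPm m x) (gammaPm m y) := by
    intro x y
    have := sameCycle_conj (f := gap m * P) (g := (gammaPm m)⁻¹) (x := x) (y := y)
    rwa [inv_inv, ← e1] at this
  have hr : ∀ j : Fin m, gammaPm m (.inr j) = .inr j := fun j => rfl
  have hl : ∀ j : Fin m, gammaPm m (.inl j) = gap m (.inr j) := fun j => rfl
  have hcomm : ∀ x y, loops P (gap m) x y ↔ loops (gap m) P x y := by
    have : ∀ P D : Perm (Pm m), loops P D ≤ loops D P := fun P D =>
      loops_le (loops_right D P) (loops_left D P)
    exact fun x y => ⟨fun h => this _ _ h, fun h => this _ _ h⟩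
  have hgp : ∀ x, SameCycle (gap m * P) (P x) (gap m x) := fun x =>
    ⟨1, by rw [zpow_one, Perm.mul_apply, hP.apply_apply]⟩
  constructor
  · intro h x y hx hy hxy
    rw [hcomm, loops_iff hg hP] at hxy
    rw [← mem_endpoints_iff] at hx hy
    rcases hxy with h1 | h1
    · exact Sum.inr_injective (h (.inr x) hx (.inr y) hy ((e2 _ _).2 h1))
    · exact absurd (h (.inl x) hx (.inr y) hy ((e2 _ _).2 ((hgp _).symm.trans h1))) (by simp)
  · intro h x hx y hy hxy
    rw [e2] at hxy
    have hγ : ∀ x : Pm m, loops P (gap m) (.inr (Pm.abs x)) (gammaPm m x) := by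
      rintro (x | x)
      · exact loops_right P (gap m) (.inr x)
      · exact Setoid.refl' _ _
    have h1 : loops P (gap m) (gammaPm m x) (gammaPm m y) := (hcomm _ _).2 (loops_of_sameCycle hxy)
    have h2 := h _ _ ((mem_endpoints_iff c).1 hx) ((mem_endpoints_iff c).1 hy)
      (Setoid.trans' _ (hγ x) (Setoid.trans' _ h1 (Setoid.symm' _ (hγ y))))
    rcases eq_or_eq_delta h2 with h3 | rfl
    · exact h3
    · exfalso
      rcases y with y | y
      · have h4 : SameCycle (gap m * P) (.inr y) (gap m (.inr y)) := hxy
        exact hg.not_sameCycle hP _ (h4.trans (hgp (.inr y)).symm)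
      · have h4 : SameCycle (gap m * P) (gap m (.inr y)) (.inr y) := hxy
        exact hg.not_sameCycle hP _ (h4.symm.trans (hgp (.inr y)).symm)

theorem loops_pairOf_gap {ν : Perm (Fin m)} {x y : Fin m} :
    loops (pairOf ν) (gap m) (.inr x) (.inr y) ↔ SameCycle (ν⁻¹ * finRotate m) x y := by
  have h1 : ∀ x : Fin m, loops (pairOf ν) (gap m) (.inr x) (.inl (finRotate m x)) :=
    fun x => loops_right (pairOf ν) (gap m) (.inr x)
  have h2 : loops (pairOf ν) (gap m) (.inr x) (.inr y) ↔
      loops (pairOf ν) (gap m) (.inl (finRotate m x)) (.inl (finRotate m y)) :=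
    ⟨fun h => Setoid.trans' _ (Setoid.symm' _ (h1 x)) (Setoid.trans' _ h (h1 y)),
      fun h => Setoid.trans' _ (h1 x) (Setoid.trans' _ h (Setoid.symm' _ (h1 y)))⟩
  have h3 := sameCycle_conj (f := ν * (finRotate m)⁻¹) (g := (finRotate m)⁻¹) (x := x) (y := y)
  rw [inv_inv] at h3
  rw [h2, ← pairOf_finRotate, loops_pairOf, ← h3, ← sameCycle_inv]
  congr! 1
  group

theorem separates_kreweras (π : Part m) :
    Separates (kreweras π) (endpoints c) ↔ SeparatesFibers c.index (pairOf (blockPerm π)) := by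
  constructor
  · intro h x y hx hy hxy
    exact h x ((mem_endpoints_iff c).2 hx) y ((mem_endpoints_iff c).2 hy) (loops_pairOf_gap.1 hxy)
  · intro h x hx y hy hxy
    exact h x y ((mem_endpoints_iff c).1 hx) ((mem_endpoints_iff c).1 hy) (loops_pairOf_gap.2 hxy)

end Composition

/-! ### For planar pairings, joining the intervals means separating their endpoints -/

section Joins

variable {n r : ℕ} {ι : Type*}

/-- The edges of `P` and the fibers of `f` connect all points. -/
def Joins (f : Fin n → ι) (P : Perm (Pm n)) : Prop :=
  ∀ r : Setoid (Fin n), Setoid.ker f ≤ r → (∀ x, r (Pm.abs x) (Pm.abs (P x))) → r = ⊤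

theorem joins_blockPerm {π : Part n} {f : Fin n → ι} :
    sameBlock π ⊔ Setoid.ker f = ⊤ ↔ Joins f (pairOf (blockPerm π)) := by
  constructor
  · intro h r hf hr
    rw [eq_top_iff, ← h]
    refine sup_le ?_ hf
    intro x y hxy
    have h1 : SameCycle (blockPerm π) x y := sameCycle_blockPerm.2 hxy
    refine Quotient.exact (sameCycle_invariant (f := Quotient.mk r) (fun z => ?_) h1)
    exact Quotient.sound (r.symm (hr (.inr z)))
  · intro h
    refine h _ le_sup_right fun x => le_sup_left (a := sameBlock π) ?_
    rcases x with x | x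
    · exact (sameCycle_blockPerm.1 ⟨1, by simp⟩ :
        π.part ((blockPerm π)⁻¹ x) = π.part x).symm
    · exact sameCycle_blockPerm.1 ⟨1, rfl⟩

theorem predAbove_abs_contractEmb (i : Fin n) (z : Pm n) :
    i.predAbove (Pm.abs (contractEmb i z)) = Pm.abs z := by
  rcases z with j | j
  · rw [contractEmb_inl]
    by_cases hj : j = i
    · subst hj
      rw [succ_succAbove_self]
      exact Fin.predAbove_castSucc_self j
    · rw [succAbove_succ_eq _ hj]
      exact Fin.predAbove_succAbove i j
  · rw [contractEmb_inr]
    exact Fin.predAbove_succAbove i j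

section

variable {i : Fin n} {f : Fin (n + 1) → ι} (hf : f i.castSucc = f i.succ)
  {P : Perm (Pm (n + 1))} {P' : Perm (Pm n)}
include hf

theorem comp_predAbove (x : Fin (n + 1)) : (f ∘ i.castSucc.succAbove) (i.predAbove x) = f x := by
  by_cases hx : x = i.castSucc
  · rw [hx, Fin.predAbove_castSucc_self, Function.comp_apply, castSucc_succAbove_self, hf]
  · obtain ⟨k, rfl⟩ := Fin.exists_succAbove_eq hx
    rw [Fin.predAbove_succAbove]
    rfl

theorem Joins.contract (H : ∀ r : Setoid (Fin n), (∀ z, r (Pm.abs z) (Pm.abs (P' z))) →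
      ∀ x, r (i.predAbove (Pm.abs x)) (i.predAbove (Pm.abs (P x)))) (h : Joins f P) :
    Joins (f ∘ i.castSucc.succAbove) P' := by
  intro r hr hr'
  have := h (r.comap i.predAbove) (fun x y hxy => hr (by
    rw [Setoid.ker_def] at hxy ⊢
    rw [comp_predAbove hf, comp_predAbove hf, hxy])) (H r hr')
  rw [Setoid.eq_top_iff] at this ⊢
  intro x y
  have h1 := this (i.castSucc.succAbove x) (i.castSucc.succAbove y)
  rw [Setoid.comap_rel, Fin.predAbove_succAbove, Fin.predAbove_succAbove] at h1
  exact h1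

theorem rel_contractEmb {r : Setoid (Fin (n + 1))} (hr : Setoid.ker f ≤ r) (z : Pm n) :
    r (Pm.abs (contractEmb i z)) (i.castSucc.succAbove (Pm.abs z)) := by
  apply hr
  rw [Setoid.ker_def, ← comp_predAbove hf, predAbove_abs_contractEmb, Function.comp_apply]

theorem Joins.expand (H : ∀ r : Setoid (Fin (n + 1)), r i.castSucc i.succ →
      (∀ x, r (Pm.abs x) (Pm.abs (P x))) →
      ∀ z, r (Pm.abs (contractEmb i z)) (Pm.abs (contractEmb i (P' z))))
    (h : Joins (f ∘ i.castSucc.succAbove) P') : Joins f P := by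
  intro r hr hr'
  have := h (r.comap i.castSucc.succAbove) (fun x y hxy => hr hxy) fun z =>
    r.trans (r.symm (rel_contractEmb hf hr z)) (r.trans (H r (hr hf) hr' z)
      (rel_contractEmb hf hr (P' z)))
  rw [Setoid.eq_top_iff] at this ⊢
  have key : ∀ x : Fin (n + 1), ∃ j, r x (i.castSucc.succAbove j) := by
    intro x
    refine ⟨i.predAbove x, hr ?_⟩
    rw [Setoid.ker_def, ← comp_predAbove hf x]
    rfl
  intro x y
  obtain ⟨j, hj⟩ := key x
  obtain ⟨k, hk⟩ := key y
  exact r.trans hj (r.trans (this j k) (r.symm hk))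

theorem joins_insertEdge (hP' : IsPairing P') :
    Joins f (insertEdge i P') ↔ Joins (f ∘ i.castSucc.succAbove) P' := by
  have hE := isTrivialExpansion_insertEdge (i := i) hP'
  refine ⟨Joins.contract hf fun r hr x => ?_, Joins.expand hf fun r hr hr' z => ?_⟩
  · rcases contractEmb_surj i x with rfl | rfl | ⟨z, rfl⟩
    · rw [hE.P_p]; simp [Pm.abs]
    · rw [hE.P_q]; simp [Pm.abs]
    · rw [hE.P_e, predAbove_abs_contractEmb, predAbove_abs_contractEmb]
      exact hr z
  · rw [← hE.P_e]
    exact hr' _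

omit hf in
theorem rel_of_loops {r : Setoid (Fin n)} (hr : ∀ z, r (Pm.abs z) (Pm.abs (P' z))) {x y : Pm n}
    (h : loops P' (delta n) x y) : r (Pm.abs x) (Pm.abs y) :=
  loops_le (r := r.comap Pm.abs) hr (fun z => by rw [Setoid.comap_rel, abs_delta]) h

/-- The split cuts one cycle into two pieces, but these contain i and i+1, which the common fiber
connects again. -/
theorem joins_insertOn (hP' : IsPairing P') {y : Pm n}
    (hy : SameCycle (P' * delta n) (.inl i) y) :
    Joins f (insertOn i P' y) ↔ Joins (f ∘ i.castSucc.succAbove) P' := by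
  have hE := isExpansion_insertOn (i := i) hP' y
  have h1 : insertOn i P' y (contractEmb i y) = .inr i.castSucc :=
    (hE.P_pairing.apply_eq_iff.1 hE.P_p).symm ▸ rfl
  have h2 : insertOn i P' y (contractEmb i (P' y)) = .inl i.succ :=
    (hE.P_pairing.apply_eq_iff.1 hE.P_q).symm ▸ rfl
  have hp : i.predAbove (Pm.abs (.inr i.castSucc)) = i := by simp [Pm.abs]
  have hq : i.predAbove (Pm.abs (.inl i.succ)) = i := by simp [Pm.abs]
  refine ⟨Joins.contract hf fun r hr x => ?_, Joins.expand hf fun r hr hr' z => ?_⟩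
  · have h3 : r i (Pm.abs y) := rel_of_loops hr (loops_of_sameCycle hy)
    have h4 : r i (Pm.abs (P' y)) := r.trans h3 (hr y)
    rcases contractEmb_surj i x with rfl | rfl | ⟨z, rfl⟩
    · rw [hE.P_p, hp, predAbove_abs_contractEmb]; exact h3
    · rw [hE.P_q, hq, predAbove_abs_contractEmb]; exact h4
    · rw [predAbove_abs_contractEmb]
      by_cases hz : z = y
      · rw [hz, h1, hp]; exact r.symm h3
      by_cases hz' : z = P' y
      · rw [hz', h2, hq]; exact r.symm h4
      rw [hE.P_e z hz hz', predAbove_abs_contractEmb]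
      exact hr z
  · have h3 := hr' (.inr i.castSucc)
    have h4 := hr' (.inl i.succ)
    rw [hE.P_p] at h3
    rw [hE.P_q] at h4
    have h5 : r (Pm.abs (contractEmb i y)) (Pm.abs (contractEmb i (P' y))) :=
      r.trans (r.symm h3) (r.trans hr h4)
    by_cases hz : z = y
    · rw [hz]; exact h5
    by_cases hz' : z = P' y
    · rw [hz', hP'.apply_apply]; exact r.symm h5
    rw [← hE.P_e z hz hz']
    exact hr' _

end

/-- With trivial fibers, joining means that there is a single loop with `delta`. By planarity this
leaves n+1 loops with `gap`, one for each negative point. Conversely, separation forces the pairing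
`gap`, whose cycle runs through all points. -/
theorem joins_iff_of_injective {P : Perm (Pm (n + 1))} (hP : IsPairing P)
    (ht : totalLoops P = n + 2) {f : Fin (n + 1) → ι} (hf : Function.Injective f) :
    Joins f P ↔ SeparatesFibers f P := by
  constructor
  · intro h x y _ _ hxy
    have h1 := h ((loops P (delta (n + 1))).comap Sum.inl) (fun x y hxy => by
      rw [hf hxy]) (fun x => by
        have key : ∀ x : Pm (n + 1), loops P (delta (n + 1)) (.inl (Pm.abs x)) x := by
          intro x
          rcases x with x | x
          · exact Setoid.refl' _ _
          · exact loops_right P (delta (n + 1)) (.inl x)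
        exact (loops P (delta (n + 1))).trans (key x) ((loops P (delta (n + 1))).trans (loops_left _ _ x)
          ((loops P (delta (n + 1))).symm (key (P x)))))
    have h2 : numLoops P (delta (n + 1)) = 1 := by
      rw [numLoops, Nat.card_eq_one_iff_unique]
      refine ⟨⟨fun a b => ?_⟩, ⟨Quotient.mk _ (.inl 0)⟩⟩
      have key : ∀ a : Quotient (loops P (delta (n + 1))), ∃ x, a = Quotient.mk _ (.inl x) := by
        intro a
        induction a using Quotient.inductionOn with
        | h a =>
          rcases a with a | a
          · exact ⟨a, rfl⟩
          · exact ⟨a, Quotient.sound (loops_right P (delta (n + 1)) (.inr a))⟩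
      obtain ⟨a, rfl⟩ := key a
      obtain ⟨b, rfl⟩ := key b
      exact Quotient.sound (Setoid.eq_top_iff.1 h1 a b)
    rw [totalLoops] at ht
    exact separated_of_numLoops (by omega) hxy
  · intro h
    have hlast : ∀ x, IsLast f x := fun x y hy e => hy.ne' (hf e)
    have := eq_gap_of_separated hP fun x y => h x y (hlast x) (hlast y)
    subst this
    intro r _ hr
    rw [Setoid.eq_top_iff]
    intro x y
    refine Quotient.exact (sameCycle_invariant (f := Quotient.mk r) (fun z => ?_)
      (sameCycle_finRotate x y))
    exact Quotient.sound (r.symm (hr (.inr z)))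

/-- Neighbours in a common fiber are removed as in `cumulant_fiberProd`. A planar pairing arises
only from a new edge or a split, since the other insertions fall short of the maximum, and these two
preserve both conditions. -/
theorem joins_iff {P : Perm (Pm (n + 1))} (hP : IsPairing P)
    (ht : totalLoops P = n + 2) {f : Fin (n + 1) → Fin r} (hf : Monotone f) :
    Joins f P ↔ SeparatesFibers f P := by
  induction n with
  | zero => exact joins_iff_of_injective hP ht fun x y _ => Fin.ext (by omega)
  | succ n ih =>
    by_cases hinj : Function.Injective f
    · exact joins_iff_of_injective hP ht hinj
    obtain ⟨i, hi⟩ := exists_eq_of_not_injective hf hinj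
    have hf' := hf.comp (Fin.strictMono_succAbove i.castSucc).monotone
    obtain ⟨P', hP', rfl | ⟨y, rfl⟩⟩ := exists_insert_eq i hP
    · rw [joins_insertEdge hi hP', separatesFibers_iff hi (loops_gap_insertEdge hP').1]
      rw [totalLoops_insertEdge hP'] at ht
      exact ih hP' (by omega) hf'
    · have hs := totalLoops_spec n hP'
      have hδ := isPairing_delta (n + 1)
      by_cases h1 : SameCycle (P' * delta (n + 1)) (.inl i) y
      · rw [joins_insertOn hi hP' h1, separatesFibers_iff hi (loops_gap_insertOn hP' y).1]
        rw [totalLoops_split hP' h1] at ht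
        exact ih hP' (by omega) hf'
      · by_cases h2 : SameCycle (P' * delta (n + 1)) (.inl i) (delta (n + 1) y)
        · rw [totalLoops_twist hP' h2] at ht
          omega
        · have h3 : ¬ loops P' (delta (n + 1)) (.inl i) y := by
            rw [loops_iff hP' hδ]
            rintro (h | h)
            · exact h1 h
            · have := hP'.sameCycle_conj hδ h
              rw [hδ.apply_apply] at this
              exact h2 this
          have := totalLoops_merge hP' h3
          omega

end Joins

/-! ### Assembly -/

section Final

variable {A : Type*} [Ring A] [Algebra ℂ A] (S : RealInfProbSpace A) {n r : ℕ}

theorem eps_mul_dualCumulant (l : List A) : DualNumber.eps * dualCumulant S l =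
    TrivSqZeroExt.inr (listCumulant S l) := by
  rw [eps_mul_eq]
  congr 1
  simp [dualCumulant]

theorem fst_splitExpansion (x y : A) (w : List A) :
    (splitExpansion DualNumber.eps (dualCumulant S) S.t x y w).fst =
      splitExpansion 0 (listCumulant S) S.t x y w := by
  have h := map_splitExpansion (TrivSqZeroExt.fstHom ℂ ℂ ℂ).toRingHom (ε := DualNumber.eps)
    (κ := dualCumulant S) (t := S.t) x y w
  have e1 : (TrivSqZeroExt.fstHom ℂ ℂ ℂ).toRingHom DualNumber.eps = 0 := rfl
  have e2 : (TrivSqZeroExt.fstHom ℂ ℂ ℂ).toRingHom ∘ dualCumulant S = listCumulant S := by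
    funext l; simp [dualCumulant]
  rw [e1, e2] at h
  exact h

open Classical in
/-- The infinitesimal cumulants with products as entries. -/
theorem infCumulant_fiberProd (hS : S.IsTracial) {f : Fin (n + 1) → Fin r} (hf : Monotone f)
    (hsurj : Function.Surjective f) (a : Fin (n + 1) → A) :
    S.infCumulant r (fiberProd f a) =
      ∑ π ∈ NC (n + 1) with SeparatesFibers f (pairOf (blockPerm π)), S.dCumulantPart π a +
        ∑ σ ∈ SNC (n + 1) with SeparatesFibers f (σ * delta (n + 1)), S.cumulantHalf σ a := by
  -- The free cumulants come first, with ε = 0, where the hypotheses multiplied by ε are void.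
  -- Multiplication by ε sees only the free part of `dualCumulant`, so these results provide the
  -- corresponding hypotheses over the dual numbers.
  have hcyc₀ := cumulant_rotate (momentFormula S) S.t_t hS.1 (by simp) (by simp)
  have hrev₀ := cumulant_reverse (momentFormula S) S.t_t S.t_mul S.τ_t hcyc₀
  have hsplit₀ := cumulant_mul_cons (momentFormula S) (mul_zero 0) S.t_t S.t_mul hcyc₀ (by simp)
    (by simp)
  have hrev : ∀ l : List A, DualNumber.eps * dualCumulant S (l.map S.t).reverse =
      DualNumber.eps * dualCumulant S l := fun l => by
    rw [eps_mul_dualCumulant, eps_mul_dualCumulant, hrev₀]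
  have htr : ∀ a b, dualMoment S (a * b) = dualMoment S (b * a) := fun a b => by
    rw [dualMoment, dualMoment, hS.1, hS.2]
  have hcyc := cumulant_rotate (dualMomentFormula S) S.t_t htr (fun l => by
    rw [eps_mul_dualCumulant, eps_mul_dualCumulant, hcyc₀]) hrev
  have hsplit := cumulant_mul_cons (dualMomentFormula S) DualNumber.eps_mul_eps S.t_t S.t_mul hcyc
    hrev fun x y w => by
      rw [eps_mul_dualCumulant, eps_mul_eq, fst_splitExpansion, hsplit₀]
  have hs : ∀ x, extend S.t a (delta (n + 1) x) = S.t (extend S.t a x) := extend_delta S.t_t a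
  have h := congrArg TrivSqZeroExt.snd (cumulant_fiberProd DualNumber.eps_mul_eps S.t_mul hcyc hrev
    hsplit hf hsurj hs)
  rw [snd_sum_weight S _ hs] at h
  refine Eq.trans ?_ h
  rw [dualCumulant, TrivSqZeroExt.snd_add, TrivSqZeroExt.snd_inl, TrivSqZeroExt.snd_inr, zero_add]
  exact (apply_ofFn S.infCumulant _).symm

theorem joins_iff_separates {π : Part (n + 1)} (hπ : π ∈ NC (n + 1)) (c : Composition (n + 1)) :
    sameBlock π ⊔ sameInterval c = ⊤ ↔ SeparatesFibers c.index (pairOf (blockPerm π)) := by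
  have hP := isPairing_pairOf (blockPerm π)
  exact joins_blockPerm.trans
    (joins_iff hP ((totalLoops_eq_iff hP).2 ⟨π, hπ, rfl⟩) (monotone_index c))

end Final

end RealInf

theorem mainTheorem3 {A : Type*} [Ring A] [Algebra ℂ A]
    (S : RealInf.RealInfProbSpace A) (hS : S.IsTracial)
    {m : ℕ} (hm : 0 < m) (c : Composition m) (a : Fin m → A) :
    S.infCumulant c.length (RealInf.consecutiveProducts c a) =
        ∑ π ∈ RealInf.joiningNC c, S.dCumulantPart π a +
          ∑ σ ∈ RealInf.separatingSNC c, S.cumulantHalf σ a ∧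
    ∀ π ∈ RealInf.NC m,
      (RealInf.sameBlock π ⊔ RealInf.sameInterval c = ⊤ ↔
        RealInf.Separates (RealInf.kreweras π) (RealInf.endpoints c)) := by
  classical
  obtain ⟨n, rfl⟩ := Nat.exists_eq_succ_of_ne_zero hm.ne'
  refine ⟨?_, fun π hπ =>
    (RealInf.joins_iff_separates hπ c).trans (RealInf.separates_kreweras c π).symm⟩
  rw [RealInf.consecutiveProducts_eq, RealInf.infCumulant_fiberProd S hS
    (RealInf.monotone_index c) (RealInf.surjective_index c)]
  congr 1
  · refine Finset.sum_congr (Finset.filter_congr fun π hπ => ?_) fun _ _ => rfl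
    exact (RealInf.joins_iff_separates hπ c).symm
  · refine Finset.sum_congr (Finset.filter_congr fun σ hσ => ?_) fun _ _ => rfl
    exact (RealInf.separates_krewerasDelta c (RealInf.mem_SNC_iff.1 hσ).1).symm
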